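/- Let $r>\ell\ge 2$ be integers and put $s=r-\ell$. Let $t_0$ be the integer with $1\le t_0\le s$ and $t_0\equiv r \pmod s$, and let $\lambda=t_0!\,(s-t_0)!$. For $k\ge 1$ let $P_k$ be the $r$-uniform $\ell$-path with $k$ edges, that is, the hypergraph with vertices $0,\dots,\ell+ks-1$ and edges $\{is,\dots,is+r-1\}$ for $0\le i<k$, and set $A_k=\mathrm{Aut}(P_k)/\lambda^k$, where $\mathrm{Aut}(P_k)$ is the number of automorphisms of $P_k$. For $s\mid n$ let $m=n/s$ and let $C_{n}$ be the $r$-uniform $\ell$-cycle on $n$ cyclically ordered vertices, whose $m$ edges are the sets of $r$ consecutive vertices that start at the multiples of $s$. Let $G_r(n,p)$ be the random hypergraph on $n$ vertices in which each $r$-subset is an edge independently with probability $p$, and let $Z$ be the number of copies of $C_{n}$ (Hamilton $\ell$-cycles) in $G_r(n,p)$. Let $C_1,C_2$ be independent uniformly random copies of $C_n$ in the complete $r$-uniform hypergraph on the $n$ vertices, and $|C_1\cap C_2|$ the number of their common edges. Let $n\to\infty$ along the multiples of $s$, and let $p=p(n)\in[0,1]$ satisfy $p=(c_n+o(1))\,\lambda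 e^{s}/n^{s}$ for a bounded sequence of positive reals $c_n$. Suppose that $\mathbb E[Z]\to\infty$. Write $$\Sigma_n=n^{2-\ell}\sum_{1\le k\le\log n}\frac{A_k\,c_n^{-k}e^{-ks}}{s^2}.$$ Then: 1. For every $n>r$ with $s\mid n$ and $p(n)>0$, $$\frac{\mathbb E[Z^2]}{\mathbb E[Z]^2}=\sum_{t=0}^{m}\frac{\mathbb P(|C_1\cap C_2|=t)}{p^t}.$$ 2. $$\frac{\mathbb E[Z^2]}{\mathbb E[Z]^2}\le \exp\bigl((1+o(1))\,\Sigma_n\bigr)+O\!\left(\frac1{\mathbb E[Z]}\right).$$ 3. If moreover $n^{2-\ell}\,\mathbb E[Z]\to\infty$ (which is automatic when $\ell=2$), then $$\frac{\mathbb E[Z^2]}{\mathbb E[Z]^2}\le \exp\bigl((1+o(1))\,\Sigma_n\bigr).$$ 4. If $\ell\ge 3$, then $\mathbb E[Z^2]/\mathbb E[Z]^2=1+o(1)$. -/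

import Mathlib

noncomputable section

namespace RandomHypergraph

open ProbabilityTheory MeasureTheory Filter

/-- The image of a hypergraph (given by its finite set of edges) under a permutation of the
vertices. -/
def relabel {V : Type*} [DecidableEq V] (σ : Equiv.Perm V) (H : Finset (Finset V)) :
    Finset (Finset V) :=
  H.image (fun e => e.map σ.toEmbedding)

/-- `Aut(H)`: the number of permutations of the vertex set that map the edge set of `H` to
itself. -/
def autCount {V : Type*} [Fintype V] [DecidableEq V] (H : Finset (Finset V)) : ℕ :=
  (Finset.univ.filter (fun σ : Equiv.Perm V => relabel σ H = H)).card

/-- The `r`-uniform `ℓ`-path `P_k` with `k` edges: the vertices are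
`0, 1, …, ℓ + k (r - ℓ) - 1`, and for `i < k` the `i`-th edge consists of the `r` consecutive
vertices `i (r - ℓ), …, i (r - ℓ) + r - 1`. -/
def path (r ℓ k : ℕ) : Finset (Finset (Fin (ℓ + k * (r - ℓ)))) :=
  (Finset.range k).image (fun i =>
    Finset.univ.filter (fun v => i * (r - ℓ) ≤ (v : ℕ) ∧ (v : ℕ) < i * (r - ℓ) + r))

/-- The `r`-uniform `ℓ`-cycle on the `n` vertices `0, …, n - 1` (for `r - ℓ ∣ n`): for
`i < n / (r - ℓ)` the `i`-th edge consists of the `r` cyclically consecutive vertices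
`i (r - ℓ), …, i (r - ℓ) + r - 1` modulo `n`. -/
def cycle (r ℓ n : ℕ) : Finset (Finset (Fin n)) :=
  (Finset.range (n / (r - ℓ))).image (fun i =>
    Finset.univ.filter (fun v => ∃ j < r, (i * (r - ℓ) + j) % n = (v : ℕ)))

/-- The set of all copies of the Hamilton `ℓ`-cycle in the complete `r`-uniform hypergraph on
`n` vertices; each copy is given by its set of edges. -/
def copies (r ℓ n : ℕ) : Finset (Finset (Finset (Fin n))) :=
  Finset.univ.image (fun σ : Equiv.Perm (Fin n) => relabel σ (cycle r ℓ n))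

/-- The law of the random hypergraph `G_r(n, p)`: each `r`-element subset of the `n` vertices is
an edge independently with probability `p`. -/
def randomHypergraph (r n : ℕ) (p : unitInterval) : Measure (Set (Finset (Fin n))) :=
  setBernoulli {e : Finset (Fin n) | e.card = r} p

open Classical in
/-- `Z`: the number of Hamilton `ℓ`-cycles contained in the hypergraph with edge set `G`. -/
def hamCount (r ℓ n : ℕ) (G : Set (Finset (Fin n))) : ℕ :=
  ((copies r ℓ n).filter (fun C => (C : Set (Finset (Fin n))) ⊆ G)).card

/-- `E[Z]` in `G_r(n, p)`. -/
def firstMoment (r ℓ n : ℕ) (p : unitInterval) : ℝ :=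
  ∫ G, (hamCount r ℓ n G : ℝ) ∂(randomHypergraph r n p)

/-- `E[Z²]` in `G_r(n, p)`. -/
def secondMoment (r ℓ n : ℕ) (p : unitInterval) : ℝ :=
  ∫ G, (hamCount r ℓ n G : ℝ) ^ 2 ∂(randomHypergraph r n p)

/-- `E[Z²] / E[Z]²`. -/
def momentRatio (r ℓ n : ℕ) (p : unitInterval) : ℝ :=
  secondMoment r ℓ n p / firstMoment r ℓ n p ^ 2

/-- `P(|C₁ ∩ C₂| = t)` for two independent uniformly random copies `C₁, C₂` of the Hamilton
`ℓ`-cycle in the complete `r`-uniform hypergraph, where `|C₁ ∩ C₂|` is the number of common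
edges. -/
def overlapProb (r ℓ n t : ℕ) : ℝ :=
  (((copies r ℓ n ×ˢ copies r ℓ n).filter (fun C => (C.1 ∩ C.2).card = t)).card : ℝ) /
    ((copies r ℓ n).card : ℝ) ^ 2

/-- The integer `t` with `1 ≤ t ≤ r - ℓ` and `t ≡ r` modulo `r - ℓ` (see `residue_unique`). -/
def residue (r ℓ : ℕ) : ℕ := (r - 1) % (r - ℓ) + 1

/-- `residue r ℓ` is the unique `t` with `1 ≤ t ≤ r - ℓ` and `t ≡ r` modulo `r - ℓ`. -/
theorem residue_unique {r ℓ : ℕ} (h : ℓ < r) (t : ℕ) :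
    (1 ≤ t ∧ t ≤ r - ℓ ∧ t ≡ r [MOD (r - ℓ)]) ↔ t = residue r ℓ := by
  have hs : 0 < r - ℓ := by omega
  have hres : residue r ℓ ≡ r [MOD (r - ℓ)] := by
    have h1 : (r - 1) % (r - ℓ) + 1 ≡ (r - 1) + 1 [MOD (r - ℓ)] :=
      Nat.ModEq.add_right 1 (Nat.mod_modEq _ _)
    have h2 : r - 1 + 1 = r := by omega
    rw [h2] at h1
    exact h1
  have hlt : (r - 1) % (r - ℓ) < r - ℓ := Nat.mod_lt _ hs
  constructor
  · rintro ⟨h1, h2, h3⟩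
    have h4 : (t - 1) + 1 ≡ (r - 1) % (r - ℓ) + 1 [MOD (r - ℓ)] := by
      have : t - 1 + 1 = t := by omega
      rw [this]
      exact h3.trans hres.symm
    have h5 := Nat.ModEq.add_right_cancel' 1 h4
    have h6 : t - 1 = (r - 1) % (r - ℓ) := Nat.ModEq.eq_of_lt_of_lt h5 (by omega) hlt
    unfold residue
    omega
  · rintro rfl
    refine ⟨?_, ?_, hres⟩ <;> unfold residue <;> omega

/-- `λ(r, ℓ) = t! (s - t)!` where `s = r - ℓ`, `1 ≤ t ≤ s` and `t ≡ r` modulo `s`. -/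
def lam (r ℓ : ℕ) : ℝ :=
  ((residue r ℓ).factorial * (r - ℓ - residue r ℓ).factorial : ℕ)

/-- `A_k = Aut(P_k) / (t! (s - t)!) ^ k`. -/
def coeffA (r ℓ k : ℕ) : ℝ := (autCount (path r ℓ k) : ℝ) / lam r ℓ ^ k

/-- The main term `λ(r, ℓ) e ^ (r - ℓ) / n ^ (r - ℓ)` of the first moment threshold `p^*(r, ℓ)`. -/
def threshold (r ℓ n : ℕ) : ℝ :=
  lam r ℓ * Real.exp ((r : ℝ) - ℓ) / (n : ℝ) ^ (r - ℓ)

/-- `n ^ (2 - ℓ) ∑_{1 ≤ k ≤ log n} A_k c ^ (-k) e ^ (-k (r - ℓ)) / (r - ℓ) ^ 2`. -/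
def pathSum (r ℓ n : ℕ) (c : ℝ) : ℝ :=
  (n : ℝ) ^ (2 - (ℓ : ℤ)) *
    ∑ k ∈ Finset.Icc 1 ⌊Real.log n⌋₊,
      coeffA r ℓ k * (c ^ k)⁻¹ * Real.exp (-((k : ℝ) * ((r : ℝ) - ℓ))) / ((r : ℝ) - ℓ) ^ 2

/-- `n → ∞` along the multiples of `r - ℓ`. -/
def toInfty (r ℓ : ℕ) : Filter ℕ := atTop ⊓ 𝓟 {n | (r - ℓ) ∣ n}

end RandomHypergraph

end

/-! ### Edges of the cycle as cyclic arcs, and their intersections. -/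

namespace RandomHypergraph

/-! Write `s = r - ℓ`, `C` for the fixed cycle and `q = p / threshold r ℓ n`. By symmetry one of the
two cycles may be fixed, so `E[Z²] / E[Z]²` is the average of `p ^ (-|C ∩ σ C|)` over the
permutations `σ`. It is at most the sum over all `H ⊆ C` of `p ^ (-|H|)` times the probability that
`H ⊆ σ C` (`momentRatio_le_sum_powerset`). If `H` covers `v` vertices, this probability is at most
`embCount C H * (n - v)! / n!` (`card_embMaps_le`). The divergence of `E[Z]` forces `q ≥ 1`
eventually (`firstMoment_le`), so the series in `q ^ (-k) e ^ (-k)` below converge geometrically.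

Sparse `H`, with at least `δ n` uncovered vertices: here `(n - v)! / n!` is `n ^ (-v)` up to a
factor `1 + O(1/n) e ^ ((1 - δ/2) v)` (`fallRatio_le`), and that exponential is small enough to be
charged to the covered vertices without losing convergence. What remains is a weight that is
submultiplicative over disjoint supports. Splitting `H` into clusters of overlapping edges bounds
the whole sum by the exponential of the total cluster weight (`sum_weight_le_exp`). The clusters
that are paths give the main term: there are `m` starts and `m` targets, the image of a path is
again a run of edges so that only `Aut(P_k)` maps remain for each target (`exists_path_aut`), and
`P_k` has `ℓ + k s` vertices; this produces `n ^ (2 - ℓ) A_k q ^ (-k) e ^ (-k s) / s²`. A cluster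
with an interior gap pays `O(1/n)` per gap, since the next run has at most four possible positions
but at least one extra block of vertices (`embCount_union_seg_le_four`, `sum_clusters_le`).
Boundedness of `A_k` (`autCount_path_le_lamNat`) controls the rest.

Dense `H` are compared with `H = C`, whose term is at most `Aut(C) p ^ (-m) / n! = 1 / E[Z]`. Going
round the cycle, a gap of `g` missing edges gains `(C₀ / n ^ s) ^ g` (`C₀` a constant), frees at
most `g s - ℓ` vertices at a cost of `δ n` each, and costs at most `m` positions for the next run.
For small `δ` and `ℓ ≥ 2` this is `O(2 ^ (-g) / n)`, so all patterns of gaps together contribute a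
bounded factor (`sum_denseWeight_le`, `sum_dense_le`).

The resulting term `O(1 / E[Z])` is absorbed in the exponent when `n ^ (2 - ℓ) E[Z]` diverges,
because `pathSum` has order at least `n ^ (2 - ℓ)`. For `ℓ ≥ 3` `pathSum` tends to 0, and the ratio
is never below 1. -/

/-- The set of the `r` cyclically consecutive vertices `i * s, …, i * s + r - 1` modulo `n`. -/
def arc (n s r i : ℕ) : Finset (Fin n) :=
  Finset.univ.filter (fun v => ∃ j < r, (i * s + j) % n = (v : ℕ))

lemma cycle_eq_image_arc (r ℓ n : ℕ) :
    cycle r ℓ n = (Finset.range (n / (r - ℓ))).image (arc n (r - ℓ) r) := rfl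

lemma exists_eq_ofNat_add {n : ℕ} [NeZero n] (a : ℕ) (v : Fin n) :
    ∃ u < n, v = Fin.ofNat n (a + u) := by
  have hn : 0 < n := Nat.pos_of_ne_zero (NeZero.ne n)
  refine ⟨((v : ℕ) + (n - a % n)) % n, Nat.mod_lt _ hn, ?_⟩
  apply Fin.ext
  have h1 : a % n < n := Nat.mod_lt _ hn
  have h2 : (a + ((v : ℕ) + (n - a % n)) % n) ≡ a % n + ((v : ℕ) + (n - a % n)) [MOD n] :=
    Nat.ModEq.add (Nat.mod_modEq _ _).symm (Nat.mod_modEq _ _)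
  have h3 : a % n + ((v : ℕ) + (n - a % n)) = v + n := by omega
  rw [h3] at h2
  have h4 : ((v : ℕ) + n) % n = v := by
    rw [Nat.add_mod_right, Nat.mod_eq_of_lt v.2]
  simp only [Fin.ofNat_eq_cast, Fin.val_natCast]
  rw [h2, h4]

lemma ofNat_add_inj {n : ℕ} [NeZero n] (a : ℕ) {u v : ℕ} (hu : u < n) (hv : v < n)
    (h : Fin.ofNat n (a + u) = Fin.ofNat n (a + v)) : u = v := by
  have h1 := congrArg Fin.val h
  simp only [Fin.ofNat_eq_cast, Fin.val_natCast] at h1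
  have h2 : u ≡ v [MOD n] := Nat.ModEq.add_left_cancel' a h1
  exact Nat.ModEq.eq_of_lt_of_lt h2 hu hv

/-- Counting in positions relative to a base vertex turns cyclic conditions into linear inequalities
on `range n`. -/
lemma card_filter_ofNat {n : ℕ} [NeZero n] (a : ℕ) (P : Fin n → Prop) [DecidablePred P] :
    (Finset.univ.filter P).card =
      ((Finset.range n).filter (fun u => P (Fin.ofNat n (a + u)))).card := by
  symm
  apply Finset.card_bij (fun u _ => Fin.ofNat n (a + u))
  · intro u hu
    simpa using (Finset.mem_filter.1 hu).2
  · intro u hu v hv h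
    exact ofNat_add_inj a (Finset.mem_range.1 (Finset.mem_filter.1 hu).1)
      (Finset.mem_range.1 (Finset.mem_filter.1 hv).1) h
  · intro v hv
    obtain ⟨u, hu, rfl⟩ := exists_eq_ofNat_add a v
    exact ⟨u, Finset.mem_filter.2 ⟨Finset.mem_range.2 hu, (Finset.mem_filter.1 hv).2⟩, rfl⟩

/-- Membership in an arc in coordinates relative to the start of another arc. -/
lemma ofNat_mem_arc {n s r m x t u : ℕ} [NeZero n] (hn : n = m * s) (hr : r ≤ n) (ht : t < m)
    (hu : u < n) :
    Fin.ofNat n (x * s + u) ∈ arc n s r (x + t) ↔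
      (t * s ≤ u ∧ u < t * s + r) ∨ u + n < t * s + r := by
  have hs : 0 < s := by
    rcases Nat.eq_zero_or_pos s with h | h
    · subst h; simp at hn; omega
    · exact h
  have hT : t * s < n := by rw [hn]; exact Nat.mul_lt_mul_of_pos_right ht hs
  simp only [arc, Finset.mem_filter, Finset.mem_univ, true_and, Fin.ofNat_eq_cast, Fin.val_natCast]
  have key : ∀ j, ((x + t) * s + j) % n = (x * s + u) % n ↔ (t * s + j) % n = u := by
    intro j
    have e : (x + t) * s + j = x * s + (t * s + j) := by ring
    rw [e]
    constructor
    · intro h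
      have h2 : t * s + j ≡ u [MOD n] := Nat.ModEq.add_left_cancel' _ h
      rw [← Nat.mod_eq_of_lt hu]; exact h2
    · intro h
      refine Nat.ModEq.add_left (x * s) (?_ : (t * s + j) % n = u % n)
      rw [h, Nat.mod_eq_of_lt hu]
  simp only [key]
  generalize t * s = T at *
  constructor
  · rintro ⟨j, hj, h⟩
    rcases lt_or_ge (T + j) n with h1 | h1
    · rw [Nat.mod_eq_of_lt h1] at h; omega
    · rw [Nat.mod_eq_sub_mod h1, Nat.mod_eq_of_lt (by omega)] at h; omega
  · rintro (⟨h1, h2⟩ | h1)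
    · exact ⟨u - T, by omega, by rw [Nat.mod_eq_of_lt (by omega)]; omega⟩
    · refine ⟨u + n - T, by omega, ?_⟩
      have : T + (u + n - T) = u + n := by omega
      rw [this, Nat.add_mod_right, Nat.mod_eq_of_lt hu]

/-- Membership in an arc away from the wrap-around. -/
lemma ofNat_mem_arc_of_le {n s r m x t u : ℕ} [NeZero n] (hn : n = m * s) (hr : r ≤ n)
    (ht : t * s + r ≤ n) (hr0 : 0 < r) (hu : u < n) :
    Fin.ofNat n (x * s + u) ∈ arc n s r (x + t) ↔ t * s ≤ u ∧ u < t * s + r := by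
  have htm : t < m := by
    by_contra h
    have : m * s ≤ t * s := Nat.mul_le_mul_right s (by omega)
    omega
  rw [ofNat_mem_arc hn hr htm hu]
  omega

lemma arc_congr {n s r m i j : ℕ} (hn : n = m * s) (h : i ≡ j [MOD m]) :
    arc n s r i = arc n s r j := by
  ext v
  simp only [arc, Finset.mem_filter, Finset.mem_univ, true_and]
  have : ∀ k, (i * s + k) % n = (j * s + k) % n := fun k => by
    have h1 : i * s ≡ j * s [MOD n] := by rw [hn]; exact Nat.ModEq.mul_right' s h
    exact Nat.ModEq.add_right k h1
  simp [this]

lemma arc_mod {n s r m : ℕ} (hn : n = m * s) (i : ℕ) : arc n s r (i % m) = arc n s r i :=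
  arc_congr hn (Nat.mod_modEq _ _)

lemma arc_mem_cycle {n r ℓ m : ℕ} (hs : 0 < r - ℓ) (hm : 0 < m) (hn : n = m * (r - ℓ)) (i : ℕ) :
    arc n (r - ℓ) r i ∈ cycle r ℓ n := by
  rw [cycle_eq_image_arc, ← arc_mod hn i]
  refine Finset.mem_image_of_mem _ (Finset.mem_range.2 ?_)
  rw [hn, Nat.mul_div_cancel _ hs]
  exact Nat.mod_lt _ hm

lemma mem_cycle_iff {n r ℓ m : ℕ} (hs : 0 < r - ℓ) (hn : n = m * (r - ℓ)) (e : Finset (Fin n)) :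
    e ∈ cycle r ℓ n ↔ ∃ i < m, arc n (r - ℓ) r i = e := by
  rw [cycle_eq_image_arc]
  have : n / (r - ℓ) = m := by rw [hn, Nat.mul_div_cancel _ hs]
  rw [this]
  simp

lemma exists_add_modEq {m : ℕ} (hm : 0 < m) (x y : ℕ) : ∃ t < m, x + t ≡ y [MOD m] := by
  have : NeZero m := ⟨hm.ne'⟩
  obtain ⟨u, hu, h⟩ := exists_eq_ofNat_add x (Fin.ofNat m y)
  refine ⟨u, hu, ?_⟩
  have h1 := congrArg Fin.val h
  simp only [Fin.ofNat_eq_cast, Fin.val_natCast] at h1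
  exact h1.symm

lemma card_arc {n s r m x : ℕ} (hn : n = m * s) (hr : r ≤ n) (hm : 0 < m) (hs : 0 < s) :
    (arc n s r x).card = r := by
  have hn0 : 0 < n := by rw [hn]; positivity
  have : NeZero n := ⟨hn0.ne'⟩
  have h1 : arc n s r x = Finset.univ.filter (fun v => v ∈ arc n s r (x + 0)) := by simp
  rw [h1, card_filter_ofNat (x * s)]
  have : (Finset.range n).filter (fun u => Fin.ofNat n (x * s + u) ∈ arc n s r (x + 0)) =
      Finset.range r := by
    ext u
    simp only [Finset.mem_filter, Finset.mem_range]
    constructor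
    · rintro ⟨hu, h⟩
      rw [ofNat_mem_arc hn hr hm hu] at h; omega
    · intro h
      refine ⟨by omega, ?_⟩
      rw [ofNat_mem_arc hn hr hm (by omega)]; omega
  rw [this, Finset.card_range]

lemma arc_injOn {n s r m : ℕ} (hn : n = m * s) (hr : r < n) (hr0 : 0 < r) (hs : 0 < s) {i j : ℕ}
    (h : arc n s r i = arc n s r j) : i ≡ j [MOD m] := by
  have hm : 0 < m := by
    rcases Nat.eq_zero_or_pos m with h | h
    · subst h; simp at hn; omega
    · exact h
  have hn0 : 0 < n := by omega
  have : NeZero n := ⟨hn0.ne'⟩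
  obtain ⟨t, ht, htj⟩ := exists_add_modEq hm i j
  rw [← arc_congr hn htj] at h
  rcases Nat.eq_zero_or_pos t with h0 | h0
  · subst h0; exact htj
  exfalso
  have hT : t * s < n := by rw [hn]; exact Nat.mul_lt_mul_of_pos_right ht hs
  have hT0 : 0 < t * s := by positivity
  have key : ∀ u < n, (u < r ↔ (t * s ≤ u ∧ u < t * s + r) ∨ u + n < t * s + r) := by
    intro u hu
    rw [← ofNat_mem_arc (x := i) hn hr.le ht hu, ← h]
    have := ofNat_mem_arc (x := i) hn hr.le hm hu
    simp only [add_zero, zero_mul, zero_le, true_and, zero_add] at this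
    rw [this]; omega
  generalize t * s = T at *
  -- The start `T` of the second arc lies in the first, so `T - 1` does too. But the vertex just
  -- before its start lies in the second arc only if that arc goes all the way round, that is if `n
  -- ≤ r`.
  have h1 := key 0 hn0
  have h2 := key T hT
  have h3 := key (T - 1) (by omega)
  omega

/-- The size of the intersection of two edges of the cycle determines their cyclic distance. -/
lemma modEq_of_card_arc_inter {n s r m d i j : ℕ} (hn : n = m * s) (hr : 2 * r ≤ n) (hs : 0 < s)
    (hdr : d * s < r) (h : (arc n s r i ∩ arc n s r j).card = r - d * s) :
    i + d ≡ j [MOD m] ∨ j + d ≡ i [MOD m] := by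
  have hm : 0 < m := by
    rcases Nat.eq_zero_or_pos m with h | h
    · subst h; simp at hn; omega
    · exact h
  have hn0 : 0 < n := by omega
  have : NeZero n := ⟨hn0.ne'⟩
  obtain ⟨t, ht, htj⟩ := exists_add_modEq hm i j
  rw [← arc_congr hn htj] at h
  have hT : t * s < n := by rw [hn]; exact Nat.mul_lt_mul_of_pos_right ht hs
  have h1 : arc n s r i ∩ arc n s r (i + t) =
      Finset.univ.filter (fun v => v ∈ arc n s r (i + 0) ∧ v ∈ arc n s r (i + t)) := by
    ext v; simp
  have key : ∀ u < n, (Fin.ofNat n (i * s + u) ∈ arc n s r (i + 0) ∧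
      Fin.ofNat n (i * s + u) ∈ arc n s r (i + t) ↔
      (u < r ∧ ((t * s ≤ u ∧ u < t * s + r) ∨ u + n < t * s + r))) := by
    intro u hu
    rw [ofNat_mem_arc hn (by omega) hm hu, ofNat_mem_arc hn (by omega) ht hu]
    omega
  rw [h1, card_filter_ofNat (i * s)] at h
  -- Since `2 r ≤ n`, two arcs cannot meet on both sides. If `t s < r` the overlap is ahead of `i`;
  -- otherwise it can only come from the second arc wrapping round.
  rcases lt_or_ge (t * s) r with hlt | hge
  · have e : (Finset.range n).filter (fun u => Fin.ofNat n (i * s + u) ∈ arc n s r (i + 0) ∧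
      Fin.ofNat n (i * s + u) ∈ arc n s r (i + t)) = Finset.Ico (t * s) r := by
      ext u
      simp only [Finset.mem_filter, Finset.mem_range, Finset.mem_Ico]
      constructor
      · rintro ⟨hu, h⟩
        rw [key u hu] at h; omega
      · intro h
        refine ⟨by omega, ?_⟩
        rw [key u (by omega)]; omega
    rw [e, Nat.card_Ico] at h
    have h2 : t * s = d * s := by omega
    have h3 : t = d := Nat.eq_of_mul_eq_mul_right hs h2
    left; rw [← h3]; exact htj
  · have e : (Finset.range n).filter (fun u => Fin.ofNat n (i * s + u) ∈ arc n s r (i + 0) ∧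
      Fin.ofNat n (i * s + u) ∈ arc n s r (i + t)) = Finset.range (t * s + r - n) := by
      ext u
      simp only [Finset.mem_filter, Finset.mem_range]
      constructor
      · rintro ⟨hu, h⟩
        rw [key u hu] at h; omega
      · intro h
        refine ⟨by omega, ?_⟩
        rw [key u (by omega)]; omega
    rw [e, Finset.card_range] at h
    have h2 : t * s + d * s = m * s := by omega
    have h3 : t + d = m := by
      apply Nat.eq_of_mul_eq_mul_right hs
      rw [add_mul, h2]
    right
    calc j + d ≡ i + t + d [MOD m] := Nat.ModEq.add_right d htj.symm
      _ = i + m := by omega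
      _ ≡ i [MOD m] := by simp [Nat.ModEq]

/-- The size of the intersection of two overlapping edges of the cycle. -/
lemma card_arc_inter {n s r m d i : ℕ} (hn : n = m * s) (hr : 2 * r ≤ n)
    (hdr : d * s < r) : (arc n s r i ∩ arc n s r (i + d)).card = r - d * s := by
  have hm : 0 < m := by
    rcases Nat.eq_zero_or_pos m with h | h
    · subst h; simp at hn; omega
    · exact h
  have hn0 : 0 < n := by omega
  have : NeZero n := ⟨hn0.ne'⟩
  have h1 : arc n s r i ∩ arc n s r (i + d) =
      Finset.univ.filter (fun v => v ∈ arc n s r (i + 0) ∧ v ∈ arc n s r (i + d)) := by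
    ext v; simp
  have key : ∀ u < n, (Fin.ofNat n (i * s + u) ∈ arc n s r (i + 0) ∧
      Fin.ofNat n (i * s + u) ∈ arc n s r (i + d) ↔ d * s ≤ u ∧ u < r) := by
    intro u hu
    rw [ofNat_mem_arc_of_le hn (by omega) (by omega) (by omega) hu,
      ofNat_mem_arc_of_le hn (by omega) (by omega) (by omega) hu]
    omega
  rw [h1, card_filter_ofNat (i * s)]
  have e : (Finset.range n).filter (fun u => Fin.ofNat n (i * s + u) ∈ arc n s r (i + 0) ∧
      Fin.ofNat n (i * s + u) ∈ arc n s r (i + d)) = Finset.Ico (d * s) r := by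
    ext u
    simp only [Finset.mem_filter, Finset.mem_range, Finset.mem_Ico]
    constructor
    · rintro ⟨hu, h⟩
      rwa [key u hu] at h
    · intro h
      refine ⟨by omega, ?_⟩
      rwa [key u (by omega)]
  rw [e, Nat.card_Ico]

end RandomHypergraph

/-! ### Counting embeddings by restricting permutations to the covered vertices. -/

namespace RandomHypergraph

variable {V : Type*} [Fintype V] [DecidableEq V]

/-- The permutations mapping every edge of `H` to an edge of `C`. -/
def embMaps (C H : Finset (Finset V)) : Finset (Equiv.Perm V) :=
  Finset.univ.filter (fun σ => ∀ e ∈ H, e.map σ.toEmbedding ∈ C)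

/-- The vertices covered by the edges of `H`. -/
def supp (H : Finset (Finset V)) : Finset V := H.biUnion id

/-- The restriction of a permutation to a set of vertices. -/
def restr (S : Finset V) (σ : Equiv.Perm V) : V → Option V :=
  fun v => if v ∈ S then some (σ v) else none

/-- The number of embeddings of `H` into `C` that are restrictions of permutations. -/
def embCount (C H : Finset (Finset V)) : ℕ := ((embMaps C H).image (restr (supp H))).card

lemma mem_embMaps {C H : Finset (Finset V)} {σ : Equiv.Perm V} :
    σ ∈ embMaps C H ↔ ∀ e ∈ H, e.map σ.toEmbedding ∈ C := by simp [embMaps]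

omit [Fintype V] in
lemma restr_eq_iff {S : Finset V} {σ τ : Equiv.Perm V} :
    restr S σ = restr S τ ↔ ∀ v ∈ S, σ v = τ v := by
  constructor
  · intro h v hv
    have := congrFun h v
    simpa [restr, hv] using this
  · intro h
    funext v
    by_cases hv : v ∈ S
    · simp [restr, hv, h v hv]
    · simp [restr, hv]

omit [Fintype V] in
lemma mem_supp {H : Finset (Finset V)} {v : V} : v ∈ supp H ↔ ∃ e ∈ H, v ∈ e := by
  simp [supp]

omit [Fintype V] in
lemma supp_union (H H' : Finset (Finset V)) : supp (H ∪ H') = supp H ∪ supp H' := by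
  ext v; simp only [mem_supp, Finset.mem_union]
  constructor
  · rintro ⟨e, h | h, hv⟩
    · exact Or.inl ⟨e, h, hv⟩
    · exact Or.inr ⟨e, h, hv⟩
  · rintro (⟨e, h, hv⟩ | ⟨e, h, hv⟩)
    · exact ⟨e, Or.inl h, hv⟩
    · exact ⟨e, Or.inr h, hv⟩

omit [Fintype V] in
lemma supp_mono {H H' : Finset (Finset V)} (h : H ⊆ H') : supp H ⊆ supp H' :=
  Finset.biUnion_subset_biUnion_of_subset_left _ h

lemma embMaps_mono {C H H' : Finset (Finset V)} (h : H ⊆ H') : embMaps C H' ⊆ embMaps C H := by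
  intro σ hσ
  rw [mem_embMaps] at hσ ⊢
  exact fun e he => hσ e (h he)

/-- A map on the union of two supports is the pair of its restrictions; `c` bounds the number of
second components once the first is fixed. -/
lemma embCount_union_le {C H H' : Finset (Finset V)} {c : ℕ}
    (h : ∀ τ ∈ embMaps C (H ∪ H'), (((embMaps C (H ∪ H')).filter
      (fun σ => restr (supp H) σ = restr (supp H) τ)).image (restr (supp H'))).card ≤ c) :
    embCount C (H ∪ H') ≤ embCount C H * c := by
  classical
  set X := embMaps C (H ∪ H') with hX
  set Y := X.image (fun σ => (restr (supp H) σ, restr (supp H') σ)) with hY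
  have h1 : embCount C (H ∪ H') ≤ Y.card := by
    unfold embCount
    rw [← hX]
    let g : (V → Option V) × (V → Option V) → (V → Option V) := fun x v =>
      if v ∈ supp H then x.1 v else x.2 v
    have : X.image (restr (supp (H ∪ H'))) ⊆ Y.image g := by
      intro f hf
      obtain ⟨σ, hσ, rfl⟩ := Finset.mem_image.1 hf
      refine Finset.mem_image.2 ⟨_, Finset.mem_image_of_mem _ hσ, ?_⟩
      funext v
      by_cases hv : v ∈ supp H <;> by_cases hv' : v ∈ supp H' <;>
        simp [g, restr, supp_union, hv, hv']
    exact (Finset.card_le_card this).trans Finset.card_image_le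
  have h2 : Y.card ≤ c * (Y.image Prod.fst).card := by
    apply Finset.card_le_mul_card_image
    intro a ha
    obtain ⟨y, hy, rfl⟩ := Finset.mem_image.1 ha
    obtain ⟨τ, hτ, rfl⟩ := Finset.mem_image.1 hy
    refine le_trans ?_ (h τ hτ)
    apply Finset.card_le_card_of_injOn Prod.snd
    · intro z hz
      obtain ⟨hz1, hz2⟩ := Finset.mem_filter.1 (Finset.mem_coe.1 hz)
      obtain ⟨σ, hσ, rfl⟩ := Finset.mem_image.1 hz1
      refine Finset.mem_coe.2 (Finset.mem_image.2 ⟨σ, Finset.mem_filter.2 ⟨hσ, hz2⟩, rfl⟩)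
    · intro z hz w hw hzw
      have h1 := (Finset.mem_filter.1 (Finset.mem_coe.1 hz)).2
      have h2 := (Finset.mem_filter.1 (Finset.mem_coe.1 hw)).2
      exact Prod.ext (h1.trans h2.symm) hzw
  have h3 : (Y.image Prod.fst).card ≤ embCount C H := by
    apply Finset.card_le_card
    intro f hf
    obtain ⟨y, hy, rfl⟩ := Finset.mem_image.1 hf
    obtain ⟨σ, hσ, rfl⟩ := Finset.mem_image.1 hy
    exact Finset.mem_image_of_mem _ (embMaps_mono Finset.subset_union_left hσ)
  calc _ ≤ _ := h1
    _ ≤ _ := h2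
    _ ≤ c * embCount C H := Nat.mul_le_mul_left _ h3
    _ = _ := mul_comm _ _

lemma embCount_union_le_mul (C H H' : Finset (Finset V)) :
    embCount C (H ∪ H') ≤ embCount C H * embCount C H' := by
  apply embCount_union_le
  intro τ _
  apply Finset.card_le_card
  exact Finset.image_subset_image
    ((Finset.filter_subset _ _).trans (embMaps_mono Finset.subset_union_right))

lemma embCount_empty (C : Finset (Finset V)) : embCount C ∅ ≤ 1 := by
  unfold embCount
  rw [Finset.card_le_one]
  intro a ha b hb
  obtain ⟨σ, _, rfl⟩ := Finset.mem_image.1 ha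
  obtain ⟨τ, _, rfl⟩ := Finset.mem_image.1 hb
  rw [restr_eq_iff]
  intro v hv
  simp [supp] at hv

lemma card_perm_fixing (S : Finset V) :
    (Finset.univ.filter (fun σ : Equiv.Perm V => ∀ v ∈ S, σ v = v)).card =
      (Fintype.card V - S.card).factorial := by
  classical
  have e := Equiv.Perm.subtypeEquivSubtypePerm (fun v : V => v ∉ S)
  have h1 : (Finset.univ.filter (fun σ : Equiv.Perm V => ∀ v ∈ S, σ v = v)).card =
      Fintype.card {f : Equiv.Perm V // ∀ a, ¬ (a ∉ S) → f a = a} := by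
    rw [Fintype.card_subtype]
    congr 1
    ext σ
    simp
  rw [h1, ← Fintype.card_congr e, Fintype.card_perm, Fintype.card_subtype_compl]
  simp

/-- Permutations with the same restriction to `supp H` lie in one coset of the pointwise stabilizer
of `supp H`. -/
lemma card_embMaps_le (C H : Finset (Finset V)) :
    (embMaps C H).card ≤ embCount C H * (Fintype.card V - (supp H).card).factorial := by
  classical
  rw [mul_comm]
  apply Finset.card_le_mul_card_image
  intro a ha
  obtain ⟨τ, hτ, rfl⟩ := Finset.mem_image.1 ha
  rw [← card_perm_fixing (supp H)]
  apply Finset.card_le_card_of_injOn (fun σ => τ⁻¹ * σ)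
  · intro σ hσ
    have h1 := restr_eq_iff.1 (Finset.mem_filter.1 (Finset.mem_coe.1 hσ)).2
    simp only [Finset.coe_filter, Finset.mem_univ, true_and, Set.mem_ofPred_eq]
    intro v hv
    simp [h1 v hv]
  · intro σ _ σ' _ h
    exact mul_left_cancel h

end RandomHypergraph

/-! ### Rigidity of runs of consecutive edges. -/

namespace RandomHypergraph

/-- Bounding a number of values by a number of codes: `f a` only has to be determined by some code
of `a`, so no canonical code need be singled out. -/
lemma card_image_le_of_relation {α β γ : Type*} [DecidableEq β] {A : Finset α} {f : α → β}
    {T : Finset γ} (R : α → γ → Prop) (h1 : ∀ a ∈ A, ∃ c ∈ T, R a c)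
    (h2 : ∀ a ∈ A, ∀ b ∈ A, ∀ c, R a c → R b c → f a = f b) : (A.image f).card ≤ T.card := by
  classical
  rcases T.eq_empty_or_nonempty with rfl | ⟨c0, hc0⟩
  · have : A = ∅ := by
      rw [Finset.eq_empty_iff_forall_notMem]
      intro a ha
      obtain ⟨c, hc, _⟩ := h1 a ha
      simp at hc
    simp [this]
  have h3 : ∀ b, ∃ c, b ∈ A.image f → c ∈ T ∧ ∃ a ∈ A, f a = b ∧ R a c := by
    intro b
    by_cases hb : b ∈ A.image f
    · obtain ⟨a, ha, rfl⟩ := Finset.mem_image.1 hb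
      obtain ⟨c, hc, hR⟩ := h1 a ha
      exact ⟨c, fun _ => ⟨hc, a, ha, rfl, hR⟩⟩
    · exact ⟨c0, fun h => absurd h hb⟩
  choose g hg using h3
  apply Finset.card_le_card_of_injOn g
  · exact fun b hb => (hg b hb).1
  · intro b hb b' hb' h
    obtain ⟨_, a, ha1, ha2, ha3⟩ := hg b hb
    obtain ⟨_, a', hb1, hb2, hb3⟩ := hg b' hb'
    rw [← ha2, ← hb2]
    exact h2 _ ha1 _ hb1 (g b) ha3 (h ▸ hb3)

/-- A self-avoiding walk with steps `±d` in a commutative group goes straight. -/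
lemma straight_walk {G : Type*} [AddCommGroup G] {f : ℕ → G} {d : G} {k : ℕ}
    (hf : ∀ i, i + 1 < k → f (i + 1) = f i + d ∨ f (i + 1) = f i - d)
    (hinj : ∀ i < k, ∀ j < k, f i = f j → i = j) :
    (∀ i < k, f i = f 0 + i • d) ∨ (∀ i < k, f i = f 0 - i • d) := by
  induction k with
  | zero => left; intro i hi; omega
  | succ k ih =>
    have ih' := ih (fun i hi => hf i (by omega)) (fun i hi j hj => hinj i (by omega) j (by omega))
    rcases Nat.lt_or_ge k 2 with hk | hk
    · rcases Nat.eq_zero_or_pos k with h0 | h0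
      · left; intro i hi
        have : i = 0 := by omega
        subst this; simp
      · have hk1 : k = 1 := by omega
        subst hk1
        rcases hf 0 (by omega) with h | h
        · left; intro i hi
          rcases (show i = 0 ∨ i = 1 by omega) with rfl | rfl
          · simp
          · simpa using h
        · right; intro i hi
          rcases (show i = 0 ∨ i = 1 by omega) with rfl | rfl
          · simp
          · simpa using h
    · obtain ⟨j, rfl⟩ : ∃ j, k = j + 2 := ⟨k - 2, by omega⟩
      have hstep := hf (j + 1) (by omega)
      -- A change of direction would return the walk to its last but one point.
      have hne : f (j + 1 + 1) ≠ f j := fun h => by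
        have := hinj (j + 1 + 1) (by omega) j (by omega) h
        omega
      rcases ih' with h | h
      · left
        have e : f (j + 1) = f j + d := by
          rw [h (j + 1) (by omega), h j (by omega), succ_nsmul]; abel
        rcases hstep with h1 | h1
        · intro i hi
          rcases (show i < j + 2 ∨ i = j + 2 by omega) with h2 | rfl
          · exact h i h2
          · rw [h1, h (j + 1) (by omega), succ_nsmul _ (j + 1)]; abel
        · exact absurd (by rw [h1, e]; abel) hne
      · right
        have e : f (j + 1) = f j - d := by
          rw [h (j + 1) (by omega), h j (by omega), succ_nsmul]; abel
        rcases hstep with h1 | h1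
        · exact absurd (by rw [h1, e]; abel) hne
        · intro i hi
          rcases (show i < j + 2 ∨ i = j + 2 by omega) with h2 | rfl
          · exact h i h2
          · rw [h1, h (j + 1) (by omega), succ_nsmul _ (j + 1)]; abel

lemma card_filter_interval {N a b : ℕ} (h : b ≤ N) :
    (Finset.univ.filter (fun v : Fin N => a ≤ (v : ℕ) ∧ (v : ℕ) < b)).card = b - a := by
  rw [← Nat.card_Ico]
  apply Finset.card_bij (fun (v : Fin N) _ => (v : ℕ))
  · intro v hv
    simpa using hv
  · intro v _ w _ h
    exact Fin.ext h
  · intro v hv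
    rw [Finset.mem_Ico] at hv
    exact ⟨⟨v, by omega⟩, by simpa using hv, rfl⟩

/-- The set of `k` consecutive edges of the cycle from the edge `x` on. -/
def seg (n s r x k : ℕ) : Finset (Finset (Fin n)) :=
  (Finset.range k).image (fun i => arc n s r (x + i))

/-- The hypotheses on the parameters under which the cycle has the expected local structure. -/
structure Params (r ℓ n m : ℕ) : Prop where
  pos : 0 < ℓ
  lt : ℓ < r
  eq : n = m * (r - ℓ)
  two_le : 2 * r ≤ n

namespace Params

variable {r ℓ n m : ℕ} (P : Params r ℓ n m)
include P

lemma s_pos : 0 < r - ℓ := by have := P.lt; omega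

lemma n_pos : 0 < n := by have := P.lt; have := P.two_le; omega

lemma m_pos : 0 < m := by
  have := P.n_pos
  rw [P.eq] at this
  exact Nat.pos_of_mul_pos_right this

lemma neZero : NeZero n := ⟨P.n_pos.ne'⟩

lemma neZero_m : NeZero m := ⟨P.m_pos.ne'⟩

lemma arc_inj {i j : ℕ} (h : arc n (r - ℓ) r i = arc n (r - ℓ) r j) : i ≡ j [MOD m] :=
  arc_injOn P.eq (by have := P.two_le; have := P.lt; omega) (by have := P.lt; omega) P.s_pos h

lemma lt_m {k : ℕ} (hk : ℓ + k * (r - ℓ) ≤ n) : k < m := by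
  by_contra h
  have h1 : m * (r - ℓ) ≤ k * (r - ℓ) := Nat.mul_le_mul_right _ (by omega)
  have := P.eq
  have := P.pos
  omega

end Params

/-- Consecutive edges meet in `ℓ` vertices, and edges of the cycle meeting in `ℓ` vertices are
neighbours. Hence the images of the edges of the run form a self-avoiding walk with steps `±1`,
which goes straight, and the image is again a run. Here `y` is its first index, the alternative
records the orientation, and in coordinates relative to the two starts `σ` is an automorphism of
`P_k`. -/
lemma exists_path_aut {r ℓ n m : ℕ} (P : Params r ℓ n m) [NeZero n] {x k : ℕ} (hk0 : 0 < k)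
    (hk : ℓ + k * (r - ℓ) ≤ n) {σ : Equiv.Perm (Fin n)}
    (hσ : σ ∈ embMaps (cycle r ℓ n) (seg n (r - ℓ) r x k)) :
    ∃ y < m, (arc n (r - ℓ) r y = (arc n (r - ℓ) r x).map σ.toEmbedding ∨
        arc n (r - ℓ) r (y + (k - 1)) = (arc n (r - ℓ) r x).map σ.toEmbedding) ∧
      ∃ g : Equiv.Perm (Fin (ℓ + k * (r - ℓ))), relabel g (path r ℓ k) = path r ℓ k ∧
        ∀ u : Fin (ℓ + k * (r - ℓ)),
          σ (Fin.ofNat n (x * (r - ℓ) + u)) = Fin.ofNat n (y * (r - ℓ) + g u) := by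
  have hℓ := P.pos
  have hlt := P.lt
  have h2r := P.two_le
  have hs := P.s_pos
  have hkm := P.lt_m hk
  have hm := P.m_pos
  have := P.neZero_m
  rw [mem_embMaps] at hσ
  have hidx : ∀ i, ∃ f, i < k → f < m ∧
      (arc n (r - ℓ) r (x + i)).map σ.toEmbedding = arc n (r - ℓ) r f := by
    intro i
    by_cases hi : i < k
    · have h1 := hσ (arc n (r - ℓ) r (x + i))
        (Finset.mem_image.2 ⟨i, Finset.mem_range.2 hi, rfl⟩)
      rw [mem_cycle_iff hs P.eq] at h1
      obtain ⟨f, hf, h2⟩ := h1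
      exact ⟨f, fun _ => ⟨hf, h2.symm⟩⟩
    · exact ⟨0, fun h => absurd h hi⟩
  choose f hf using hidx
  have hwalk : (∀ i < k, ((f i : ℕ) : ZMod m) = (f 0 : ZMod m) + i • (1 : ZMod m)) ∨
      (∀ i < k, ((f i : ℕ) : ZMod m) = (f 0 : ZMod m) - i • (1 : ZMod m)) := by
    apply straight_walk (f := fun i => ((f i : ℕ) : ZMod m))
    · intro i hi
      have h1 := (hf i (by omega)).2
      have h2 := (hf (i + 1) hi).2
      have h3 : (arc n (r - ℓ) r (f i) ∩ arc n (r - ℓ) r (f (i + 1))).card = r - 1 * (r - ℓ) := by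
        rw [← h1, ← h2, ← Finset.map_inter, Finset.card_map, ← add_assoc]
        exact card_arc_inter P.eq h2r (by omega)
      rcases modEq_of_card_arc_inter P.eq h2r hs (by omega) h3 with h4 | h4
      · left
        have := (ZMod.natCast_eq_natCast_iff _ _ _).2 h4
        push_cast at this
        exact this.symm
      · right
        have := (ZMod.natCast_eq_natCast_iff _ _ _).2 h4
        push_cast at this
        rw [← this]; ring
    · intro i hi j hj h
      have h1 := (ZMod.natCast_eq_natCast_iff _ _ _).1 h
      have h2 : arc n (r - ℓ) r (x + i) = arc n (r - ℓ) r (x + j) := by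
        apply Finset.map_injective σ.toEmbedding
        rw [(hf i hi).2, (hf j hj).2]
        exact arc_congr P.eq h1
      have h3 := Nat.ModEq.add_left_cancel' x (P.arc_inj h2)
      exact Nat.ModEq.eq_of_lt_of_lt h3 (by omega) (by omega)
  -- the image is again a set of consecutive edges
  obtain ⟨y, hy, hyx, hyi⟩ : ∃ y < m, (arc n (r - ℓ) r y = (arc n (r - ℓ) r x).map σ.toEmbedding ∨
        arc n (r - ℓ) r (y + (k - 1)) = (arc n (r - ℓ) r x).map σ.toEmbedding) ∧
      ∀ i < k, ∃ j < k, (arc n (r - ℓ) r (x + i)).map σ.toEmbedding =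
        arc n (r - ℓ) r (y + j) := by
    have h0 := hf 0 hk0
    rcases hwalk with h | h
    · refine ⟨f 0, h0.1, Or.inl ?_, ?_⟩
      · simpa using h0.2.symm
      · intro i hi
        refine ⟨i, hi, ?_⟩
        rw [(hf i hi).2]
        apply arc_congr P.eq
        rw [← ZMod.natCast_eq_natCast_iff, h i hi]
        push_cast; simp
    -- If the walk runs backwards, the image run starts with the image of the last edge, `k - 1`
    -- steps before `f 0`.
    · obtain ⟨y, hy, hy'⟩ := exists_add_modEq hm (k - 1) (f 0)
      have hy2 : ((k - 1 : ℕ) : ZMod m) + y = f 0 := by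
        have := (ZMod.natCast_eq_natCast_iff _ _ _).2 hy'
        push_cast at this
        exact this
      refine ⟨y, hy, Or.inr ?_, ?_⟩
      · have := h0.2
        rw [add_zero] at this
        rw [this]
        apply arc_congr P.eq
        rw [add_comm]; exact hy'
      · intro i hi
        refine ⟨k - 1 - i, by omega, ?_⟩
        rw [(hf i hi).2]
        apply arc_congr P.eq
        rw [← ZMod.natCast_eq_natCast_iff, h i hi, ← hy2]
        rw [Nat.cast_add, Nat.cast_sub (show i ≤ k - 1 by omega)]
        simp only [nsmul_eq_mul, mul_one]
        ring
  refine ⟨y, hy, hyx, ?_⟩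
  -- the edge containing a vertex
  have hle : ∀ i < k, i * (r - ℓ) + r ≤ ℓ + k * (r - ℓ) := by
    intro i hi
    have : (i + 1) * (r - ℓ) ≤ k * (r - ℓ) := Nat.mul_le_mul_right _ hi
    rw [add_mul] at this
    omega
  have hmem : ∀ z, ∀ i < k, ∀ u < n, (Fin.ofNat n (z * (r - ℓ) + u) ∈ arc n (r - ℓ) r (z + i) ↔
      i * (r - ℓ) ≤ u ∧ u < i * (r - ℓ) + r) := by
    intro z i hi u hu
    exact ofNat_mem_arc_of_le P.eq (by omega) ((hle i hi).trans hk) (by omega) hu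
  have hcov : ∀ u < ℓ + k * (r - ℓ), ∃ i < k, i * (r - ℓ) ≤ u ∧ u < i * (r - ℓ) + r := by
    intro u hu
    by_cases h : u / (r - ℓ) < k
    · refine ⟨u / (r - ℓ), h, Nat.div_mul_le_self _ _, ?_⟩
      have := Nat.lt_div_mul_add hs (a := u)
      omega
    · refine ⟨k - 1, by omega, ?_, ?_⟩
      · have h1 : k ≤ u / (r - ℓ) := by omega
        have h2 := (Nat.le_div_iff_mul_le hs).1 h1
        have h3 : (k - 1) * (r - ℓ) ≤ k * (r - ℓ) := Nat.mul_le_mul_right _ (by omega)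
        omega
      · have h3 : (k - 1 + 1) * (r - ℓ) = k * (r - ℓ) := by congr 1; omega
        rw [add_mul] at h3
        omega
  have hex : ∀ u : Fin (ℓ + k * (r - ℓ)), ∃ w : Fin (ℓ + k * (r - ℓ)),
      σ (Fin.ofNat n (x * (r - ℓ) + u)) = Fin.ofNat n (y * (r - ℓ) + w) := by
    intro u
    obtain ⟨i, hi, hiu⟩ := hcov u u.2
    obtain ⟨j, hj, hij⟩ := hyi i hi
    have h1 : σ (Fin.ofNat n (x * (r - ℓ) + u)) ∈ arc n (r - ℓ) r (y + j) := by
      rw [← hij]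
      exact Finset.mem_map_of_mem σ.toEmbedding ((hmem x i hi u (by omega)).2 hiu)
    obtain ⟨w, hw, h2⟩ := exists_eq_ofNat_add (y * (r - ℓ)) (σ (Fin.ofNat n (x * (r - ℓ) + u)))
    rw [h2, hmem y j hj w hw] at h1
    exact ⟨⟨w, by have := hle j hj; omega⟩, h2⟩
  choose g hg using hex
  have ginj : Function.Injective g := by
    intro u v h
    have h1 := hg u
    rw [h, ← hg v] at h1
    exact Fin.ext (ofNat_add_inj _ (by omega) (by omega) (σ.injective h1))
  let g' := Equiv.ofBijective g (Finite.injective_iff_bijective.1 ginj)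
  refine ⟨g', ?_, hg⟩
  apply Finset.eq_of_subset_of_card_le
  · intro e he
    obtain ⟨e', he', rfl⟩ := Finset.mem_image.1 he
    obtain ⟨i, hi, rfl⟩ := Finset.mem_image.1 he'
    have hi := Finset.mem_range.1 hi
    obtain ⟨j, hj, hij⟩ := hyi i hi
    refine Finset.mem_image.2 ⟨j, Finset.mem_range.2 hj, ?_⟩
    symm
    apply Finset.eq_of_subset_of_card_le
    · intro w hw
      obtain ⟨u, hu, rfl⟩ := Finset.mem_map.1 hw
      simp only [Finset.mem_filter, Finset.mem_univ, true_and] at hu ⊢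
      have h1 : σ (Fin.ofNat n (x * (r - ℓ) + u)) ∈ arc n (r - ℓ) r (y + j) := by
        rw [← hij]
        exact Finset.mem_map_of_mem σ.toEmbedding ((hmem x i hi u (by omega)).2 hu)
      rw [hg u, hmem y j hj _ (by omega)] at h1
      exact h1
    · rw [Finset.card_map, card_filter_interval (hle i hi), card_filter_interval (hle j hj)]
      omega
  · unfold relabel
    rw [Finset.card_image_of_injective]
    exact Finset.map_injective _

lemma exists_eq_ofNat_of_mem_supp_seg {r ℓ n m : ℕ} (P : Params r ℓ n m) [NeZero n] {x k : ℕ}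
    (hk : ℓ + k * (r - ℓ) ≤ n) {v : Fin n} (hv : v ∈ supp (seg n (r - ℓ) r x k)) :
    ∃ u : Fin (ℓ + k * (r - ℓ)), v = Fin.ofNat n (x * (r - ℓ) + u) := by
  rw [mem_supp] at hv
  obtain ⟨e, he, hv⟩ := hv
  obtain ⟨i, hi, rfl⟩ := Finset.mem_image.1 he
  have hi := Finset.mem_range.1 hi
  obtain ⟨u, hu, rfl⟩ := exists_eq_ofNat_add (x * (r - ℓ)) v
  have h1 : (i + 1) * (r - ℓ) ≤ k * (r - ℓ) := Nat.mul_le_mul_right _ hi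
  rw [add_mul] at h1
  have hlt := P.lt
  have := P.two_le
  rw [ofNat_mem_arc_of_le P.eq (by omega) (by omega) (by omega) hu] at hv
  exact ⟨⟨u, by omega⟩, rfl⟩

/-- Appending a path of `k` edges whose possible positions are confined to `T`. -/
lemma embCount_union_seg_le {r ℓ n m : ℕ} (P : Params r ℓ n m) {x k c : ℕ} (hk0 : 0 < k)
    (hk : ℓ + k * (r - ℓ) ≤ n) {H : Finset (Finset (Fin n))}
    (hT : ∀ τ ∈ embMaps (cycle r ℓ n) (H ∪ seg n (r - ℓ) r x k), ∃ T : Finset ℕ, T.card ≤ c ∧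
      ∀ σ ∈ embMaps (cycle r ℓ n) (H ∪ seg n (r - ℓ) r x k), (∀ v ∈ supp H, σ v = τ v) →
      ∀ y < m, (arc n (r - ℓ) r y = (arc n (r - ℓ) r x).map σ.toEmbedding ∨
        arc n (r - ℓ) r (y + (k - 1)) = (arc n (r - ℓ) r x).map σ.toEmbedding) → y ∈ T) :
    embCount (cycle r ℓ n) (H ∪ seg n (r - ℓ) r x k) ≤
      embCount (cycle r ℓ n) H * (c * autCount (path r ℓ k)) := by
  have := P.neZero
  apply embCount_union_le
  intro τ hτ
  obtain ⟨T, hTc, hT⟩ := hT τ hτ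
  have hcard : (T ×ˢ (Finset.univ.filter (fun g : Equiv.Perm (Fin (ℓ + k * (r - ℓ))) =>
      relabel g (path r ℓ k) = path r ℓ k))).card ≤ c * autCount (path r ℓ k) := by
    rw [Finset.card_product]
    exact Nat.mul_le_mul_right _ hTc
  -- On the new run, `σ` is encoded by the start of the image run and the induced automorphism of
  -- `P_k`.
  refine le_trans (card_image_le_of_relation (T := T ×ˢ _) (fun σ (c : ℕ × Equiv.Perm (Fin (ℓ + k * (r - ℓ)))) =>
          ∀ u : Fin (ℓ + k * (r - ℓ)), σ (Fin.ofNat n (x * (r - ℓ) + u)) = Fin.ofNat n (c.1 * (r - ℓ) + c.2 u)) ?_ ?_) hcard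
  · intro σ hσ
    rw [Finset.mem_filter] at hσ
    obtain ⟨y, hy, hyx, g, hg, hgu⟩ := exists_path_aut P hk0 hk
      (embMaps_mono Finset.subset_union_right hσ.1)
    refine ⟨(y, g), ?_, hgu⟩
    rw [Finset.mem_product]
    exact ⟨hT σ hσ.1 (restr_eq_iff.1 hσ.2) y hy hyx, by simpa using hg⟩
  · intro σ _ σ' _ c h h'
    rw [restr_eq_iff]
    intro v hv
    obtain ⟨u, rfl⟩ := exists_eq_ofNat_of_mem_supp_seg P hk hv
    rw [h u, h' u]

lemma embCount_union_seg_le_m {r ℓ n m : ℕ} (P : Params r ℓ n m) {x k : ℕ} (hk0 : 0 < k)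
    (hk : ℓ + k * (r - ℓ) ≤ n) (H : Finset (Finset (Fin n))) :
    embCount (cycle r ℓ n) (H ∪ seg n (r - ℓ) r x k) ≤
      embCount (cycle r ℓ n) H * (m * autCount (path r ℓ k)) := by
  apply embCount_union_seg_le P hk0 hk
  intro τ _
  refine ⟨Finset.range m, by simp, ?_⟩
  intro σ _ _ y hy _
  exact Finset.mem_range.2 hy

lemma embCount_seg_le {r ℓ n m : ℕ} (P : Params r ℓ n m) {x k : ℕ} (hk0 : 0 < k)
    (hk : ℓ + k * (r - ℓ) ≤ n) :
    embCount (cycle r ℓ n) (seg n (r - ℓ) r x k) ≤ m * autCount (path r ℓ k) := by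
  have h := embCount_union_seg_le_m P (x := x) hk0 hk ∅
  rw [Finset.empty_union] at h
  refine h.trans ?_
  calc _ ≤ 1 * (m * autCount (path r ℓ k)) := Nat.mul_le_mul_right _ (embCount_empty _)
    _ = _ := one_mul _

/-- The image `z` of the edge `x` is already fixed. The first edge of the new run meets it in `r - d
s` vertices, so its image is `z + d` or `z - d`; the run then continues in one of two directions.
This leaves four possible starts in place of `m`. -/
lemma embCount_union_seg_le_four {r ℓ n m : ℕ} (P : Params r ℓ n m) {x d k : ℕ} (hk0 : 0 < k)
    (hk : ℓ + k * (r - ℓ) ≤ n) (hdr : d * (r - ℓ) < r) {H : Finset (Finset (Fin n))}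
    (hx : arc n (r - ℓ) r x ∈ H) :
    embCount (cycle r ℓ n) (H ∪ seg n (r - ℓ) r (x + d) k) ≤
      embCount (cycle r ℓ n) H * (4 * autCount (path r ℓ k)) := by
  have hs := P.s_pos
  have := P.neZero_m
  apply embCount_union_seg_le P hk0 hk
  intro τ hτ
  rw [mem_embMaps] at hτ
  have h1 := hτ _ (Finset.mem_union_left _ hx)
  rw [mem_cycle_iff hs P.eq] at h1
  obtain ⟨z, hz, hzx⟩ := h1
  -- The starts for a run traversed forwards, and those for a reversed run, which begins `k - 1`
  -- edges before the image of its first edge.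
  let S : Finset (ZMod m) := {(z : ZMod m) + d, (z : ZMod m) - d,
    (z : ZMod m) + d - (k - 1 : ℕ), (z : ZMod m) - d - (k - 1 : ℕ)}
  refine ⟨(Finset.range m).filter (fun y => (y : ZMod m) ∈ S), ?_, ?_⟩
  · calc _ ≤ S.card := by
          apply Finset.card_le_card_of_injOn (fun y : ℕ => (y : ZMod m))
          · intro y hy
            exact (Finset.mem_filter.1 (Finset.mem_coe.1 hy)).2
          · intro y hy y' hy' h
            have h1 := Finset.mem_range.1 (Finset.mem_filter.1 (Finset.mem_coe.1 hy)).1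
            have h2 := Finset.mem_range.1 (Finset.mem_filter.1 (Finset.mem_coe.1 hy')).1
            exact Nat.ModEq.eq_of_lt_of_lt ((ZMod.natCast_eq_natCast_iff _ _ _).1 h) h1 h2
      _ ≤ 4 := Finset.card_le_four
  · intro σ hσ hστ y hy hyx
    rw [mem_embMaps] at hσ
    have h2 : (arc n (r - ℓ) r x).map σ.toEmbedding = (arc n (r - ℓ) r x).map τ.toEmbedding := by
      rw [Finset.map_eq_image, Finset.map_eq_image]
      apply Finset.image_congr
      intro v hv
      exact hστ v (mem_supp.2 ⟨_, hx, hv⟩)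
    have h3 := hσ (arc n (r - ℓ) r (x + d)) (Finset.mem_union_right _
      (Finset.mem_image.2 ⟨0, Finset.mem_range.2 hk0, rfl⟩))
    rw [mem_cycle_iff hs P.eq] at h3
    obtain ⟨w, hw, hwx⟩ := h3
    have h4 : (arc n (r - ℓ) r z ∩ arc n (r - ℓ) r w).card = r - d * (r - ℓ) := by
      rw [hzx, ← h2, hwx, ← Finset.map_inter, Finset.card_map]
      exact card_arc_inter P.eq P.two_le hdr
    have h5 : (w : ZMod m) = z + d ∨ (w : ZMod m) = z - d := by
      rcases modEq_of_card_arc_inter P.eq P.two_le hs hdr h4 with h | h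
      · left
        have := (ZMod.natCast_eq_natCast_iff _ _ _).2 h
        push_cast at this
        exact this.symm
      · right
        have := (ZMod.natCast_eq_natCast_iff _ _ _).2 h
        push_cast at this
        rw [← this]; ring
    have h6 : (y : ZMod m) = w ∨ (y : ZMod m) = w - (k - 1 : ℕ) := by
      rw [← hwx] at hyx
      rcases hyx with h | h
      · left
        exact (ZMod.natCast_eq_natCast_iff _ _ _).2 (P.arc_inj h)
      · right
        have := (ZMod.natCast_eq_natCast_iff _ _ _).2 (P.arc_inj h)
        rw [Nat.cast_add] at this
        rw [← this]; ring
    refine Finset.mem_filter.2 ⟨Finset.mem_range.2 hy, ?_⟩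
    simp only [S, Finset.mem_insert, Finset.mem_singleton]
    rcases h5 with h5 | h5 <;> rcases h6 with h6 | h6 <;> rw [h6, h5] <;> simp

end RandomHypergraph

/-! ### Automorphisms: an upper bound for paths, a lower bound for the cycle. -/

namespace RandomHypergraph

/-- The constant `λ(r, ℓ)` as a natural number. -/
def lamNat (r ℓ : ℕ) : ℕ := (residue r ℓ).factorial * (r - ℓ - residue r ℓ).factorial

lemma lam_eq_lamNat (r ℓ : ℕ) : lam r ℓ = (lamNat r ℓ : ℝ) := rfl

lemma lamNat_pos (r ℓ : ℕ) : 0 < lamNat r ℓ :=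
  Nat.mul_pos (Nat.factorial_pos _) (Nat.factorial_pos _)

lemma residue_pos (r ℓ : ℕ) : 0 < residue r ℓ := Nat.succ_pos _

lemma residue_le {r ℓ : ℕ} (h : ℓ < r) : residue r ℓ ≤ r - ℓ :=
  Nat.mod_lt _ (by omega)

lemma exists_eq_mul_add_residue {r ℓ : ℕ} (h : ℓ < r) :
    ∃ q, r = q * (r - ℓ) + residue r ℓ := by
  refine ⟨(r - 1) / (r - ℓ), ?_⟩
  have := Nat.div_add_mod (r - 1) (r - ℓ)
  unfold residue
  rw [mul_comm] at this
  omega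

lemma mul_add_lt_mul_add_iff {s t b c o : ℕ} (ho : o < s) (ht : 0 < t) (hts : t ≤ s) :
    b * s + o < c * s + t ↔ b < c ∨ (b = c ∧ o < t) := by
  rcases lt_trichotomy b c with h | h | h
  · have : (b + 1) * s ≤ c * s := Nat.mul_le_mul_right _ h
    rw [add_mul] at this
    constructor
    · intro _; exact Or.inl h
    · intro _; omega
  · subst h
    simp
  · have : (c + 1) * s ≤ b * s := Nat.mul_le_mul_right _ h
    rw [add_mul] at this
    constructor
    · intro _; omega
    · intro h; omega

lemma mul_le_mul_add_iff {s b c o : ℕ} (ho : o < s) : c * s ≤ b * s + o ↔ c ≤ b := by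
  constructor
  · intro h
    by_contra hc
    have : (b + 1) * s ≤ c * s := Nat.mul_le_mul_right _ (by omega)
    rw [add_mul] at this
    omega
  · intro h
    have : c * s ≤ b * s := Nat.mul_le_mul_right _ h
    omega

/-- Membership in an edge in terms of the block and of the part of the block. -/
lemma interval_mem_iff {s t q i x : ℕ} (hs : 0 < s) (ht : 0 < t) (hts : t ≤ s) :
    (i * s ≤ x ∧ x < i * s + (q * s + t)) ↔
      i ≤ x / s ∧ (x / s < i + q ∨ (x / s = i + q ∧ x % s < t)) := by
  have e : x = x / s * s + x % s := (Nat.div_add_mod' x s).symm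
  have ho := Nat.mod_lt x hs
  rw [← mul_add_lt_mul_add_iff ho ht hts (b := x / s) (c := i + q),
    ← mul_le_mul_add_iff ho (b := x / s) (c := i), ← e, add_mul, add_assoc]

/-- The `i`-th edge of the path with `k` edges. -/
def pathEdge (r ℓ k i : ℕ) : Finset (Fin (ℓ + k * (r - ℓ))) :=
  Finset.univ.filter (fun v => i * (r - ℓ) ≤ (v : ℕ) ∧ (v : ℕ) < i * (r - ℓ) + r)

lemma path_eq_image_pathEdge (r ℓ k : ℕ) :
    path r ℓ k = (Finset.range k).image (pathEdge r ℓ k) := rfl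

lemma mul_add_le_of_lt {r ℓ k i : ℕ} (h : ℓ < r) (hi : i < k) :
    i * (r - ℓ) + r ≤ ℓ + k * (r - ℓ) := by
  have : (i + 1) * (r - ℓ) ≤ k * (r - ℓ) := Nat.mul_le_mul_right _ hi
  rw [add_mul] at this
  omega

lemma card_pathEdge_inter {r ℓ k i j : ℕ} (h : ℓ < r) (hi : i < k) (hij : j ≤ i) :
    (pathEdge r ℓ k i ∩ pathEdge r ℓ k j).card = j * (r - ℓ) + r - i * (r - ℓ) := by
  have h1 := mul_add_le_of_lt h (hij.trans_lt hi)
  rw [← card_filter_interval (N := ℓ + k * (r - ℓ)) (a := i * (r - ℓ)) h1]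
  congr 1
  ext v
  have h2 : j * (r - ℓ) ≤ i * (r - ℓ) := Nat.mul_le_mul_right _ hij
  simp only [pathEdge, Finset.mem_inter, Finset.mem_filter, Finset.mem_univ, true_and]
  omega

lemma card_pathEdge {r ℓ k i : ℕ} (h : ℓ < r) (hi : i < k) : (pathEdge r ℓ k i).card = r := by
  rw [pathEdge, card_filter_interval (mul_add_le_of_lt h hi)]
  omega

/-- The permutations of the vertices of a path that fix every edge. -/
def edgeFixing (r ℓ k : ℕ) : Finset (Equiv.Perm (Fin (ℓ + k * (r - ℓ)))) :=
  Finset.univ.filter (fun g => ∀ i < k, (pathEdge r ℓ k i).map g.toEmbedding = pathEdge r ℓ k i)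

/-- Two permutations that act alike on the edges differ by one that fixes every edge. -/
lemma card_filter_map_pathEdge_le (r ℓ k : ℕ) (φ : ℕ → ℕ) :
    (Finset.univ.filter (fun g : Equiv.Perm (Fin (ℓ + k * (r - ℓ))) => ∀ i < k,
      (pathEdge r ℓ k i).map g.toEmbedding = pathEdge r ℓ k (φ i))).card ≤
      (edgeFixing r ℓ k).card := by
  rcases Finset.eq_empty_or_nonempty (Finset.univ.filter
    (fun g : Equiv.Perm (Fin (ℓ + k * (r - ℓ))) => ∀ i < k,
      (pathEdge r ℓ k i).map g.toEmbedding = pathEdge r ℓ k (φ i))) with h | ⟨τ, hτ⟩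
  · rw [h]; simp
  apply Finset.card_le_card_of_injOn (fun g => τ⁻¹ * g)
  · intro g hg
    have h1 := (Finset.mem_filter.1 (Finset.mem_coe.1 hg)).2
    have h2 := (Finset.mem_filter.1 hτ).2
    refine Finset.mem_coe.2 (Finset.mem_filter.2 ⟨Finset.mem_univ _, fun i hi => ?_⟩)
    apply Finset.map_injective τ.toEmbedding
    have h3 : (τ⁻¹ * g).toEmbedding.trans τ.toEmbedding = g.toEmbedding := by
      ext v; simp
    rw [h2 i hi, ← h1 i hi, Finset.map_map, h3]
  · intro g _ g' _ h
    exact mul_left_cancel h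

/-- An automorphism preserves the sizes of intersections of edges, so on indices it is a
self-avoiding walk in `0, …, k - 1` with steps `±1`: the identity or the reversal. -/
lemma autCount_path_le {r ℓ k : ℕ} (hℓ : 0 < ℓ) (h : ℓ < r) (hk : 0 < k) :
    autCount (path r ℓ k) ≤ 2 * (edgeFixing r ℓ k).card := by
  have hsub : Finset.univ.filter (fun g : Equiv.Perm (Fin (ℓ + k * (r - ℓ))) =>
      relabel g (path r ℓ k) = path r ℓ k) ⊆
      (Finset.univ.filter (fun g : Equiv.Perm (Fin (ℓ + k * (r - ℓ))) => ∀ i < k,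
        (pathEdge r ℓ k i).map g.toEmbedding = pathEdge r ℓ k (id i))) ∪
      (Finset.univ.filter (fun g : Equiv.Perm (Fin (ℓ + k * (r - ℓ))) => ∀ i < k,
        (pathEdge r ℓ k i).map g.toEmbedding = pathEdge r ℓ k (k - 1 - i))) := by
    intro g hg
    have hg := (Finset.mem_filter.1 hg).2
    have hidx : ∀ i, ∃ f, i < k → f < k ∧
        (pathEdge r ℓ k i).map g.toEmbedding = pathEdge r ℓ k f := by
      intro i
      by_cases hi : i < k
      · have h1 : (pathEdge r ℓ k i).map g.toEmbedding ∈ relabel g (path r ℓ k) :=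
          Finset.mem_image_of_mem _ (Finset.mem_image_of_mem _ (Finset.mem_range.2 hi))
        rw [hg, path_eq_image_pathEdge, Finset.mem_image] at h1
        obtain ⟨f, hf, h2⟩ := h1
        exact ⟨f, fun _ => ⟨Finset.mem_range.1 hf, h2.symm⟩⟩
      · exact ⟨0, fun h => absurd h hi⟩
    choose f hf using hidx
    have hinter : ∀ i < k, ∀ j < k, (pathEdge r ℓ k (f i) ∩ pathEdge r ℓ k (f j)).card =
        (pathEdge r ℓ k i ∩ pathEdge r ℓ k j).card := by
      intro i hi j hj
      rw [← (hf i hi).2, ← (hf j hj).2, ← Finset.map_inter, Finset.card_map]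
    have hwalk : (∀ i < k, ((f i : ℕ) : ℤ) = (f 0 : ℤ) + i • (1 : ℤ)) ∨
        (∀ i < k, ((f i : ℕ) : ℤ) = (f 0 : ℤ) - i • (1 : ℤ)) := by
      apply straight_walk (f := fun i => ((f i : ℕ) : ℤ))
      · intro i hi
        have h1 := hinter (i + 1) hi i (by omega)
        rw [card_pathEdge_inter h hi (by omega)] at h1
        have h2 := (hf i (by omega)).1
        have h3 := (hf (i + 1) hi).1
        have hs : 0 < r - ℓ := by omega
        rw [show (i + 1) * (r - ℓ) = i * (r - ℓ) + (r - ℓ) by ring] at h1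
        rcases le_total (f i) (f (i + 1)) with h4 | h4
        · rw [card_pathEdge_inter h h3 h4] at h1
          have h5 : f (i + 1) * (r - ℓ) = (f i + 1) * (r - ℓ) := by rw [add_mul]; omega
          have h6 := Nat.eq_of_mul_eq_mul_right hs h5
          left; omega
        · rw [Finset.inter_comm, card_pathEdge_inter h h2 h4] at h1
          have h5 : f i * (r - ℓ) = (f (i + 1) + 1) * (r - ℓ) := by rw [add_mul]; omega
          have h6 := Nat.eq_of_mul_eq_mul_right hs h5
          right; omega
      · intro i hi j hj hij
        have hij : f i = f j := by exact_mod_cast hij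
        have h1 := hinter i hi j hj
        rw [hij, Finset.inter_self, card_pathEdge h (hf j hj).1] at h1
        have hs : 0 < r - ℓ := by omega
        rcases lt_trichotomy i j with h2 | h2 | h2
        · rw [Finset.inter_comm, card_pathEdge_inter h hj h2.le] at h1
          have : i * (r - ℓ) < j * (r - ℓ) := Nat.mul_lt_mul_of_pos_right h2 hs
          omega
        · exact h2
        · rw [card_pathEdge_inter h hi h2.le] at h1
          have : j * (r - ℓ) < i * (r - ℓ) := Nat.mul_lt_mul_of_pos_right h2 hs
          omega
    rw [Finset.mem_union, Finset.mem_filter, Finset.mem_filter]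
    simp only [nsmul_eq_mul, mul_one] at hwalk
    have hl := (hf (k - 1) (by omega)).1
    rcases hwalk with hw | hw
    · left
      refine ⟨Finset.mem_univ _, fun i hi => ?_⟩
      have h1 := hw (k - 1) (by omega)
      have h2 := hw i hi
      have h3 : f i = i := by omega
      rw [(hf i hi).2, h3]; rfl
    · right
      refine ⟨Finset.mem_univ _, fun i hi => ?_⟩
      have h1 := hw (k - 1) (by omega)
      have h2 := hw i hi
      have h0 := (hf 0 hk).1
      have h3 : f i = k - 1 - i := by omega
      rw [(hf i hi).2, h3]
  refine (Finset.card_le_card hsub).trans ((Finset.card_union_le _ _).trans ?_)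
  have h1 := card_filter_map_pathEdge_le r ℓ k id
  have h2 := card_filter_map_pathEdge_le r ℓ k (fun i => k - 1 - i)
  omega

/-- The part of the path containing a vertex; vertices near the ends are not distinguished. -/
def pathPart (r ℓ k q : ℕ) (x : Fin (ℓ + k * (r - ℓ))) : Option (Fin k × Bool) :=
  if h : q ≤ (x : ℕ) / (r - ℓ) ∧ (x : ℕ) / (r - ℓ) + 1 < k then
    some (⟨(x : ℕ) / (r - ℓ), by omega⟩, decide ((x : ℕ) % (r - ℓ) < residue r ℓ)) else none

/-- With `r = q s + t`, the set of edges containing a vertex determines its block of length `s`, and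
whether its offset in the block is below `t`, unless the vertex is near an end of the path. A
permutation fixing all edges preserves this set. -/
lemma pathPart_comp_of_mem_edgeFixing {r ℓ k q : ℕ} (hℓ : 0 < ℓ) (h : ℓ < r)
    (hq : r = q * (r - ℓ) + residue r ℓ) {g : Equiv.Perm (Fin (ℓ + k * (r - ℓ)))}
    (hg : g ∈ edgeFixing r ℓ k) : pathPart r ℓ k q ∘ g = pathPart r ℓ k q := by
  have hs : 0 < r - ℓ := by omega
  have ht := residue_pos r ℓ
  have hts := residue_le h
  have hq1 : 1 ≤ q := by
    by_contra h0
    have : q = 0 := by omega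
    rw [this] at hq
    omega
  have hmem : ∀ x : Fin (ℓ + k * (r - ℓ)), ∀ i, x ∈ pathEdge r ℓ k i ↔
      i ≤ (x : ℕ) / (r - ℓ) ∧ ((x : ℕ) / (r - ℓ) < i + q ∨
        ((x : ℕ) / (r - ℓ) = i + q ∧ (x : ℕ) % (r - ℓ) < residue r ℓ)) := by
    intro x i
    rw [← interval_mem_iff hs ht hts, ← hq]
    simp [pathEdge]
  have hfix : ∀ x, ∀ i < k, (g x ∈ pathEdge r ℓ k i ↔ x ∈ pathEdge r ℓ k i) := by
    intro x i hi
    have h1 := (Finset.mem_filter.1 hg).2 i hi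
    constructor
    · intro hx
      rw [← h1] at hx
      obtain ⟨y, hy, hyx⟩ := Finset.mem_map.1 hx
      have : y = x := g.injective hyx
      rwa [← this]
    · intro hx
      rw [← h1]
      exact Finset.mem_map_of_mem _ hx
  -- Four edges decide: edge `b` gives `b ≤ b'`, edge `b + 1 - q` gives `b' ≤ b + 1`, edge `b + 1`
  -- excludes `b' = b + 1`, and edge `b - q` then compares the offsets.
  have key : ∀ b b' : ℕ, ∀ o o' : Prop,
      (∀ i < k, (i ≤ b ∧ (b < i + q ∨ (b = i + q ∧ o))) ↔
        (i ≤ b' ∧ (b' < i + q ∨ (b' = i + q ∧ o')))) → q ≤ b → b + 1 < k →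
      b' = b ∧ (o' ↔ o) := by
    intro b b' o o' H h1 h2
    have H1 := H b (by omega)
    have H2 := H (b + 1) (by omega)
    have H3 := H (b + 1 - q) (by omega)
    have H4 := H (b - q) (by omega)
    have hb : b' = b := by
      have a1 : b ≤ b' := (H1.1 ⟨le_rfl, Or.inl (by omega)⟩).1
      have a2 := H3.1 ⟨by omega, Or.inl (by omega)⟩
      have a3 : ¬ (b + 1 ≤ b' ∧ (b' < b + 1 + q ∨ (b' = b + 1 + q ∧ o'))) := by
        rw [← H2]; omega
      by_contra hne
      apply a3
      refine ⟨by omega, Or.inl ?_⟩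
      rcases a2.2 with a | a <;> omega
    refine ⟨hb, ?_⟩
    subst hb
    have e1 : (b' - q ≤ b' ∧ (b' < b' - q + q ∨ b' = b' - q + q ∧ o)) ↔ o := by
      constructor
      · rintro ⟨_, a | a⟩
        · omega
        · exact a.2
      · intro ho; exact ⟨by omega, Or.inr ⟨by omega, ho⟩⟩
    have e2 : (b' - q ≤ b' ∧ (b' < b' - q + q ∨ b' = b' - q + q ∧ o')) ↔ o' := by
      constructor
      · rintro ⟨_, a | a⟩
        · omega
        · exact a.2
      · intro ho; exact ⟨by omega, Or.inr ⟨by omega, ho⟩⟩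
    rw [e1, e2] at H4
    exact H4.symm
  funext x
  have hx : ∀ i < k, _ := fun i hi => hfix x i hi
  simp only [hmem] at hx
  simp only [Function.comp, pathPart]
  by_cases h1 : q ≤ (x : ℕ) / (r - ℓ) ∧ (x : ℕ) / (r - ℓ) + 1 < k
  · obtain ⟨a, b⟩ := key _ _ _ _ (fun i hi => (hx i hi).symm) h1.1 h1.2
    have h2 : q ≤ (g x : ℕ) / (r - ℓ) ∧ (g x : ℕ) / (r - ℓ) + 1 < k := by rw [a]; exact h1
    rw [dif_pos h1, dif_pos h2]
    simp only [a, b]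
  · by_cases h2 : q ≤ (g x : ℕ) / (r - ℓ) ∧ (g x : ℕ) / (r - ℓ) + 1 < k
    · obtain ⟨a, b⟩ := key _ _ _ _ (fun i hi => hx i hi) h2.1 h2.2
      rw [← a] at h2
      exact absurd h2 h1
    · rw [dif_neg h1, dif_neg h2]

lemma card_filter_block_le {N s t b : ℕ} (hs : 0 < s) :
    (Finset.univ.filter (fun x : Fin N => (x : ℕ) / s = b ∧ (x : ℕ) % s < t)).card ≤ t ∧
    (Finset.univ.filter (fun x : Fin N => (x : ℕ) / s = b ∧ ¬ (x : ℕ) % s < t)).card ≤ s - t := by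
  constructor
  · refine le_of_le_of_eq ?_ (Finset.card_range t)
    apply Finset.card_le_card_of_injOn (fun x : Fin N => (x : ℕ) % s)
    · intro x hx
      have := (Finset.mem_filter.1 (Finset.mem_coe.1 hx)).2
      exact Finset.mem_coe.2 (Finset.mem_range.2 this.2)
    · intro x hx y hy hxy
      have h1 := (Finset.mem_filter.1 (Finset.mem_coe.1 hx)).2
      have h2 := (Finset.mem_filter.1 (Finset.mem_coe.1 hy)).2
      apply Fin.ext
      rw [← Nat.div_add_mod (x : ℕ) s, ← Nat.div_add_mod (y : ℕ) s, h1.1, h2.1]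
      simp only at hxy
      rw [hxy]
  · refine le_of_le_of_eq ?_ (Nat.card_Ico t s)
    apply Finset.card_le_card_of_injOn (fun x : Fin N => (x : ℕ) % s)
    · intro x hx
      have := (Finset.mem_filter.1 (Finset.mem_coe.1 hx)).2
      have h3 := Nat.mod_lt (x : ℕ) hs
      exact Finset.mem_coe.2 (Finset.mem_Ico.2 ⟨not_lt.1 this.2, h3⟩)
    · intro x hx y hy hxy
      have h1 := (Finset.mem_filter.1 (Finset.mem_coe.1 hx)).2
      have h2 := (Finset.mem_filter.1 (Finset.mem_coe.1 hy)).2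
      apply Fin.ext
      rw [← Nat.div_add_mod (x : ℕ) s, ← Nat.div_add_mod (y : ℕ) s, h1.1, h2.1]
      simp only at hxy
      rw [hxy]

/-- The permutations preserving a partition number the product of the factorials of its part sizes.
Each block contributes at most `t! (s - t)!`, and the undistinguished vertices near the two ends
number at most `r + (ℓ + s) = 2 r`. -/
lemma card_edgeFixing_le {r ℓ k : ℕ} (hℓ : 0 < ℓ) (h : ℓ < r) (hk : 0 < k) :
    (edgeFixing r ℓ k).card ≤ (2 * r).factorial * lamNat r ℓ ^ k := by
  obtain ⟨q, hq⟩ := exists_eq_mul_add_residue h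
  have hs : 0 < r - ℓ := by omega
  have hts := residue_le h
  have h1 : (edgeFixing r ℓ k).card ≤
      Fintype.card {g : Equiv.Perm (Fin (ℓ + k * (r - ℓ))) //
        pathPart r ℓ k q ∘ g = pathPart r ℓ k q} := by
    rw [Fintype.card_subtype]
    apply Finset.card_le_card
    intro g hg
    exact Finset.mem_filter.2 ⟨Finset.mem_univ _, pathPart_comp_of_mem_edgeFixing hℓ h hq hg⟩
  refine h1.trans ?_
  rw [DomMulAct.stabilizer_card, Fintype.prod_option, Fintype.prod_prod_type]
  apply Nat.mul_le_mul
  · apply Nat.factorial_le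
    rw [Fintype.card_subtype]
    have hsub : Finset.univ.filter (fun x => pathPart r ℓ k q x = none) ⊆
        Finset.univ.filter (fun x : Fin (ℓ + k * (r - ℓ)) => 0 ≤ (x : ℕ) ∧ (x : ℕ) < r) ∪
        Finset.univ.filter (fun x : Fin (ℓ + k * (r - ℓ)) => (k - 1) * (r - ℓ) ≤ (x : ℕ) ∧
          (x : ℕ) < ℓ + k * (r - ℓ)) := by
      intro x hx
      have hx := (Finset.mem_filter.1 hx).2
      unfold pathPart at hx
      by_cases h2 : q ≤ (x : ℕ) / (r - ℓ) ∧ (x : ℕ) / (r - ℓ) + 1 < k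
      · rw [dif_pos h2] at hx; simp at hx
      · rw [Finset.mem_union]
        by_cases h3 : q ≤ (x : ℕ) / (r - ℓ)
        · right
          have h4 : k - 1 ≤ (x : ℕ) / (r - ℓ) := by omega
          refine Finset.mem_filter.2 ⟨Finset.mem_univ _, ?_, x.2⟩
          exact (Nat.le_div_iff_mul_le hs).1 h4
        · left
          refine Finset.mem_filter.2 ⟨Finset.mem_univ _, Nat.zero_le _, ?_⟩
          have h4 : (x : ℕ) / (r - ℓ) < q := by omega
          have := (Nat.div_lt_iff_lt_mul hs).1 h4
          omega
    refine (Finset.card_le_card hsub).trans ((Finset.card_union_le _ _).trans ?_)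
    have h5 : (k - 1 + 1) * (r - ℓ) = k * (r - ℓ) := by congr 1; omega
    rw [add_mul] at h5
    rw [card_filter_interval (by omega), card_filter_interval le_rfl]
    omega
  · calc _ ≤ ∏ _b : Fin k, lamNat r ℓ := by
          apply Finset.prod_le_prod' 
          intro b _
          rw [Fintype.prod_bool, lamNat]
          obtain ⟨c1, c2⟩ := card_filter_block_le (N := ℓ + k * (r - ℓ)) (b := b) hs
          apply Nat.mul_le_mul
          · apply Nat.factorial_le
            rw [Fintype.card_subtype]
            refine (Finset.card_le_card ?_).trans c1
            intro x hx
            have hx := (Finset.mem_filter.1 hx).2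
            refine Finset.mem_filter.2 ⟨Finset.mem_univ _, ?_⟩
            unfold pathPart at hx
            split_ifs at hx with h2
            simp only [Option.some.injEq, Prod.mk.injEq, decide_eq_true_eq] at hx
            exact ⟨congrArg Fin.val hx.1, hx.2⟩
          · apply Nat.factorial_le
            rw [Fintype.card_subtype]
            refine (Finset.card_le_card ?_).trans c2
            intro x hx
            have hx := (Finset.mem_filter.1 hx).2
            refine Finset.mem_filter.2 ⟨Finset.mem_univ _, ?_⟩
            unfold pathPart at hx
            split_ifs at hx with h2
            simp only [Option.some.injEq, Prod.mk.injEq, decide_eq_false_iff_not] at hx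
            exact ⟨congrArg Fin.val hx.1, hx.2⟩
      _ = _ := by simp

/-- The numbers `Aut(P_k) / λ ^ k` are bounded. -/
lemma autCount_path_le_lamNat {r ℓ k : ℕ} (hℓ : 0 < ℓ) (h : ℓ < r) (hk : 0 < k) :
    autCount (path r ℓ k) ≤ 2 * (2 * r).factorial * lamNat r ℓ ^ k := by
  calc _ ≤ 2 * (edgeFixing r ℓ k).card := autCount_path_le hℓ h hk
    _ ≤ 2 * ((2 * r).factorial * lamNat r ℓ ^ k) :=
        Nat.mul_le_mul_left _ (card_edgeFixing_le hℓ h hk)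
    _ = _ := by ring

/-- The part of the cycle containing a vertex. -/
def cyclePart (r ℓ m : ℕ) (n : ℕ) (hn : n = m * (r - ℓ)) (x : Fin n) : Fin m × Bool :=
  (⟨(x : ℕ) / (r - ℓ), by
    have h := x.2
    exact Nat.div_lt_of_lt_mul (by rw [mul_comm, ← hn]; exact h)⟩,
    decide ((x : ℕ) % (r - ℓ) < residue r ℓ))

lemma card_filter_block {m s t n b : ℕ} (hn : n = m * s) (hts : t ≤ s) (hb : b < m) :
    (Finset.univ.filter (fun x : Fin n => (x : ℕ) / s = b ∧ (x : ℕ) % s < t)).card = t ∧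
    (Finset.univ.filter (fun x : Fin n => (x : ℕ) / s = b ∧ ¬ (x : ℕ) % s < t)).card = s - t := by
  rcases Nat.eq_zero_or_pos s with rfl | hs
  · have : t = 0 := by omega
    subst this
    have : n = 0 := by simpa using hn
    subst this
    simp
  have hle : (b + 1) * s ≤ n := by rw [hn]; exact Nat.mul_le_mul_right _ hb
  rw [add_mul] at hle
  have key : ∀ x : ℕ, x / s = b ↔ b * s ≤ x ∧ x < b * s + s := by
    intro x
    rw [Nat.div_eq_iff hs]; omega
  have key2 : ∀ x : ℕ, x / s = b → x % s = x - b * s := by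
    intro x hx
    have := Nat.div_add_mod' x s
    rw [hx] at this
    omega
  constructor
  · have : (Finset.univ.filter (fun x : Fin n => (x : ℕ) / s = b ∧ (x : ℕ) % s < t)) =
        Finset.univ.filter (fun x : Fin n => b * s ≤ (x : ℕ) ∧ (x : ℕ) < b * s + t) := by
      ext x
      simp only [Finset.mem_filter, Finset.mem_univ, true_and]
      constructor
      · rintro ⟨h1, h2⟩
        rw [key2 _ h1] at h2
        rw [key] at h1
        omega
      · intro h
        have h1 : (x : ℕ) / s = b := (key _).2 (by omega)
        exact ⟨h1, by rw [key2 _ h1]; omega⟩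
    rw [this, card_filter_interval (by omega)]
    omega
  · have : (Finset.univ.filter (fun x : Fin n => (x : ℕ) / s = b ∧ ¬ (x : ℕ) % s < t)) =
        Finset.univ.filter (fun x : Fin n => b * s + t ≤ (x : ℕ) ∧ (x : ℕ) < b * s + s) := by
      ext x
      simp only [Finset.mem_filter, Finset.mem_univ, true_and]
      constructor
      · rintro ⟨h1, h2⟩
        rw [key2 _ h1] at h2
        rw [key] at h1
        omega
      · intro h
        have h1 : (x : ℕ) / s = b := (key _).2 (by omega)
        exact ⟨h1, by rw [key2 _ h1]; omega⟩
    rw [this, card_filter_interval (by omega)]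
    omega

lemma card_cyclePart_stabilizer {r ℓ m n : ℕ} (h : ℓ < r) (hn : n = m * (r - ℓ)) :
    Fintype.card {g : Equiv.Perm (Fin n) // cyclePart r ℓ m n hn ∘ g = cyclePart r ℓ m n hn} =
      lamNat r ℓ ^ m := by
  rw [DomMulAct.stabilizer_card, Fintype.prod_prod_type]
  have hts := residue_le h
  calc _ = ∏ _b : Fin m, lamNat r ℓ := by
        apply Finset.prod_congr rfl
        intro b _
        rw [Fintype.prod_bool, lamNat, Fintype.card_subtype, Fintype.card_subtype]
        obtain ⟨c1, c2⟩ := card_filter_block hn hts b.2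
        congr 2
        · rw [← c1]
          congr 1
          ext x
          simp [cyclePart, Prod.ext_iff, Fin.ext_iff]
        · rw [← c2]
          congr 1
          ext x
          simp [cyclePart, Prod.ext_iff, Fin.ext_iff]
    _ = _ := by simp

/-- Since `r = q s + t`, an arc consists of `q` whole blocks and the first part of one more, so it
is a union of parts. -/
lemma map_arc_eq_of_cyclePart {r ℓ m n : ℕ} (P : Params r ℓ n m) {g : Equiv.Perm (Fin n)}
    (hg : cyclePart r ℓ m n P.eq ∘ g = cyclePart r ℓ m n P.eq) {i : ℕ} (hi : i < m) :
    (arc n (r - ℓ) r i).map g.toEmbedding = arc n (r - ℓ) r i := by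
  have := P.neZero
  have hs := P.s_pos
  have h2r := P.two_le
  obtain ⟨q, hq⟩ := exists_eq_mul_add_residue P.lt
  have ht := residue_pos r ℓ
  have hts := residue_le P.lt
  have hmem : ∀ x : Fin n, x ∈ arc n (r - ℓ) r i ↔
      (i ≤ (x : ℕ) / (r - ℓ) ∧ ((x : ℕ) / (r - ℓ) < i + q ∨
        ((x : ℕ) / (r - ℓ) = i + q ∧ (x : ℕ) % (r - ℓ) < residue r ℓ))) ∨
      ((x : ℕ) / (r - ℓ) + m < i + q ∨
        ((x : ℕ) / (r - ℓ) + m = i + q ∧ (x : ℕ) % (r - ℓ) < residue r ℓ)) := by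
    intro x
    have e : x = Fin.ofNat n (0 * (r - ℓ) + x) := by
      apply Fin.ext
      simp
    have h1 := ofNat_mem_arc (x := 0) P.eq (by omega : r ≤ n) hi x.2
    rw [← e, zero_add] at h1
    rw [h1, ← interval_mem_iff hs ht hts, ← hq]
    apply or_congr Iff.rfl
    rw [← mul_add_lt_mul_add_iff (Nat.mod_lt (x : ℕ) hs) ht hts, add_mul, add_mul, add_assoc (i * _),
      ← hq, ← P.eq]
    have := Nat.div_add_mod' (x : ℕ) (r - ℓ)
    omega
  apply Finset.eq_of_subset_of_card_le
  · intro w hw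
    obtain ⟨x, hx, rfl⟩ := Finset.mem_map.1 hw
    have h1 := congrFun hg x
    simp only [Function.comp, cyclePart, Prod.mk.injEq, Fin.mk.injEq, decide_eq_decide] at h1
    have hx' := (hmem x).1 hx
    rw [← h1.1, ← h1.2] at hx'
    exact (hmem (g x)).2 hx'
  · rw [Finset.card_map]

/-- Rotation of the vertices by `j` steps of the cycle. -/
def rotate (n s : ℕ) [NeZero n] (j : ℕ) : Equiv.Perm (Fin n) := Equiv.addRight (Fin.ofNat n (j * s))

lemma rotate_apply (n s : ℕ) [NeZero n] (j : ℕ) (x : Fin n) :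
    rotate n s j x = Fin.ofNat n (x + j * s) := by
  apply Fin.ext
  simp [rotate, Fin.val_add]

lemma map_arc_rotate {n s r : ℕ} [NeZero n] (i j : ℕ) :
    (arc n s r i).map (rotate n s j).toEmbedding = arc n s r (i + j) := by
  have hrot : ∀ a, rotate n s j (Fin.ofNat n a) = Fin.ofNat n (a + j * s) := by
    intro a
    rw [rotate_apply]
    apply Fin.ext
    simp
  have harc : ∀ i, arc n s r i = (Finset.range r).image (fun k => Fin.ofNat n (i * s + k)) := by
    intro i
    ext v
    simp [arc, Fin.ext_iff]
  rw [harc, harc, Finset.map_eq_image, Finset.image_image]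
  apply Finset.image_congr
  intro k _
  simp only [Function.comp, Equiv.coe_toEmbedding]
  rw [hrot]
  congr 1
  ring

/-- The `m` rotations combine freely with the `λ ^ m` permutations that preserve all parts. This
bounds the number of copies from above, and the factor `m` later cancels the polynomial factor in
Stirling's bound. -/
lemma mul_lamNat_pow_le_autCount_cycle {r ℓ m n : ℕ} (P : Params r ℓ n m) :
    m * lamNat r ℓ ^ m ≤ autCount (cycle r ℓ n) := by
  have := P.neZero
  have hs := P.s_pos
  set S := Finset.univ.filter
    (fun g : Equiv.Perm (Fin n) => cyclePart r ℓ m n P.eq ∘ g = cyclePart r ℓ m n P.eq) with hS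
  have hSc : S.card = lamNat r ℓ ^ m := by
    rw [← card_cyclePart_stabilizer P.lt P.eq, Fintype.card_subtype]
  have h1 : (Finset.range m ×ˢ S).card = m * lamNat r ℓ ^ m := by
    rw [Finset.card_product, hSc, Finset.card_range]
  rw [← h1]
  -- The rotation can be read off a product: it is the block to which the vertex 0 is sent.
  have hblock : ∀ j < m, ∀ g ∈ S,
      ((rotate n (r - ℓ) j * g) (Fin.ofNat n 0) : ℕ) / (r - ℓ) = j := by
    intro j hj g hg
    have h2 := congrFun (Finset.mem_filter.1 hg).2 (Fin.ofNat n 0)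
    simp only [Function.comp, cyclePart, Prod.mk.injEq, Fin.mk.injEq, decide_eq_decide] at h2
    have h3 : (g (Fin.ofNat n 0) : ℕ) / (r - ℓ) = 0 := by
      rw [h2.1]; simp
    have h4 : (g (Fin.ofNat n 0) : ℕ) < r - ℓ := by
      rcases Nat.div_eq_zero_iff.1 h3 with h | h
      · omega
      · exact h
    have h5 : (j + 1) * (r - ℓ) ≤ m * (r - ℓ) := Nat.mul_le_mul_right _ hj
    rw [add_mul, ← P.eq] at h5
    rw [Equiv.Perm.mul_apply, rotate_apply, Fin.ofNat_eq_cast, Fin.val_natCast,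
      Nat.mod_eq_of_lt (by omega), Nat.add_mul_div_right _ _ hs, h3, zero_add]
  apply Finset.card_le_card_of_injOn (fun x => rotate n (r - ℓ) x.1 * x.2)
  · rintro ⟨j, g⟩ hx
    obtain ⟨hj, hg⟩ := Finset.mem_product.1 (Finset.mem_coe.1 hx)
    refine Finset.mem_coe.2 (Finset.mem_filter.2 ⟨Finset.mem_univ _, ?_⟩)
    apply Finset.eq_of_subset_of_card_le
    · intro e he
      obtain ⟨e', he', rfl⟩ := Finset.mem_image.1 he
      rw [mem_cycle_iff hs P.eq] at he'
      obtain ⟨i, hi, rfl⟩ := he'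
      have h2 : (arc n (r - ℓ) r i).map (rotate n (r - ℓ) j * g).toEmbedding =
          ((arc n (r - ℓ) r i).map g.toEmbedding).map (rotate n (r - ℓ) j).toEmbedding := by
        rw [Finset.map_map]; rfl
      simp only
      rw [h2, map_arc_eq_of_cyclePart P (Finset.mem_filter.1 hg).2 hi, map_arc_rotate]
      exact arc_mem_cycle hs P.m_pos P.eq _
    · unfold relabel
      rw [Finset.card_image_of_injective _ (Finset.map_injective _)]
  · rintro ⟨j, g⟩ hx ⟨j', g'⟩ hx' h
    obtain ⟨hj, hg⟩ := Finset.mem_product.1 (Finset.mem_coe.1 hx)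
    obtain ⟨hj', hg'⟩ := Finset.mem_product.1 (Finset.mem_coe.1 hx')
    simp only at h
    have h2 := hblock j (Finset.mem_range.1 hj) g hg
    have h3 := hblock j' (Finset.mem_range.1 hj') g' hg'
    rw [h, h3] at h2
    subst h2
    rw [mul_left_cancel h]

end RandomHypergraph

/-! ### The moments of `Z`, and the reduction to sub-hypergraphs of one cycle. -/

namespace RandomHypergraph

open MeasureTheory ProbabilityTheory

lemma measurableSet_subset {ι : Type*} (C : Finset ι) :
    MeasurableSet {G : Set ι | (C : Set ι) ⊆ G} := by
  have : {G : Set ι | (C : Set ι) ⊆ G} = ⋂ e ∈ C, {G : Set ι | e ∈ G} := by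
    ext G; simp [Set.subset_def]
  rw [this]
  refine Finset.measurableSet_biInter _ fun e _ => ?_
  exact measurableSet_setOfPred.2 (measurable_set_mem e)

lemma setBernoulli_real_subset {ι : Type*} (u : Set ι) (p : unitInterval) (C : Finset ι)
    (hC : (C : Set ι) ⊆ u) :
    (setBernoulli u p).real {G | (C : Set ι) ⊆ G} = (p : ℝ) ^ C.card := by
  rw [measureReal_def, setBernoulli_apply']
  have : ((fun p : ι → Prop => {i | p i}) ⁻¹' {G : Set ι | (C : Set ι) ⊆ G}) =
      Set.pi (C : Set ι) (fun _ => {True}) := by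
    ext P; simp [Set.subset_def, Set.mem_pi]
  rw [this, Measure.infinitePi_pi _ (by intros; exact MeasurableSet.of_discrete), ENNReal.toReal_prod]
  rw [← Finset.prod_const]
  apply Finset.prod_congr rfl
  intro i hi
  have hiu : (i ∈ u) = True := eq_true (hC hi)
  simp [hiu]

section Relabel

variable {V : Type*} [DecidableEq V]

lemma relabel_mul (σ τ : Equiv.Perm V) (H : Finset (Finset V)) :
    relabel (σ * τ) H = relabel σ (relabel τ H) := by
  unfold relabel
  rw [Finset.image_image]
  apply Finset.image_congr
  intro e _
  simp only [Function.comp, Finset.map_map]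
  rfl

lemma relabel_one (H : Finset (Finset V)) : relabel 1 H = H := by
  unfold relabel
  have : (fun e : Finset V => e.map (1 : Equiv.Perm V).toEmbedding) = id := by
    funext e; exact Finset.map_refl
  rw [this, Finset.image_id]

lemma relabel_inter (σ : Equiv.Perm V) (H H' : Finset (Finset V)) :
    relabel σ (H ∩ H') = relabel σ H ∩ relabel σ H' :=
  Finset.image_inter _ _ (Finset.map_injective _)

lemma card_relabel (σ : Equiv.Perm V) (H : Finset (Finset V)) : (relabel σ H).card = H.card :=
  Finset.card_image_of_injective _ (Finset.map_injective _)

lemma card_filter_relabel_eq [Fintype V] (τ : Equiv.Perm V) (H : Finset (Finset V)) :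
    (Finset.univ.filter (fun σ => relabel σ H = relabel τ H)).card = autCount H := by
  unfold autCount
  apply Finset.card_bij (fun σ _ => τ⁻¹ * σ)
  · intro σ hσ
    have := (Finset.mem_filter.1 hσ).2
    refine Finset.mem_filter.2 ⟨Finset.mem_univ _, ?_⟩
    rw [relabel_mul, this, ← relabel_mul, inv_mul_cancel, relabel_one]
  · intro σ _ σ' _ h
    exact mul_left_cancel h
  · intro σ hσ
    have := (Finset.mem_filter.1 hσ).2
    refine ⟨τ * σ, Finset.mem_filter.2 ⟨Finset.mem_univ _, ?_⟩, by simp⟩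
    rw [relabel_mul, this]

lemma subset_relabel_iff [Fintype V] (σ : Equiv.Perm V) (C H : Finset (Finset V)) :
    H ⊆ relabel σ C ↔ σ⁻¹ ∈ embMaps C H := by
  have key : ∀ e : Finset V, e ∈ relabel σ C ↔ e.map (σ⁻¹).toEmbedding ∈ C := by
    intro e
    have h1 : (e.map (σ⁻¹).toEmbedding).map σ.toEmbedding = e := by
      rw [Finset.map_map]
      ext v
      simp
    constructor
    · intro h
      obtain ⟨f, hf, h2⟩ := Finset.mem_image.1 h
      have h3 : f = e.map (σ⁻¹).toEmbedding := by
        apply Finset.map_injective σ.toEmbedding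
        rw [h1]; exact h2
      rwa [← h3]
    · intro h
      exact Finset.mem_image.2 ⟨_, h, h1⟩
  rw [mem_embMaps]
  exact ⟨fun h e he => (key e).1 (h he), fun h e he => (key e).2 (h e he)⟩

end Relabel

/-- Orbit-stabilizer: each copy comes from exactly `Aut(C_n)` permutations. -/
lemma sum_copies {M : Type*} [AddCommMonoid M] (r ℓ n : ℕ) (f : Finset (Finset (Fin n)) → M) :
    ∑ σ : Equiv.Perm (Fin n), f (relabel σ (cycle r ℓ n)) =
      autCount (cycle r ℓ n) • ∑ C ∈ copies r ℓ n, f C := by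
  rw [Finset.sum_comp f (fun σ => relabel σ (cycle r ℓ n)), Finset.smul_sum]
  apply Finset.sum_congr rfl
  intro C hC
  obtain ⟨τ, _, rfl⟩ := Finset.mem_image.1 hC
  congr 1
  convert card_filter_relabel_eq τ (cycle r ℓ n)

lemma autCount_pos {V : Type*} [Fintype V] [DecidableEq V] (H : Finset (Finset V)) :
    0 < autCount H :=
  Finset.card_pos.2 ⟨1, Finset.mem_filter.2 ⟨Finset.mem_univ _, relabel_one H⟩⟩

lemma autCount_mul_card_copies (r ℓ n : ℕ) :
    autCount (cycle r ℓ n) * (copies r ℓ n).card = n.factorial := by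
  have h := sum_copies r ℓ n (fun _ => 1)
  simp only [Finset.sum_const, Finset.card_univ, Fintype.card_perm, Fintype.card_fin,
    smul_eq_mul, mul_one] at h
  exact h.symm

lemma card_cycle {r ℓ n m : ℕ} (h : ℓ < r) (hn : n = m * (r - ℓ)) (hrn : r < n) :
    (cycle r ℓ n).card = m := by
  have hs : 0 < r - ℓ := by omega
  rw [cycle_eq_image_arc, hn, Nat.mul_div_cancel _ hs, ← hn]
  refine (Finset.card_image_of_injOn ?_).trans (Finset.card_range m)
  intro i hi j hj hij
  have h1 := arc_injOn hn hrn (by omega) hs hij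
  exact Nat.ModEq.eq_of_lt_of_lt h1 (Finset.mem_range.1 (Finset.mem_coe.1 hi))
    (Finset.mem_range.1 (Finset.mem_coe.1 hj))

lemma card_of_mem_copies {r ℓ n m : ℕ} (h : ℓ < r) (hn : n = m * (r - ℓ)) (hrn : r < n)
    {C : Finset (Finset (Fin n))} (hC : C ∈ copies r ℓ n) : C.card = m := by
  obtain ⟨σ, _, rfl⟩ := Finset.mem_image.1 hC
  rw [card_relabel, card_cycle h hn hrn]

lemma card_edge_of_mem_copies {r ℓ n m : ℕ} (h : ℓ < r) (hn : n = m * (r - ℓ)) (hrn : r < n)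
    {C : Finset (Finset (Fin n))} (hC : C ∈ copies r ℓ n) :
    (C : Set (Finset (Fin n))) ⊆ {e | e.card = r} := by
  obtain ⟨σ, _, rfl⟩ := Finset.mem_image.1 hC
  intro e he
  obtain ⟨e', he', rfl⟩ := Finset.mem_image.1 (Finset.mem_coe.1 he)
  have hs : 0 < r - ℓ := by omega
  rw [mem_cycle_iff hs hn] at he'
  obtain ⟨i, hi, rfl⟩ := he'
  change (Finset.map _ _).card = r
  rw [Finset.card_map, card_arc hn hrn.le (by omega) hs]

-- The filter in `hamCount` runs over the copies viewed as sets of edges; the coercion from finite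
-- sets is injective, so the number is the same.
open Classical in
lemma hamCount_eq_card (r ℓ n : ℕ) (G : Set (Finset (Fin n))) :
    hamCount r ℓ n G =
      ((copies r ℓ n).filter (fun C => ((C : Finset (Finset (Fin n))) : Set _) ⊆ G)).card := by
  symm
  unfold hamCount
  apply Finset.card_bij (fun (C : Finset (Finset (Fin n))) _ => (C : Set (Finset (Fin n))))
  · intro C hC
    obtain ⟨h1, h2⟩ := Finset.mem_filter.1 hC
    refine Finset.mem_filter.2 ⟨?_, h2⟩
    simp only [Finset.bind_def, Finset.pure_def, Finset.mem_sup]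
    exact ⟨C, h1, by simp⟩
  · intro C _ C' _ h
    exact Finset.coe_injective h
  · intro C hC
    obtain ⟨h1, h2⟩ := Finset.mem_filter.1 hC
    simp only [Finset.bind_def, Finset.pure_def, Finset.mem_sup] at h1
    obtain ⟨C', h3, h4⟩ := h1
    have h5 : C = C' := by simpa using h4
    subst h5
    exact ⟨C', Finset.mem_filter.2 ⟨h3, h2⟩, rfl⟩

lemma hamCount_eq_sum (r ℓ n : ℕ) (G : Set (Finset (Fin n))) :
    (hamCount r ℓ n G : ℝ) = ∑ C ∈ copies r ℓ n,
      Set.indicator {G : Set (Finset (Fin n)) | (C : Set (Finset (Fin n))) ⊆ G} 1 G := by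
  classical
  rw [hamCount_eq_card, Finset.card_filter]
  push_cast
  apply Finset.sum_congr rfl
  intro C _
  by_cases h : (C : Set (Finset (Fin n))) ⊆ G <;> simp [h]

lemma firstMoment_eq {r ℓ n m : ℕ} (h : ℓ < r) (hn : n = m * (r - ℓ)) (hrn : r < n)
    (p : unitInterval) : firstMoment r ℓ n p = (copies r ℓ n).card * (p : ℝ) ^ m := by
  unfold firstMoment randomHypergraph
  simp_rw [hamCount_eq_sum]
  rw [integral_finsetSum]
  · rw [← nsmul_eq_mul]
    apply Finset.sum_eq_card_nsmul
    intro C hC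
    rw [integral_indicator_one (measurableSet_subset C),
      setBernoulli_real_subset _ _ _ (card_edge_of_mem_copies h hn hrn hC),
      card_of_mem_copies h hn hrn hC]
  · intro C _
    exact (integrable_const _).indicator (measurableSet_subset C)

lemma secondMoment_eq {r ℓ n m : ℕ} (h : ℓ < r) (hn : n = m * (r - ℓ)) (hrn : r < n)
    (p : unitInterval) : secondMoment r ℓ n p =
      ∑ C ∈ copies r ℓ n ×ˢ copies r ℓ n, (p : ℝ) ^ (C.1 ∪ C.2).card := by
  unfold secondMoment randomHypergraph
  have e : ∀ G, (hamCount r ℓ n G : ℝ) ^ 2 = ∑ C ∈ copies r ℓ n ×ˢ copies r ℓ n,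
      Set.indicator {G : Set (Finset (Fin n)) |
        ((C.1 ∪ C.2 : Finset (Finset (Fin n))) : Set (Finset (Fin n))) ⊆ G} (1 : Set (Finset (Fin n)) → ℝ) G := by
    intro G
    rw [sq, hamCount_eq_sum, Finset.sum_mul_sum, ← Finset.sum_product']
    apply Finset.sum_congr rfl
    intro C _
    by_cases h1 : (C.1 : Set (Finset (Fin n))) ⊆ G <;>
      by_cases h2 : (C.2 : Set (Finset (Fin n))) ⊆ G <;> simp [h1, h2]
  simp_rw [e]
  rw [integral_finsetSum]
  · apply Finset.sum_congr rfl
    intro C hC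
    obtain ⟨h1, h2⟩ := Finset.mem_product.1 hC
    rw [integral_indicator_one (measurableSet_subset _), setBernoulli_real_subset]
    rw [Finset.coe_union]
    exact Set.union_subset (card_edge_of_mem_copies h hn hrn h1)
      (card_edge_of_mem_copies h hn hrn h2)
  · intro C _
    exact (integrable_const _).indicator (measurableSet_subset _)

lemma copies_card_pos (r ℓ n : ℕ) : 0 < (copies r ℓ n).card :=
  Finset.card_pos.2 ⟨_, Finset.mem_image_of_mem _ (Finset.mem_univ 1)⟩

lemma momentRatio_eq_sum_copies {r ℓ n m : ℕ} (h : ℓ < r) (hn : n = m * (r - ℓ)) (hrn : r < n)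
    {p : unitInterval} (hp : 0 < (p : ℝ)) :
    momentRatio r ℓ n p = (∑ C ∈ copies r ℓ n ×ˢ copies r ℓ n,
      ((p : ℝ) ^ (C.1 ∩ C.2).card)⁻¹) / ((copies r ℓ n).card : ℝ) ^ 2 := by
  unfold momentRatio
  rw [secondMoment_eq h hn hrn, firstMoment_eq h hn hrn]
  have hN : (0 : ℝ) < (copies r ℓ n).card := by exact_mod_cast copies_card_pos r ℓ n
  have e : ∑ C ∈ copies r ℓ n ×ˢ copies r ℓ n, (p : ℝ) ^ (C.1 ∪ C.2).card =
      (∑ C ∈ copies r ℓ n ×ˢ copies r ℓ n, ((p : ℝ) ^ (C.1 ∩ C.2).card)⁻¹) * (p : ℝ) ^ (2 * m) := by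
    rw [Finset.sum_mul]
    apply Finset.sum_congr rfl
    intro C hC
    obtain ⟨h1, h2⟩ := Finset.mem_product.1 hC
    have h3 := Finset.card_union_add_card_inter C.1 C.2
    rw [card_of_mem_copies h hn hrn h1, card_of_mem_copies h hn hrn h2] at h3
    rw [eq_comm, inv_mul_eq_iff_eq_mul₀ (by positivity), ← pow_add]
    congr 1
    omega
  rw [e, mul_pow, ← pow_mul, mul_comm m 2, mul_div_mul_right _ _ (by positivity)]

lemma momentRatio_eq_sum_overlapProb {r ℓ n m : ℕ} (h : ℓ < r) (hn : n = m * (r - ℓ)) (hrn : r < n)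
    {p : unitInterval} (hp : 0 < (p : ℝ)) :
    momentRatio r ℓ n p =
      ∑ t ∈ Finset.range (n / (r - ℓ) + 1), overlapProb r ℓ n t / (p : ℝ) ^ t := by
  have hs : 0 < r - ℓ := by omega
  have hm : n / (r - ℓ) = m := by rw [hn, Nat.mul_div_cancel _ hs]
  rw [momentRatio_eq_sum_copies h hn hrn hp, hm]
  have hmaps : ∀ C ∈ copies r ℓ n ×ˢ copies r ℓ n, (C.1 ∩ C.2).card ∈ Finset.range (m + 1) := by
    intro C hC
    obtain ⟨h1, h2⟩ := Finset.mem_product.1 hC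
    have := Finset.card_le_card (Finset.inter_subset_left (s₁ := C.1) (s₂ := C.2))
    rw [card_of_mem_copies h hn hrn h1] at this
    exact Finset.mem_range.2 (by omega)
  rw [← Finset.sum_fiberwise_of_maps_to hmaps, Finset.sum_div]
  apply Finset.sum_congr rfl
  intro t _
  rw [Finset.sum_congr rfl (g := fun _ => ((p : ℝ) ^ t)⁻¹)]
  · rw [Finset.sum_const, nsmul_eq_mul, overlapProb]
    ring
  · intro C hC
    rw [(Finset.mem_filter.1 hC).2]

/-- By symmetry the first copy may be fixed: relabelling both copies by the same permutation
preserves the number of common edges. -/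
lemma momentRatio_eq_sum_perm {r ℓ n m : ℕ} (h : ℓ < r) (hn : n = m * (r - ℓ)) (hrn : r < n)
    {p : unitInterval} (hp : 0 < (p : ℝ)) :
    momentRatio r ℓ n p = (∑ σ : Equiv.Perm (Fin n),
      ((p : ℝ) ^ (cycle r ℓ n ∩ relabel σ (cycle r ℓ n)).card)⁻¹) / (n.factorial : ℝ) := by
  rw [momentRatio_eq_sum_copies h hn hrn hp]
  set A := autCount (cycle r ℓ n) with hA
  have hA0 : (0 : ℝ) < A := by exact_mod_cast autCount_pos _
  have hN : (0 : ℝ) < (copies r ℓ n).card := by exact_mod_cast copies_card_pos r ℓ n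
  have hAN : (A : ℝ) * (copies r ℓ n).card = n.factorial := by
    exact_mod_cast autCount_mul_card_copies r ℓ n
  set S := ∑ σ : Equiv.Perm (Fin n),
      ((p : ℝ) ^ (cycle r ℓ n ∩ relabel σ (cycle r ℓ n)).card)⁻¹ with hS
  set T := ∑ C ∈ copies r ℓ n ×ˢ copies r ℓ n, ((p : ℝ) ^ (C.1 ∩ C.2).card)⁻¹ with hT
  have h1 : (A : ℝ) * T = (copies r ℓ n).card * S := by
    rw [hT, Finset.sum_product, Finset.mul_sum, ← nsmul_eq_mul]
    apply Finset.sum_eq_card_nsmul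
    intro C hC
    obtain ⟨τ, _, rfl⟩ := Finset.mem_image.1 hC
    have h2 := sum_copies r ℓ n (fun C' => ((p : ℝ) ^ (relabel τ (cycle r ℓ n) ∩ C').card)⁻¹)
    rw [nsmul_eq_mul] at h2
    rw [← h2, hS]
    symm
    apply Fintype.sum_equiv (Equiv.mulLeft τ)
    intro σ
    rw [Equiv.coe_mulLeft, relabel_mul, ← relabel_inter, card_relabel]
  rw [← hAN, div_eq_div_iff (by positivity) (by positivity)]
  calc T * (A * (copies r ℓ n).card) = (A * T) * (copies r ℓ n).card := by ring
    _ = _ := by rw [h1]; ring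

lemma one_le_momentRatio {r ℓ n m : ℕ} (h : ℓ < r) (hn : n = m * (r - ℓ)) (hrn : r < n)
    {p : unitInterval} (hp : 0 < (p : ℝ)) : 1 ≤ momentRatio r ℓ n p := by
  rw [momentRatio_eq_sum_perm h hn hrn hp, le_div_iff₀ (by positivity), one_mul]
  calc (n.factorial : ℝ) = ∑ _σ : Equiv.Perm (Fin n), (1 : ℝ) := by
        simp [Fintype.card_perm]
    _ ≤ _ := by
        apply Finset.sum_le_sum
        intro σ _
        exact (one_le_inv₀ (by positivity)).2 (pow_le_one₀ hp.le p.2.2)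

/-- The second moment is bounded by a sum over the sub-hypergraphs of the cycle. -/
lemma momentRatio_le_sum_powerset {r ℓ n m : ℕ} (h : ℓ < r) (hn : n = m * (r - ℓ)) (hrn : r < n)
    {p : unitInterval} (hp : 0 < (p : ℝ)) :
    momentRatio r ℓ n p ≤ ∑ H ∈ (cycle r ℓ n).powerset,
      ((p : ℝ) ^ H.card)⁻¹ * ((embMaps (cycle r ℓ n) H).card / (n.factorial : ℝ)) := by
  rw [momentRatio_eq_sum_perm h hn hrn hp, Finset.sum_div]
  -- The left side is the term of the right-hand sum for `H` equal to the set of common edges.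
  have h1 : ∀ σ : Equiv.Perm (Fin n),
      ((p : ℝ) ^ (cycle r ℓ n ∩ relabel σ (cycle r ℓ n)).card)⁻¹ ≤
        ∑ H ∈ (cycle r ℓ n).powerset,
          if H ⊆ relabel σ (cycle r ℓ n) then ((p : ℝ) ^ H.card)⁻¹ else 0 := by
    intro σ
    have h2 := Finset.single_le_sum (s := (cycle r ℓ n).powerset)
      (f := fun H => if H ⊆ relabel σ (cycle r ℓ n) then ((p : ℝ) ^ H.card)⁻¹ else 0)
      (by intro H _; split_ifs <;> positivity)
      (Finset.mem_powerset.2 (Finset.inter_subset_left (s₂ := relabel σ (cycle r ℓ n))))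
    simpa using h2
  have h3 : ∀ H : Finset (Finset (Fin n)), ∑ σ : Equiv.Perm (Fin n),
      (if H ⊆ relabel σ (cycle r ℓ n) then ((p : ℝ) ^ H.card)⁻¹ else 0) =
      ((p : ℝ) ^ H.card)⁻¹ * (embMaps (cycle r ℓ n) H).card := by
    intro H
    have h4 : (Finset.univ.filter (fun σ => H ⊆ relabel σ (cycle r ℓ n))).card =
        (embMaps (cycle r ℓ n) H).card := by
      apply Finset.card_bij (fun σ _ => σ⁻¹)
      · intro σ hσ
        exact (subset_relabel_iff _ _ _).1 (Finset.mem_filter.1 hσ).2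
      · intro σ _ σ' _ h
        exact inv_injective h
      · intro σ hσ
        refine ⟨σ⁻¹, Finset.mem_filter.2 ⟨Finset.mem_univ _, ?_⟩, inv_inv _⟩
        rw [subset_relabel_iff, inv_inv]
        exact hσ
    rw [← Finset.sum_filter, Finset.sum_const, h4, nsmul_eq_mul, mul_comm]
  calc _ ≤ ∑ σ : Equiv.Perm (Fin n), (∑ H ∈ (cycle r ℓ n).powerset,
          if H ⊆ relabel σ (cycle r ℓ n) then ((p : ℝ) ^ H.card)⁻¹ else 0) / (n.factorial : ℝ) := by
        apply Finset.sum_le_sum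
        intro σ _
        gcongr
        exact h1 σ
    _ = _ := by
        rw [← Finset.sum_div, Finset.sum_comm, Finset.sum_div]
        apply Finset.sum_congr rfl
        intro H _
        rw [h3 H]
        ring

end RandomHypergraph

/-! ### Clusters of overlapping edges, and the exponential bound for their unions. -/

namespace RandomHypergraph

/-- Every term is dominated by that of some partner, and a partner determines its origin. This
bounds sums over structures by sums over the data of their decompositions. -/
lemma sum_le_sum_of_relation {α β : Type*} [DecidableEq β] {S : Finset α} {T : Finset β} {f : α → ℝ}
    {h : β → ℝ} (R : α → β → Prop) (hh : ∀ b ∈ T, 0 ≤ h b)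
    (hR : ∀ a ∈ S, ∃ b ∈ T, f a ≤ h b ∧ R a b)
    (hinj : ∀ a ∈ S, ∀ a' ∈ S, ∀ b, R a b → R a' b → a = a') : ∑ a ∈ S, f a ≤ ∑ b ∈ T, h b := by
  rcases S.eq_empty_or_nonempty with rfl | ⟨a0, ha0⟩
  · simpa using Finset.sum_nonneg hh
  have : Nonempty β := ⟨(hR a0 ha0).choose⟩
  choose! φ hφ using hR
  calc ∑ a ∈ S, f a ≤ ∑ a ∈ S, h (φ a) := Finset.sum_le_sum fun a ha => (hφ a ha).2.1
    _ = ∑ b ∈ S.image φ, h b := by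
        rw [Finset.sum_image]
        intro a ha a' ha' haa
        exact hinj a ha a' ha' (φ a) (hφ a ha).2.2 (haa ▸ (hφ a' ha').2.2)
    _ ≤ ∑ b ∈ T, h b := by
        apply Finset.sum_le_sum_of_subset_of_nonneg
        · intro b hb
          obtain ⟨a, ha, rfl⟩ := Finset.mem_image.1 hb
          exact (hφ a ha).1
        · intro b hb _
          exact hh b hb

/-- Splitting off the last maximal interval of a finite set of natural numbers. -/
lemma exists_last_interval {Q : Finset ℕ} (h0 : 0 ∈ Q) :
    (∃ k, 0 < k ∧ Q = Finset.range k) ∨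
    ∃ Q' : Finset ℕ, ∃ e g k : ℕ, 0 < g ∧ 0 < k ∧ 0 ∈ Q' ∧ e ∈ Q' ∧ Q' ⊆ Finset.range (e + 1) ∧
      Q = Q' ∪ Finset.Ico (e + 1 + g) (e + 1 + g + k) := by
  obtain ⟨M, hM, hmax⟩ : ∃ M ∈ Q, ∀ t ∈ Q, t ≤ M :=
    ⟨Q.max' ⟨0, h0⟩, Q.max'_mem _, fun t ht => Q.le_max' t ht⟩
  -- The least such `a` starts the last interval. Unless `a = 0`, `a - 1` is missing, so the gap
  -- before the interval is nonempty.
  have hex : ∃ a, a ≤ M ∧ Finset.Ico a (M + 1) ⊆ Q := by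
    refine ⟨M, le_rfl, ?_⟩
    intro t ht
    rw [Finset.mem_Ico] at ht
    have : t = M := by omega
    rwa [this]
  classical
  obtain ⟨ha, hsub⟩ := Nat.find_spec hex
  have hmin := fun b => Nat.find_min hex (m := b)
  generalize Nat.find hex = a at *
  rcases Nat.eq_zero_or_pos a with rfl | ha0
  · left
    refine ⟨M + 1, by omega, ?_⟩
    ext t
    rw [Finset.mem_range]
    constructor
    · intro ht; have := hmax t ht; omega
    · intro ht; exact hsub (Finset.mem_Ico.2 ⟨by omega, ht⟩)
  · right
    have hnot : a - 1 ∉ Q := by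
      intro h
      apply hmin (a - 1) (by omega)
      refine ⟨by omega, ?_⟩
      intro t ht
      rw [Finset.mem_Ico] at ht
      rcases (show t = a - 1 ∨ a ≤ t by omega) with rfl | h1
      · exact h
      · exact hsub (Finset.mem_Ico.2 ⟨h1, ht.2⟩)
    have hne : (Q.filter (fun t => t < a)).Nonempty := ⟨0, Finset.mem_filter.2 ⟨h0, ha0⟩⟩
    set Q' := Q.filter (fun t => t < a) with hQ'
    have he := Finset.max'_mem _ hne
    have hemax : ∀ t ∈ Q', t ≤ Q'.max' hne := fun t ht => Q'.le_max' t ht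
    generalize Q'.max' hne = e at *
    have he2 := Finset.mem_filter.1 he
    have hea : e ≠ a - 1 := fun h => hnot (h ▸ he2.1)
    refine ⟨Q', e, a - (e + 1), M + 1 - a, by omega, by omega,
      Finset.mem_filter.2 ⟨h0, ha0⟩, he, ?_, ?_⟩
    · intro t ht
      have := hemax t ht
      exact Finset.mem_range.2 (by omega)
    · ext t
      rw [Finset.mem_union, Finset.mem_Ico, hQ', Finset.mem_filter]
      constructor
      · intro ht
        have := hmax t ht
        by_cases h : t < a
        · exact Or.inl ⟨ht, h⟩
        · right; omega
      · rintro (h | h)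
        · exact h.1
        · exact hsub (Finset.mem_Ico.2 ⟨by omega, by omega⟩)

/-- The edges of the cycle with indices in `x + Q`. -/
def arcs (n s r x : ℕ) (Q : Finset ℕ) : Finset (Finset (Fin n)) :=
  Q.image (fun t => arc n s r (x + t))

lemma seg_eq_arcs (n s r x k : ℕ) : seg n s r x k = arcs n s r x (Finset.range k) := rfl

lemma arcs_union (n s r x : ℕ) (Q Q' : Finset ℕ) :
    arcs n s r x (Q ∪ Q') = arcs n s r x Q ∪ arcs n s r x Q' := Finset.image_union _ _

lemma arcs_Ico (n s r x a k : ℕ) :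
    arcs n s r x (Finset.Ico a (a + k)) = seg n s r (x + a) k := by
  ext e
  simp only [arcs, seg, Finset.mem_image, Finset.mem_Ico, Finset.mem_range]
  constructor
  · rintro ⟨t, ht, rfl⟩
    exact ⟨t - a, by omega, by congr 1; omega⟩
  · rintro ⟨t, ht, rfl⟩
    exact ⟨a + t, by omega, by congr 1; omega⟩

lemma ofNat_mem_supp_arcs {r ℓ n m : ℕ} (P : Params r ℓ n m) [NeZero n] {x : ℕ} {Q : Finset ℕ}
    (hQ : ∀ t ∈ Q, t * (r - ℓ) + r ≤ n) {u : ℕ} (hu : u < n) :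
    Fin.ofNat n (x * (r - ℓ) + u) ∈ supp (arcs n (r - ℓ) r x Q) ↔
      ∃ t ∈ Q, t * (r - ℓ) ≤ u ∧ u < t * (r - ℓ) + r := by
  have hlt := P.lt
  have h2 := P.two_le
  rw [mem_supp]
  constructor
  · rintro ⟨e, he, hv⟩
    obtain ⟨t, ht, rfl⟩ := Finset.mem_image.1 he
    rw [ofNat_mem_arc_of_le P.eq (by omega) (hQ t ht) (by omega) hu] at hv
    exact ⟨t, ht, hv⟩
  · rintro ⟨t, ht, hv⟩
    refine ⟨_, Finset.mem_image_of_mem _ ht, ?_⟩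
    rw [ofNat_mem_arc_of_le P.eq (by omega) (hQ t ht) (by omega) hu]
    exact hv

/-- The number of vertices at given positions. -/
lemma card_image_ofNat {n : ℕ} [NeZero n] (a : ℕ) {S : Finset ℕ} (hS : ∀ u ∈ S, u < n) :
    (S.image (fun u => Fin.ofNat n (a + u))).card = S.card :=
  Finset.card_image_of_injOn fun u hu v hv h => ofNat_add_inj a (hS u hu) (hS v hv) h

lemma exists_interval_of_lt {r ℓ k u : ℕ} (h : ℓ < r) (hk : 0 < k) (hu : u < ℓ + k * (r - ℓ)) :
    ∃ i < k, i * (r - ℓ) ≤ u ∧ u < i * (r - ℓ) + r := by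
  have hs : 0 < r - ℓ := by omega
  by_cases h1 : u / (r - ℓ) < k
  · refine ⟨u / (r - ℓ), h1, Nat.div_mul_le_self _ _, ?_⟩
    have := Nat.lt_div_mul_add hs (a := u)
    omega
  · refine ⟨k - 1, by omega, ?_, ?_⟩
    · have h1 : k ≤ u / (r - ℓ) := by omega
      have h2 := (Nat.le_div_iff_mul_le hs).1 h1
      have h3 : (k - 1) * (r - ℓ) ≤ k * (r - ℓ) := Nat.mul_le_mul_right _ (by omega)
      omega
    · have h3 : (k - 1 + 1) * (r - ℓ) = k * (r - ℓ) := by congr 1; omega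
      rw [add_mul] at h3
      omega

/-- The edges of `Q` stop before position `(e + 1) s + ℓ`. As the gap is small, the new run covers
everything from there to its own end, which gives `g s` vertices more than its `k` edges account
for. These surplus vertices are the source of the gain `1 / n`. -/
lemma le_card_supp_union_seg {r ℓ n m : ℕ} (P : Params r ℓ n m) {x e g k : ℕ} {Q : Finset ℕ}
    (hk : 0 < k) (hQ : Q ⊆ Finset.range (e + 1)) (hg : (g + 1) * (r - ℓ) < r)
    (hfit : ℓ + (e + 1 + g + k) * (r - ℓ) ≤ n) :
    (supp (arcs n (r - ℓ) r x Q)).card + (k + g) * (r - ℓ) ≤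
      (supp (arcs n (r - ℓ) r x Q ∪ seg n (r - ℓ) r (x + (e + 1 + g)) k)).card := by
  have := P.neZero
  have hlt := P.lt
  have e1 : (e + 1 + g + k) * (r - ℓ) = (e + 1) * (r - ℓ) + (k + g) * (r - ℓ) := by ring
  have e2 : (e + 1 + g) * (r - ℓ) = (e + 1) * (r - ℓ) + g * (r - ℓ) := by ring
  have e3 : (e + 1 + g + k) * (r - ℓ) = (e + 1 + g) * (r - ℓ) + k * (r - ℓ) := by ring
  have e4 : (g + 1) * (r - ℓ) = g * (r - ℓ) + (r - ℓ) := by ring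
  have hQfit : ∀ t ∈ Q, t * (r - ℓ) + r ≤ (e + 1) * (r - ℓ) + ℓ := by
    intro t ht
    have h1 := Finset.mem_range.1 (hQ ht)
    have h2 : (t + 1) * (r - ℓ) ≤ (e + 1) * (r - ℓ) := Nat.mul_le_mul_right _ h1
    rw [add_mul] at h2
    omega
  rw [supp_union]
  set S := (Finset.Ico ((e + 1) * (r - ℓ) + ℓ) ((e + 1) * (r - ℓ) + ℓ + (k + g) * (r - ℓ))).image
    (fun u => Fin.ofNat n (x * (r - ℓ) + u)) with hS
  have hScard : S.card = (k + g) * (r - ℓ) := by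
    rw [hS, card_image_ofNat]
    · simp
    · intro u hu
      rw [Finset.mem_Ico] at hu
      omega
  have hdisj : Disjoint (supp (arcs n (r - ℓ) r x Q)) S := by
    rw [Finset.disjoint_left]
    intro v hv hvS
    obtain ⟨u, hu, rfl⟩ := Finset.mem_image.1 hvS
    rw [Finset.mem_Ico] at hu
    rw [ofNat_mem_supp_arcs P (fun t ht => by have := hQfit t ht; omega) (by omega)] at hv
    obtain ⟨t, ht, h1⟩ := hv
    have := hQfit t ht
    omega
  have hsub : S ⊆ supp (seg n (r - ℓ) r (x + (e + 1 + g)) k) := by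
    intro v hvS
    obtain ⟨u, hu, rfl⟩ := Finset.mem_image.1 hvS
    rw [Finset.mem_Ico] at hu
    obtain ⟨i, hi, hiu⟩ := exists_interval_of_lt hlt hk
      (show u - (e + 1 + g) * (r - ℓ) < ℓ + k * (r - ℓ) by omega)
    rw [mem_supp]
    refine ⟨arc n (r - ℓ) r (x + (e + 1 + g) + i),
      Finset.mem_image.2 ⟨i, Finset.mem_range.2 hi, rfl⟩, ?_⟩
    have e5 : (e + 1 + g + i) * (r - ℓ) = (e + 1 + g) * (r - ℓ) + i * (r - ℓ) := by ring
    have h6 : (i + 1) * (r - ℓ) ≤ k * (r - ℓ) := Nat.mul_le_mul_right _ hi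
    rw [add_mul] at h6
    rw [add_assoc, ofNat_mem_arc_of_le P.eq (by have := P.two_le; omega) (by omega) (by omega)
      (by omega)]
    omega
  calc _ = (supp (arcs n (r - ℓ) r x Q) ∪ S).card := by
        rw [Finset.card_union_of_disjoint hdisj, hScard]
    _ ≤ _ := Finset.card_le_card (Finset.union_subset_union le_rfl hsub)

lemma le_card_supp_seg {r ℓ n m : ℕ} (P : Params r ℓ n m) {x k : ℕ} (hk : 0 < k)
    (hfit : ℓ + k * (r - ℓ) ≤ n) : ℓ + k * (r - ℓ) ≤ (supp (seg n (r - ℓ) r x k)).card := by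
  have := P.neZero
  have hlt := P.lt
  rw [← Finset.card_range (ℓ + k * (r - ℓ)), ← card_image_ofNat (n := n) (x * (r - ℓ))
    (S := Finset.range (ℓ + k * (r - ℓ))) (by intro u hu; rw [Finset.mem_range] at hu; omega)]
  apply Finset.card_le_card
  intro v hv
  obtain ⟨u, hu, rfl⟩ := Finset.mem_image.1 hv
  rw [Finset.mem_range] at hu
  obtain ⟨i, hi, hiu⟩ := exists_interval_of_lt hlt hk hu
  have h6 : (i + 1) * (r - ℓ) ≤ k * (r - ℓ) := Nat.mul_le_mul_right _ hi
  rw [add_mul] at h6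
  rw [seg_eq_arcs, ofNat_mem_supp_arcs P _ (by omega)]
  · exact ⟨i, Finset.mem_range.2 hi, hiu⟩
  · intro t ht
    have h6 : (t + 1) * (r - ℓ) ≤ k * (r - ℓ) := Nat.mul_le_mul_right _ (Finset.mem_range.1 ht)
    rw [add_mul] at h6
    omega

/-- The weight of a sub-hypergraph: the number of its embeddings, times a factor `p⁻¹` for every
edge, times a factor `b` for every covered vertex. -/
noncomputable def weight (r ℓ n : ℕ) (p b : ℝ) (H : Finset (Finset (Fin n))) : ℝ :=
  embCount (cycle r ℓ n) H * (p ^ H.card)⁻¹ * b ^ (supp H).card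

section Weight

variable {r ℓ n m : ℕ} {p b : ℝ}

lemma weight_nonneg (hp : 0 < p) (hb : 0 ≤ b) (H : Finset (Finset (Fin n))) :
    0 ≤ weight r ℓ n p b H := by
  unfold weight; positivity

lemma weight_empty_le : weight r ℓ n p b ∅ ≤ 1 := by
  unfold weight
  have : ((embCount (cycle r ℓ n) ∅ : ℕ) : ℝ) ≤ 1 := by exact_mod_cast embCount_empty _
  simpa [supp] using this

lemma inv_pow_le_inv_pow (hp : 0 < p) (hp1 : p ≤ 1) {i j : ℕ} (hij : i ≤ j) :
    (p ^ i)⁻¹ ≤ (p ^ j)⁻¹ := by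
  apply inv_anti₀ (by positivity)
  exact pow_le_pow_of_le_one hp.le hp1 hij

lemma weight_le (hp : 0 < p) (hp1 : p ≤ 1) (hb : 0 ≤ b) (hb1 : b ≤ 1)
    {H : Finset (Finset (Fin n))} {E c v : ℕ} (hE : embCount (cycle r ℓ n) H ≤ E)
    (hc : H.card ≤ c) (hv : v ≤ (supp H).card) :
    weight r ℓ n p b H ≤ E * (p ^ c)⁻¹ * b ^ v := by
  unfold weight
  have h1 : ((embCount (cycle r ℓ n) H : ℕ) : ℝ) ≤ E := by exact_mod_cast hE
  have h2 := inv_pow_le_inv_pow hp hp1 hc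
  have h3 : b ^ (supp H).card ≤ b ^ v := pow_le_pow_of_le_one hb hb1 hv
  have : 0 ≤ (p ^ H.card)⁻¹ := by positivity
  gcongr

/-- Embeddings of the union restrict to pairs of embeddings, numbers of edges are subadditive, and
covered vertices add up exactly. -/
lemma weight_union_le (hp : 0 < p) (hp1 : p ≤ 1) (hb : 0 ≤ b) (hb1 : b ≤ 1)
    {H H' : Finset (Finset (Fin n))} (h : Disjoint (supp H) (supp H')) :
    weight r ℓ n p b (H ∪ H') ≤ weight r ℓ n p b H * weight r ℓ n p b H' := by
  refine (weight_le hp hp1 hb hb1 (embCount_union_le_mul _ H H') (Finset.card_union_le _ _)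
    (v := (supp H).card + (supp H').card) ?_).trans (le_of_eq ?_)
  · rw [supp_union, Finset.card_union_of_disjoint h]
  · unfold weight
    rw [pow_add, pow_add, mul_inv]
    push_cast
    ring

lemma card_seg_le (n s r x k : ℕ) : (seg n s r x k).card ≤ k :=
  Finset.card_image_le.trans (Finset.card_range k).le

lemma weight_seg_le (P : Params r ℓ n m) (hp : 0 < p) (hp1 : p ≤ 1) (hb : 0 ≤ b) (hb1 : b ≤ 1)
    {x k : ℕ} (hk : 0 < k) (hfit : ℓ + k * (r - ℓ) ≤ n) :
    weight r ℓ n p b (seg n (r - ℓ) r x k) ≤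
      m * autCount (path r ℓ k) * (p ^ k)⁻¹ * b ^ (ℓ + k * (r - ℓ)) := by
  refine (weight_le hp hp1 hb hb1 (embCount_seg_le P hk hfit) (card_seg_le _ _ _ _ _)
    (le_card_supp_seg P hk hfit)).trans (le_of_eq ?_)
  push_cast; ring

/-- Four positions for the new run against `(k + g) s` new vertices. -/
lemma weight_union_seg_le (P : Params r ℓ n m) (hp : 0 < p) (hp1 : p ≤ 1) (hb : 0 ≤ b)
    (hb1 : b ≤ 1) {x e g k : ℕ} {Q : Finset ℕ} (hk : 0 < k) (he : e ∈ Q)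
    (hQ : Q ⊆ Finset.range (e + 1)) (hg : (g + 1) * (r - ℓ) < r)
    (hfit : ℓ + (e + 1 + g + k) * (r - ℓ) ≤ n) :
    weight r ℓ n p b (arcs n (r - ℓ) r x (Q ∪ Finset.Ico (e + 1 + g) (e + 1 + g + k))) ≤
      weight r ℓ n p b (arcs n (r - ℓ) r x Q) *
        (4 * autCount (path r ℓ k) * (p ^ k)⁻¹ * b ^ ((k + g) * (r - ℓ))) := by
  rw [arcs_union, arcs_Ico]
  have h1 := embCount_union_seg_le_four P (x := x + e) (d := g + 1) (k := k)
    (H := arcs n (r - ℓ) r x Q) hk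
    (le_trans (by gcongr; omega) hfit) hg (Finset.mem_image_of_mem _ he)
  rw [show x + e + (g + 1) = x + (e + 1 + g) by ring] at h1
  refine (weight_le hp hp1 hb hb1 h1 ((Finset.card_union_le _ _).trans
    (Nat.add_le_add_left (card_seg_le _ _ _ _ _) _))
    (le_card_supp_union_seg P hk hQ hg hfit)).trans (le_of_eq ?_)
  unfold weight
  rw [pow_add, pow_add, mul_inv]
  push_cast
  ring

/-- A finite set of indices starting at `0` in which consecutive edges overlap. -/
def IsCluster (r ℓ : ℕ) (Q : Finset ℕ) : Prop :=
  0 ∈ Q ∧ ∀ t ∈ Q, (∃ t' ∈ Q, t < t') → ∃ t' ∈ Q, t < t' ∧ (t' - t) * (r - ℓ) < r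

open Classical in
/-- The clusters that do not wrap around the cycle. -/
noncomputable def clusters (r ℓ n m : ℕ) : Finset (Finset ℕ) :=
  (Finset.range m).powerset.filter
    (fun Q => IsCluster r ℓ Q ∧ ∀ t ∈ Q, t * (r - ℓ) + r ≤ n)

/-- The gaps between two edges that overlap. -/
def smallGaps (r ℓ : ℕ) : Finset ℕ :=
  (Finset.Icc 1 r).filter (fun g => (g + 1) * (r - ℓ) < r)

lemma lt_of_fit (P : Params r ℓ n m) {t : ℕ} (h : t * (r - ℓ) + r ≤ n) : t < m := by
  by_contra hc
  have : m * (r - ℓ) ≤ t * (r - ℓ) := Nat.mul_le_mul_right _ (by omega)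
  have := P.eq
  have := P.lt
  omega

lemma mem_clusters (P : Params r ℓ n m) {Q : Finset ℕ} :
    Q ∈ clusters r ℓ n m ↔ IsCluster r ℓ Q ∧ ∀ t ∈ Q, t * (r - ℓ) + r ≤ n := by
  classical
  unfold clusters
  rw [Finset.mem_filter, Finset.mem_powerset]
  constructor
  · exact fun h => h.2
  · intro h
    exact ⟨fun t ht => Finset.mem_range.2 (lt_of_fit P (h.2 t ht)), h⟩

open Classical in
/-- The total weight of the clusters with a given start satisfies a renewal inequality. -/
lemma sum_clusters_le (P : Params r ℓ n m) (hp : 0 < p) (hp1 : p ≤ 1) (hb : 0 ≤ b) (hb1 : b ≤ 1)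
    (x : ℕ) :
    ∑ Q ∈ clusters r ℓ n m, weight r ℓ n p b (arcs n (r - ℓ) r x Q) ≤
      ∑ k ∈ Finset.Icc 1 m, m * autCount (path r ℓ k) * (p ^ k)⁻¹ * b ^ (ℓ + k * (r - ℓ)) +
      (∑ Q ∈ clusters r ℓ n m, weight r ℓ n p b (arcs n (r - ℓ) r x Q)) *
        ∑ k ∈ Finset.Icc 1 m, ∑ g ∈ smallGaps r ℓ,
          (4 * autCount (path r ℓ k) * (p ^ k)⁻¹ * b ^ ((k + g) * (r - ℓ))) := by
  have hlt := P.lt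
  have hs := P.s_pos
  rw [← Finset.sum_filter_add_sum_filter_not (clusters r ℓ n m)
    -- The clusters that are intervals are the paths and give the first sum; all others have a gap.
    (fun Q => ∃ k, 0 < k ∧ Q = Finset.range k)]
  apply add_le_add
  · apply sum_le_sum_of_relation (fun Q k => Q = Finset.range k)
    · intro k _; positivity
    · intro Q hQ
      obtain ⟨hQ, k, hk, rfl⟩ := Finset.mem_filter.1 hQ
      have hfit := ((mem_clusters P).1 hQ).2 (k - 1) (Finset.mem_range.2 (by omega))
      have hkm := lt_of_fit P hfit
      have h1 : (k - 1 + 1) * (r - ℓ) = k * (r - ℓ) := by congr 1; omega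
      rw [add_mul] at h1
      refine ⟨k, Finset.mem_Icc.2 ⟨by omega, by omega⟩, ?_, rfl⟩
      rw [← seg_eq_arcs]
      exact weight_seg_le P hp hp1 hb hb1 hk (by omega)
    · rintro Q _ Q' _ k rfl rfl; rfl
  · rw [Finset.sum_filter_add_sum_filter_not, Finset.sum_mul_sum]
    simp_rw [Finset.mul_sum]
    rw [← Finset.sum_product' (f := fun (Q : Finset ℕ) (k : ℕ) => ∑ g ∈ smallGaps r ℓ,
      weight r ℓ n p b (arcs n (r - ℓ) r x Q) *
        (4 * autCount (path r ℓ k) * (p ^ k)⁻¹ * b ^ ((k + g) * (r - ℓ)))),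
      ← Finset.sum_product' (f := fun (a : Finset ℕ × ℕ) (g : ℕ) =>
      weight r ℓ n p b (arcs n (r - ℓ) r x a.1) *
        (4 * autCount (path r ℓ a.2) * (p ^ a.2)⁻¹ * b ^ ((a.2 + g) * (r - ℓ))))]
    -- A cluster with a gap is a smaller cluster `Q'` followed by a gap `g` and a run of `k` edges.
    -- The triple determines it, since `e` is the largest element of `Q'`.
    apply sum_le_sum_of_relation (fun Q a => ∃ e, e ∈ a.1.1 ∧ a.1.1 ⊆ Finset.range (e + 1) ∧
      Q = a.1.1 ∪ Finset.Ico (e + 1 + a.2) (e + 1 + a.2 + a.1.2))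
    · intro a _
      have := weight_nonneg (r := r) (ℓ := ℓ) hp hb (arcs n (r - ℓ) r x a.1.1)
      positivity
    · intro Q hQ
      obtain ⟨hQ, hnot⟩ := Finset.mem_filter.1 hQ
      obtain ⟨⟨h0, hcl⟩, hfit⟩ := (mem_clusters P).1 hQ
      rcases exists_last_interval h0 with h | ⟨Q', e, g, k, hg, hk, h0', he, hQ', rfl⟩
      · exact absurd h hnot
      -- The cluster condition at `e` gives a later edge overlapping edge `e`; the next one, `e + 1
      -- + g`, overlaps it all the more.
      have hgs : (g + 1) * (r - ℓ) < r := by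
        obtain ⟨t', ht', h1, h2⟩ := hcl e (Finset.mem_union_left _ he)
          ⟨e + 1 + g, Finset.mem_union_right _ (Finset.mem_Ico.2 ⟨le_rfl, by omega⟩), by omega⟩
        rcases Finset.mem_union.1 ht' with h3 | h3
        · have := Finset.mem_range.1 (hQ' h3); omega
        · rw [Finset.mem_Ico] at h3
          have h4 : (g + 1) * (r - ℓ) ≤ (t' - e) * (r - ℓ) := Nat.mul_le_mul_right _ (by omega)
          omega
      have hlast := hfit (e + 1 + g + k - 1)
        (Finset.mem_union_right _ (Finset.mem_Ico.2 ⟨by omega, by omega⟩))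
      have hkm := lt_of_fit P hlast
      have h1 : (e + 1 + g + k - 1 + 1) * (r - ℓ) = (e + 1 + g + k) * (r - ℓ) := by
        congr 1; omega
      rw [add_mul] at h1
      have hgr : g ≤ r := by
        have : (g + 1) * 1 ≤ (g + 1) * (r - ℓ) := Nat.mul_le_mul_left _ hs
        omega
      refine ⟨((Q', k), g), ?_, ?_, ?_⟩
      · simp only [Finset.mem_product]
        refine ⟨⟨(mem_clusters P).2 ⟨⟨h0', ?_⟩, fun t ht => hfit t (Finset.mem_union_left _ ht)⟩,
          Finset.mem_Icc.2 ⟨hk, by omega⟩⟩, Finset.mem_filter.2 ⟨Finset.mem_Icc.2 ⟨hg, hgr⟩, hgs⟩⟩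
        rintro t ht ⟨t', ht', htt'⟩
        obtain ⟨t'', h2, h3, h4⟩ := hcl t (Finset.mem_union_left _ ht)
          ⟨t', Finset.mem_union_left _ ht', htt'⟩
        rcases Finset.mem_union.1 h2 with h5 | h5
        · exact ⟨t'', h5, h3, h4⟩
        · rw [Finset.mem_Ico] at h5
          have h6 := Finset.mem_range.1 (hQ' ht')
          refine ⟨e, he, by omega, ?_⟩
          have h7 : (e - t) * (r - ℓ) ≤ (t'' - t) * (r - ℓ) := Nat.mul_le_mul_right _ (by omega)
          omega
      · exact weight_union_seg_le P hp hp1 hb hb1 hk he hQ' hgs (by omega)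
      · exact ⟨e, he, hQ', rfl⟩
    · rintro Q _ Q2 _ ⟨⟨Q', k⟩, g⟩ ⟨e, he, hQ', rfl⟩ ⟨e2, he2, hQ2', rfl⟩
      have h1 := Finset.mem_range.1 (hQ' he2)
      have h2 := Finset.mem_range.1 (hQ2' he)
      have : e = e2 := by omega
      rw [this]

/-- Choosing the first edge after an uncovered vertex. -/
lemma exists_arcs_eq (P : Params r ℓ n m) [NeZero n] {H : Finset (Finset (Fin n))}
    (hH : H ⊆ cycle r ℓ n) (hne : H.Nonempty) {v : Fin n} (hv : v ∉ supp H) :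
    ∃ x < m, ∃ F : Finset ℕ, 0 ∈ F ∧ H = arcs n (r - ℓ) r x F ∧ ∀ t ∈ F, t * (r - ℓ) + r ≤ n := by
  have hlt := P.lt
  have h2 := P.two_le
  have hs := P.s_pos
  -- `pos x` is the distance from the start of the edge `x` forward to the uncovered vertex. Its
  -- maximum over `H` is attained at the first edge after that vertex.
  choose pos hpos hposv using fun x => exists_eq_ofNat_add (x * (r - ℓ)) v
  obtain ⟨x, hx, hmax⟩ := Finset.exists_max_image
    ((Finset.range m).filter (fun x => arc n (r - ℓ) r x ∈ H)) pos (by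
      obtain ⟨e, he⟩ := hne
      obtain ⟨i, hi, rfl⟩ := (mem_cycle_iff hs P.eq e).1 (hH he)
      exact ⟨i, Finset.mem_filter.2 ⟨Finset.mem_range.2 hi, he⟩⟩)
  obtain ⟨hxm, hxH⟩ := Finset.mem_filter.1 hx
  refine ⟨x, Finset.mem_range.1 hxm, (Finset.range m).filter (fun t => arc n (r - ℓ) r (x + t) ∈ H),
    Finset.mem_filter.2 ⟨Finset.mem_range.2 P.m_pos, by simpa using hxH⟩, ?_, ?_⟩
  · ext e
    constructor
    · intro he
      obtain ⟨i, hi, rfl⟩ := (mem_cycle_iff hs P.eq e).1 (hH he)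
      obtain ⟨t, ht, h3⟩ := exists_add_modEq P.m_pos x i
      have h4 := arc_congr (n := n) (s := r - ℓ) (r := r) P.eq h3
      exact Finset.mem_image.2 ⟨t, Finset.mem_filter.2 ⟨Finset.mem_range.2 ht, h4 ▸ he⟩, h4⟩
    · intro he
      obtain ⟨t, ht, rfl⟩ := Finset.mem_image.1 he
      exact (Finset.mem_filter.1 ht).2
  · intro t ht
    obtain ⟨htm, htH⟩ := Finset.mem_filter.1 ht
    have htm := Finset.mem_range.1 htm
    have hT : t * (r - ℓ) < n := by
      rw [P.eq]; exact Nat.mul_lt_mul_of_pos_right htm hs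
    have hnot : ¬ (Fin.ofNat n (x * (r - ℓ) + pos x) ∈ arc n (r - ℓ) r (x + t)) := by
      intro h
      apply hv
      rw [mem_supp]
      refine ⟨_, htH, ?_⟩
      rw [hposv x]; exact h
    rw [ofNat_mem_arc P.eq (by omega) htm (hpos x)] at hnot
    by_cases hc : t * (r - ℓ) ≤ pos x
    · have := hpos x
      omega
    · exfalso
      -- An edge starting past `v` has `v` at distance `pos x + n - t s` ahead of it, more than the
      -- maximum `pos x`.
      have h3 := hmax ((x + t) % m) (Finset.mem_filter.2
        ⟨Finset.mem_range.2 (Nat.mod_lt _ P.m_pos), by rw [arc_mod P.eq]; exact htH⟩)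
      have h4 := hposv ((x + t) % m)
      have h5 : Fin.ofNat n ((x + t) % m * (r - ℓ) + pos ((x + t) % m)) =
          Fin.ofNat n ((x + t) % m * (r - ℓ) + (pos x + n - t * (r - ℓ))) := by
        rw [← h4, hposv x]
        apply Fin.ext
        simp only [Fin.ofNat_eq_cast, Fin.val_natCast]
        have h6 : (x + t) % m * (r - ℓ) ≡ (x + t) * (r - ℓ) [MOD n] := by
          rw [P.eq]; exact Nat.ModEq.mul_right' _ (Nat.mod_modEq _ _)
        have h7 : (x + t) % m * (r - ℓ) + (pos x + n - t * (r - ℓ)) ≡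
            (x + t) * (r - ℓ) + (pos x + n - t * (r - ℓ)) [MOD n] := Nat.ModEq.add_right _ h6
        rw [h7, add_mul]
        have h8 : x * (r - ℓ) + t * (r - ℓ) + (pos x + n - t * (r - ℓ)) =
            x * (r - ℓ) + pos x + n := by omega
        rw [h8, Nat.add_mod_right]
      have h6 := ofNat_add_inj _ (hpos _) (by omega) h5
      omega

open Classical in
/-- The sets of edges of the clusters. -/
noncomputable def clusterSets (r ℓ n m : ℕ) : Finset (Finset (Finset (Fin n))) :=
  (Finset.range m ×ˢ clusters r ℓ n m).image (fun a => arcs n (r - ℓ) r a.1 a.2)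

/-- Every sub-hypergraph that does not cover all vertices decomposes into clusters. -/
lemma exists_clusterSets (P : Params r ℓ n m) (hp : 0 < p) (hp1 : p ≤ 1) (hb : 0 ≤ b) (hb1 : b ≤ 1)
    (N : ℕ) : ∀ H : Finset (Finset (Fin n)), H.card = N → H ⊆ cycle r ℓ n → (∃ v, v ∉ supp H) →
      ∃ S ⊆ clusterSets r ℓ n m, S.biUnion id = H ∧
        weight r ℓ n p b H ≤ ∏ Q ∈ S, weight r ℓ n p b Q := by
  classical
  have := P.neZero
  have hlt := P.lt
  induction N using Nat.strong_induction_on with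
  | _ N ih =>
    intro H hN hH hv
    rcases H.eq_empty_or_nonempty with rfl | hne
    · exact ⟨∅, Finset.empty_subset _, rfl, by simpa using weight_empty_le⟩
    obtain ⟨v, hv⟩ := hv
    obtain ⟨x, hx, F, h0, rfl, hfit⟩ := exists_arcs_eq P hH hne hv
    -- The least such `e` ends the first cluster: no later edge overlaps it, while every earlier
    -- index has an overlapping successor. The largest index shows that one exists.
    have hex : ∃ e, e ∈ F ∧ ∀ t ∈ F, e < t → ¬ (t - e) * (r - ℓ) < r :=
      ⟨F.max' ⟨0, h0⟩, F.max'_mem _, fun t ht h => absurd (F.le_max' t ht) (by omega)⟩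
    obtain ⟨he, hemax⟩ := Nat.find_spec hex
    have hemin := fun t => Nat.find_min hex (m := t)
    generalize Nat.find hex = e at *
    set Q := F.filter (fun t => t ≤ e) with hQ
    set R := F.filter (fun t => ¬ t ≤ e) with hR
    have hF : F = Q ∪ R := (Finset.filter_union_filter_not_eq _ _).symm
    have hQc : Q ∈ clusters r ℓ n m := by
      rw [mem_clusters P]
      refine ⟨⟨Finset.mem_filter.2 ⟨h0, Nat.zero_le _⟩, ?_⟩,
        fun t ht => hfit t (Finset.mem_filter.1 ht).1⟩
      rintro t ht ⟨t', ht', htt'⟩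
      obtain ⟨htF, hte⟩ := Finset.mem_filter.1 ht
      obtain ⟨htF', hte'⟩ := Finset.mem_filter.1 ht'
      have h1 := hemin t (by omega)
      push Not at h1
      obtain ⟨t'', h2, h3, h4⟩ := h1 htF
      by_cases h5 : t'' ≤ e
      · exact ⟨t'', Finset.mem_filter.2 ⟨h2, h5⟩, h3, h4⟩
      · refine ⟨e, Finset.mem_filter.2 ⟨he, le_rfl⟩, by omega, ?_⟩
        have h7 : (e - t) * (r - ℓ) ≤ (t'' - t) * (r - ℓ) := Nat.mul_le_mul_right _ (by omega)
        omega
    have hdisj : Disjoint (supp (arcs n (r - ℓ) r x Q)) (supp (arcs n (r - ℓ) r x R)) := by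
      rw [Finset.disjoint_left]
      intro w hw hw'
      obtain ⟨u, hu, rfl⟩ := exists_eq_ofNat_add (x * (r - ℓ)) w
      rw [ofNat_mem_supp_arcs P (fun t ht => hfit t (Finset.mem_filter.1 ht).1) hu] at hw hw'
      obtain ⟨t, ht, h1⟩ := hw
      obtain ⟨t', ht', h2⟩ := hw'
      obtain ⟨_, hte⟩ := Finset.mem_filter.1 ht
      obtain ⟨htF', hte'⟩ := Finset.mem_filter.1 ht'
      have h3 := hemax t' htF' (by omega)
      have h4 : (t' - e) * (r - ℓ) ≤ (t' - t) * (r - ℓ) := Nat.mul_le_mul_right _ (by omega)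
      rw [Nat.sub_mul] at h4
      rw [Nat.sub_mul] at h4 h3
      have h5 : t * (r - ℓ) ≤ t' * (r - ℓ) := Nat.mul_le_mul_right _ (by omega)
      omega
    have hQR : arcs n (r - ℓ) r x F = arcs n (r - ℓ) r x Q ∪ arcs n (r - ℓ) r x R := by
      rw [← arcs_union, ← hF]
    have hxQ : arc n (r - ℓ) r (x + 0) ∈ arcs n (r - ℓ) r x Q :=
      Finset.mem_image_of_mem _ (Finset.mem_filter.2 ⟨h0, Nat.zero_le _⟩)
    have hxR : arc n (r - ℓ) r (x + 0) ∉ arcs n (r - ℓ) r x R := by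
      intro h
      have h1 : (arc n (r - ℓ) r (x + 0)).card = r :=
        card_arc P.eq (by have := P.two_le; omega) P.m_pos P.s_pos
      obtain ⟨w, hw⟩ := Finset.card_pos.1 (show 0 < (arc n (r - ℓ) r (x + 0)).card by omega)
      exact Finset.disjoint_left.1 hdisj (mem_supp.2 ⟨_, hxQ, hw⟩) (mem_supp.2 ⟨_, h, hw⟩)
    have hsub : arcs n (r - ℓ) r x R ⊆ arcs n (r - ℓ) r x F := by
      rw [hQR]; exact Finset.subset_union_right
    have hcard : (arcs n (r - ℓ) r x R).card < N := by
      rw [← hN]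
      apply Finset.card_lt_card
      refine Finset.ssubset_iff_subset_ne.2 ⟨hsub, fun h => hxR ?_⟩
      rw [h, hQR]
      exact Finset.mem_union_left _ hxQ
    obtain ⟨S, hS, hSu, hSw⟩ := ih _ hcard (arcs n (r - ℓ) r x R) rfl (hsub.trans hH)
      ⟨v, fun h => hv (supp_mono hsub h)⟩
    have hnotin : arcs n (r - ℓ) r x Q ∉ S := by
      intro h
      apply hxR
      rw [← hSu]
      exact Finset.mem_biUnion.2 ⟨_, h, hxQ⟩
    refine ⟨insert (arcs n (r - ℓ) r x Q) S, ?_, ?_, ?_⟩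
    · rw [Finset.insert_subset_iff]
      exact ⟨Finset.mem_image.2 ⟨(x, Q), Finset.mem_product.2 ⟨Finset.mem_range.2 hx, hQc⟩, rfl⟩, hS⟩
    · rw [Finset.biUnion_insert, hSu, hQR]; rfl
    · rw [Finset.prod_insert hnotin, hQR]
      refine (weight_union_le hp hp1 hb hb1 hdisj).trans ?_
      exact mul_le_mul_of_nonneg_left hSw (weight_nonneg hp hb _)

open Classical in
/-- The total weight of the nonempty sub-hypergraphs that do not cover all vertices. -/
lemma sum_weight_le_exp (P : Params r ℓ n m) (hp : 0 < p) (hp1 : p ≤ 1) (hb : 0 ≤ b)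
    (hb1 : b ≤ 1) :
    ∑ H ∈ (cycle r ℓ n).powerset.filter (fun H => H.Nonempty ∧ ∃ v, v ∉ supp H),
      weight r ℓ n p b H ≤
    Real.exp (∑ x ∈ Finset.range m, ∑ Q ∈ clusters r ℓ n m,
      weight r ℓ n p b (arcs n (r - ℓ) r x Q)) - 1 := by
  have hw := weight_nonneg (r := r) (ℓ := ℓ) (n := n) hp hb
  -- `H` is the union of its clusters, so different `H` give different sets of clusters; the empty
  -- set is left out as `H` is nonempty.
  have h1 : ∑ H ∈ (cycle r ℓ n).powerset.filter (fun H => H.Nonempty ∧ ∃ v, v ∉ supp H),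
      weight r ℓ n p b H ≤ ∑ S ∈ (clusterSets r ℓ n m).powerset.erase ∅,
        ∏ Q ∈ S, weight r ℓ n p b Q := by
    apply sum_le_sum_of_relation (fun H S => S.biUnion id = H)
    · intro S _
      exact Finset.prod_nonneg fun Q _ => hw Q
    · intro H hH
      obtain ⟨h1, h2, h3⟩ := Finset.mem_filter.1 hH
      obtain ⟨S, hS, hSu, hSw⟩ := exists_clusterSets P hp hp1 hb hb1 _ H rfl
        (Finset.mem_powerset.1 h1) h3
      refine ⟨S, Finset.mem_erase.2 ⟨?_, Finset.mem_powerset.2 hS⟩, hSw, hSu⟩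
      rintro rfl
      rw [← hSu] at h2
      simp at h2
    · rintro H _ H' _ S rfl rfl; rfl
  -- Summing products over all subsets gives `∏ (1 + w)`, at most `exp (∑ w)`; the omitted empty set
  -- is the `- 1`.
  have h2 : ∑ S ∈ (clusterSets r ℓ n m).powerset.erase ∅, ∏ Q ∈ S, weight r ℓ n p b Q =
      ∏ Q ∈ clusterSets r ℓ n m, (1 + weight r ℓ n p b Q) - 1 := by
    rw [Finset.prod_one_add, ← Finset.add_sum_erase _ _ (Finset.empty_mem_powerset _)]
    simp
  have h3 : ∏ Q ∈ clusterSets r ℓ n m, (1 + weight r ℓ n p b Q) ≤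
      Real.exp (∑ Q ∈ clusterSets r ℓ n m, weight r ℓ n p b Q) := by
    rw [Real.exp_sum]
    apply Finset.prod_le_prod
    · intro Q _
      have := hw Q
      positivity
    · intro Q _
      rw [add_comm]
      exact Real.add_one_le_exp _
  have h4 : ∑ Q ∈ clusterSets r ℓ n m, weight r ℓ n p b Q ≤
      ∑ x ∈ Finset.range m, ∑ Q ∈ clusters r ℓ n m,
        weight r ℓ n p b (arcs n (r - ℓ) r x Q) := by
    rw [← Finset.sum_product']
    apply sum_le_sum_of_relation (fun H a => arcs n (r - ℓ) r a.1 a.2 = H)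
    · intro a _
      exact hw _
    · intro H hH
      obtain ⟨a, ha, rfl⟩ := Finset.mem_image.1 hH
      exact ⟨a, ha, le_rfl, rfl⟩
    · rintro H _ H' _ a rfl rfl; rfl
  have h5 := Real.exp_le_exp.2 h4
  linarith

end Weight

end RandomHypergraph

/-! ### Falling factorials, and the size of the path terms. -/

namespace RandomHypergraph

/-- The ratio of `n ^ v` and the falling factorial `n (n - 1) ⋯ (n - v + 1)`. -/
noncomputable def fallRatio (n v : ℕ) : ℝ := (n : ℝ) ^ v * (n - v).factorial / n.factorial

lemma fallRatio_zero (n : ℕ) : fallRatio n 0 = 1 := by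
  unfold fallRatio
  have : (n.factorial : ℝ) ≠ 0 := by positivity
  simp [this]

lemma fallRatio_nonneg (n v : ℕ) : 0 ≤ fallRatio n v := by unfold fallRatio; positivity

lemma fallRatio_succ {n v : ℕ} (h : v < n) :
    fallRatio n (v + 1) = fallRatio n v * ((n : ℝ) / ((n : ℝ) - v)) := by
  unfold fallRatio
  have h1 : (n - v).factorial = (n - v) * (n - (v + 1)).factorial := by
    rw [show n - v = n - (v + 1) + 1 by omega, Nat.factorial_succ]
  have h2 : ((n - v : ℕ) : ℝ) = (n : ℝ) - v := Nat.cast_sub h.le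
  have h3 : (0 : ℝ) < (n : ℝ) - v := by
    rw [← h2]; exact_mod_cast (show 0 < n - v by omega)
  rw [h1, pow_succ]
  push_cast
  rw [h2]
  field_simp

/-- The successive quotients `n / (n - v)` increase, so `log (fallRatio n v)` is convex in `v` and
vanishes at 0: it lies below its chord to `V`. According to whether the quotient at `v` is below
`exp θ`, the quotients up to `v` or those from `v` to `V` are compared with `exp θ`. -/
lemma fallRatio_le_exp_of_le {n V v : ℕ} {θ : ℝ} (hV : V < n) (hv : v ≤ V)
    (h : fallRatio n V ≤ Real.exp (θ * V)) : fallRatio n v ≤ Real.exp (θ * v) := by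
  have hpos : ∀ i ≤ V, (0 : ℝ) < (n : ℝ) - i := by
    intro i hi
    have : (i : ℝ) < n := by exact_mod_cast (show i < n by omega)
    linarith
  rcases le_total ((n : ℝ) / ((n : ℝ) - v)) (Real.exp θ) with hc | hc
  · have key : ∀ i ≤ v, fallRatio n i ≤ Real.exp (θ * i) := by
      intro i
      induction i with
      | zero => intro _; simp [fallRatio_zero]
      | succ i ih =>
        intro hi
        rw [fallRatio_succ (by omega)]
        push_cast
        rw [mul_add, mul_one, Real.exp_add]
        have h1 : (n : ℝ) / ((n : ℝ) - i) ≤ (n : ℝ) / ((n : ℝ) - v) := by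
          have h2 := hpos v hv
          have h3 : (i : ℝ) ≤ v := by exact_mod_cast (show i ≤ v by omega)
          gcongr
        have h4 := hpos i (by omega)
        exact mul_le_mul (ih (by omega)) (h1.trans hc) (by positivity) (Real.exp_pos _).le
    exact key v le_rfl
  · have key : ∀ j, v + j ≤ V → fallRatio n v * Real.exp (θ * j) ≤ fallRatio n (v + j) := by
      intro j
      induction j with
      | zero => intro _; simp
      | succ j ih =>
        intro hj
        rw [← add_assoc, fallRatio_succ (by omega)]
        push_cast
        rw [mul_add, mul_one, Real.exp_add, ← mul_assoc]
        have h1 : (n : ℝ) / ((n : ℝ) - v) ≤ (n : ℝ) / ((n : ℝ) - (v + j)) := by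
          have h2 := hpos (v + j) (by omega)
          push_cast at h2
          have h3 : (0 : ℝ) ≤ j := by positivity
          gcongr
          linarith
        exact mul_le_mul (ih (by omega)) (hc.trans h1) (Real.exp_pos _).le (fallRatio_nonneg _ _)
    have h1 := key (V - v) (by omega)
    rw [show v + (V - v) = V by omega] at h1
    have h2 := h1.trans h
    rw [← le_div_iff₀ (Real.exp_pos _), ← Real.exp_sub, Nat.cast_sub hv] at h2
    refine h2.trans (le_of_eq ?_)
    congr 1
    ring

lemma pow_le_exp_mul_factorial (n : ℕ) : (n : ℝ) ^ n ≤ Real.exp n * n.factorial := by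
  have h := Real.pow_div_factorial_le_exp (x := (n : ℝ)) (by positivity) n
  rwa [div_le_iff₀ (by positivity)] at h

/-- From `n ^ n ≤ e ^ n n!` and `Y! ≤ Y ^ Y` the ratio is at most `e ^ n (Y / n) ^ Y`. As `Y / n ≤ 1
/ 8 ≤ e ^ (-2)`, this is at most `e ^ (n - 2 Y)`, and `δ n ≤ Y` turns it into rate `1 - δ`. -/
lemma fallRatio_le_exp {n Y : ℕ} {δ : ℝ} (hδ0 : 0 ≤ δ) (hδ : δ * n ≤ Y) (hY : 8 * Y ≤ n)
    (hY0 : 0 < Y) : fallRatio n (n - Y) ≤ Real.exp ((1 - δ) * ((n - Y : ℕ) : ℝ)) := by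
  have hn : (0 : ℝ) < n := by exact_mod_cast (show 0 < n by omega)
  have hYn : Y ≤ n := by omega
  have h1 : fallRatio n (n - Y) ≤ Real.exp n * ((Y : ℝ) / n) ^ Y := by
    unfold fallRatio
    rw [show n - (n - Y) = Y by omega, div_le_iff₀ (by positivity)]
    have h2 : ((Y.factorial : ℕ) : ℝ) ≤ (Y : ℝ) ^ Y := by exact_mod_cast Nat.factorial_le_pow Y
    have h3 := pow_le_exp_mul_factorial n
    have h4 : (n : ℝ) ^ n = (n : ℝ) ^ (n - Y) * (n : ℝ) ^ Y := by
      rw [← pow_add]; congr 1; omega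
    calc (n : ℝ) ^ (n - Y) * Y.factorial ≤ (n : ℝ) ^ (n - Y) * (Y : ℝ) ^ Y := by gcongr
      _ = (n : ℝ) ^ n * ((Y : ℝ) / n) ^ Y := by rw [h4, div_pow]; field_simp
      _ ≤ (Real.exp n * n.factorial) * ((Y : ℝ) / n) ^ Y := by gcongr
      _ = _ := by ring
  have h2 : (Y : ℝ) / n ≤ Real.exp (-2) := by
    have h3 : (Y : ℝ) / n ≤ 1 / 8 := by
      rw [div_le_div_iff₀ hn (by norm_num)]
      have : ((8 * Y : ℕ) : ℝ) ≤ n := by exact_mod_cast hY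
      push_cast at this
      linarith
    have h4 : Real.exp 2 ≤ 8 := by
      have h5 := Real.exp_one_lt_d9
      have h6 : Real.exp 2 = Real.exp 1 ^ 2 := by rw [← Real.exp_nat_mul]; norm_num
      rw [h6]
      nlinarith [Real.exp_pos 1]
    have h7 : (1 : ℝ) / 8 ≤ Real.exp (-2) := by
      rw [Real.exp_neg, ← one_div]
      exact one_div_le_one_div_of_le (Real.exp_pos _) h4
    exact h3.trans h7
  calc _ ≤ Real.exp n * ((Y : ℝ) / n) ^ Y := h1
    _ ≤ Real.exp n * Real.exp (-2) ^ Y := by gcongr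
    _ = Real.exp (n - 2 * Y) := by rw [← Real.exp_nat_mul, ← Real.exp_add]; congr 1; ring
    _ ≤ _ := by
        apply Real.exp_le_exp.2
        rw [Nat.cast_sub hYn]
        have : (0 : ℝ) ≤ Y := by positivity
        nlinarith

lemma sq_le_exp {δ : ℝ} (hδ : 0 < δ) {x : ℝ} (hx : 0 ≤ x) :
    x ^ 2 ≤ 8 / δ ^ 2 * Real.exp (δ / 2 * x) := by
  have h1 := Real.quadratic_le_exp_of_nonneg (x := δ / 2 * x) (by positivity)
  rw [div_mul_eq_mul_div, le_div_iff₀ (by positivity)]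
  have : 0 ≤ δ / 2 * x := by positivity
  nlinarith

/-- The falling factorial is close to the power, up to an exponential factor of rate below `1`. -/
lemma fallRatio_le {n v : ℕ} {δ : ℝ} (hδ0 : 0 < δ) (hδ : δ ≤ 1 / 16) (hn : 16 ≤ n)
    (hv : δ * n ≤ (n - v : ℕ)) :
    fallRatio n v ≤ 1 + 8 / δ ^ 3 / n * Real.exp ((1 - δ / 2) * v) := by
  have hn0 : (0 : ℝ) < n := by exact_mod_cast (show 0 < n by omega)
  -- The chord bound is applied at `n - Y`, beyond every admissible `v`; `δ ≤ 1 / 16` and `n ≥ 16`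
  -- give `8 Y ≤ n`.
  set Y := ⌈δ * n⌉₊ with hYdef
  have hδn : 0 < δ * n := by positivity
  have hY1 : δ * n ≤ Y := Nat.le_ceil _
  have hY0 : 0 < Y := Nat.ceil_pos.2 hδn
  have hYv : Y ≤ n - v := Nat.ceil_le.2 hv
  have hY8 : 8 * Y ≤ n := by
    have h1 := Nat.ceil_lt_add_one hδn.le
    have h2 : (8 * Y : ℝ) < n / 2 + 8 := by
      have h3 : δ * n ≤ 1 / 16 * n := by gcongr
      linarith
    have h4 : (16 : ℝ) ≤ n := by exact_mod_cast hn
    have h5 : ((8 * Y : ℕ) : ℝ) ≤ n := by push_cast; linarith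
    exact_mod_cast h5
  have hV := fallRatio_le_exp hδ0.le hY1 hY8 hY0
  have hle : ∀ i ≤ v, fallRatio n i ≤ Real.exp ((1 - δ) * i) := fun i hi =>
    fallRatio_le_exp_of_le (by omega) (by omega) hV
  -- Telescoping: the factor `n / (n - i) = 1 + i / (n - i)` adds at most `i / (δ n)` times the
  -- crude bound `e ^ ((1 - δ) i)`, and these increments sum to the order `v² / n`.
  have key : ∀ i ≤ v, fallRatio n i ≤ 1 + (i : ℝ) ^ 2 / (δ * n) * Real.exp ((1 - δ) * i) := by
    intro i
    induction i with
    | zero => intro _; simp [fallRatio_zero]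
    | succ i ih =>
      intro hi
      rw [fallRatio_succ (by omega)]
      have h1 : δ * n ≤ (n : ℝ) - i := by
        have h2 : ((n - v : ℕ) : ℝ) ≤ ((n - i : ℕ) : ℝ) := by
          exact_mod_cast (show n - v ≤ n - i by omega)
        rw [Nat.cast_sub (show i ≤ n by omega)] at h2
        linarith
      have h2 : (n : ℝ) / ((n : ℝ) - i) = 1 + i / ((n : ℝ) - i) := by
        have : (n : ℝ) - i ≠ 0 := by linarith
        field_simp; ring
      have h3 : (i : ℝ) / ((n : ℝ) - i) ≤ i / (δ * n) := by gcongr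
      have h4 := ih (by omega)
      have h5 := hle i (by omega)
      have h6 := fallRatio_nonneg n i
      have h7 : Real.exp ((1 - δ) * i) ≤ Real.exp ((1 - δ) * ((i + 1 : ℕ) : ℝ)) := by
        apply Real.exp_le_exp.2
        push_cast
        nlinarith
      have h8 : (0 : ℝ) ≤ i / (δ * n) := by positivity
      calc fallRatio n i * ((n : ℝ) / ((n : ℝ) - i))
          = fallRatio n i + fallRatio n i * (i / ((n : ℝ) - i)) := by rw [h2]; ring
        _ ≤ (1 + (i : ℝ) ^ 2 / (δ * n) * Real.exp ((1 - δ) * i)) +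
            Real.exp ((1 - δ) * i) * (i / (δ * n)) := by
              apply add_le_add h4
              exact mul_le_mul h5 h3 (div_nonneg (Nat.cast_nonneg i) (by linarith))
                (Real.exp_pos _).le
        _ = 1 + ((i : ℝ) ^ 2 + i) / (δ * n) * Real.exp ((1 - δ) * i) := by ring
        _ ≤ 1 + (((i + 1 : ℕ) : ℝ)) ^ 2 / (δ * n) * Real.exp ((1 - δ) * ((i + 1 : ℕ) : ℝ)) := by
              gcongr
              push_cast
              have : (0 : ℝ) ≤ i := by positivity
              nlinarith
  refine (key v le_rfl).trans ?_
  -- Half of the saving `δ` in the rate absorbs `v²`.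
  have h1 := sq_le_exp hδ0 (show (0 : ℝ) ≤ v by positivity)
  have h2 : Real.exp ((1 - δ / 2) * v) = Real.exp (δ / 2 * v) * Real.exp ((1 - δ) * v) := by
    rw [← Real.exp_add]; congr 1; ring
  rw [h2]
  calc 1 + (v : ℝ) ^ 2 / (δ * n) * Real.exp ((1 - δ) * v)
      ≤ 1 + (8 / δ ^ 2 * Real.exp (δ / 2 * v)) / (δ * n) * Real.exp ((1 - δ) * v) := by gcongr
    _ = _ := by field_simp

section Terms

variable {r ℓ n m : ℕ} {p q : ℝ}

lemma cast_s (h : ℓ < r) : ((r - ℓ : ℕ) : ℝ) = (r : ℝ) - ℓ := Nat.cast_sub h.le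

lemma lam_pos (r ℓ : ℕ) : 0 < lam r ℓ := by
  rw [lam_eq_lamNat]; exact_mod_cast lamNat_pos r ℓ

lemma coeffA_nonneg (r ℓ k : ℕ) : 0 ≤ coeffA r ℓ k := by
  have := lam_pos r ℓ
  unfold coeffA
  positivity

lemma coeffA_pos (r ℓ k : ℕ) : 0 < coeffA r ℓ k := by
  have := lam_pos r ℓ
  have : (0 : ℝ) < autCount (path r ℓ k) := by exact_mod_cast autCount_pos _
  unfold coeffA
  positivity

/-- A bound for the numbers `A_k`. -/
def boundA (r : ℕ) : ℝ := (2 * (2 * r).factorial : ℕ)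

lemma one_le_boundA (r : ℕ) : 1 ≤ boundA r := by
  unfold boundA
  exact_mod_cast Nat.mul_pos two_pos (Nat.factorial_pos _)

lemma autCount_path_le_boundA (hℓ : 0 < ℓ) (h : ℓ < r) {k : ℕ} (hk : 0 < k) :
    (autCount (path r ℓ k) : ℝ) ≤ boundA r * lam r ℓ ^ k := by
  rw [lam_eq_lamNat]
  unfold boundA
  exact_mod_cast autCount_path_le_lamNat hℓ h hk

lemma coeffA_le (hℓ : 0 < ℓ) (h : ℓ < r) {k : ℕ} (hk : 0 < k) : coeffA r ℓ k ≤ boundA r := by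
  unfold coeffA
  rw [div_le_iff₀ (pow_pos (lam_pos r ℓ) k)]
  exact autCount_path_le_boundA hℓ h hk

/-- The powers of `n` and of `λ` cancel. At `τ = 0` this is the summand of `pathSum` with `q` for
`c`; for `0 < τ < 1` it still decays geometrically, which leaves room for the error in the falling
factorial. -/
lemma autCount_mul_eq (h : ℓ < r) (hn : 0 < n) (hq : 0 < q) (hp : p = q * threshold r ℓ n)
    (τ : ℝ) (k : ℕ) :
    (autCount (path r ℓ k) : ℝ) * (p ^ k)⁻¹ * (Real.exp τ / n) ^ (k * (r - ℓ)) =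
      coeffA r ℓ k * (q ^ k)⁻¹ * Real.exp (-((1 - τ) * (k * ((r : ℝ) - ℓ)))) := by
  have hl := lam_pos r ℓ
  have hn' : (0 : ℝ) < n := by exact_mod_cast hn
  have e1 : Real.exp (-((1 - τ) * (k * ((r : ℝ) - ℓ)))) =
      (Real.exp ((r : ℝ) - ℓ) ^ k)⁻¹ * Real.exp τ ^ (k * (r - ℓ)) := by
    rw [← Real.exp_nat_mul, ← Real.exp_nat_mul, ← Real.exp_neg, ← Real.exp_add]
    congr 1
    push_cast
    rw [cast_s h]
    ring
  rw [e1, hp]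
  unfold coeffA threshold
  rw [mul_pow, div_pow, mul_pow, div_pow, ← pow_mul (n : ℝ), mul_comm (r - ℓ) k]
  have := Real.exp_pos ((r : ℝ) - ℓ)
  field_simp

lemma sum_exp_le {x : ℝ} (hx : 0 < x) (M : ℕ) :
    ∑ k ∈ Finset.Icc 1 M, Real.exp (-(x * k)) ≤ 1 / (1 - Real.exp (-x)) := by
  have hlt : Real.exp (-x) < 1 := Real.exp_lt_one_iff.2 (by linarith)
  have h1 : ∑ k ∈ Finset.Icc 1 M, Real.exp (-(x * k)) ≤
      ∑ k ∈ Finset.range (M + 1), Real.exp (-x) ^ k := by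
    rw [Finset.sum_congr rfl (g := fun k => Real.exp (-x) ^ k)]
    · apply Finset.sum_le_sum_of_subset_of_nonneg
      · intro k hk
        rw [Finset.mem_Icc] at hk
        exact Finset.mem_range.2 (by omega)
      · intro k _ _; positivity
    · intro k _
      rw [← Real.exp_nat_mul]; congr 1; ring
  refine h1.trans ?_
  rw [one_div]
  have h2 := (hasSum_geometric_of_lt_one (Real.exp_pos (-x)).le hlt)
  exact sum_le_hasSum _ (fun k _ => by positivity) h2

/-- The geometric sum governing the contribution of paths. -/
noncomputable def geom (x : ℝ) : ℝ := 1 / (1 - Real.exp (-x))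

lemma geom_pos {x : ℝ} (hx : 0 < x) : 0 < geom x := by
  have : Real.exp (-x) < 1 := Real.exp_lt_one_iff.2 (by linarith)
  unfold geom
  apply one_div_pos.2
  linarith

lemma one_le_cast_s (h : ℓ < r) : (1 : ℝ) ≤ (r : ℝ) - ℓ := by
  rw [← cast_s h]; exact_mod_cast (show 1 ≤ r - ℓ by omega)

lemma autCount_mul_le (hℓ : 0 < ℓ) (h : ℓ < r) (hn : 0 < n) (hq : 1 ≤ q)
    (hp : p = q * threshold r ℓ n) {τ : ℝ} (hτ : τ < 1) {k : ℕ} (hk : 0 < k) :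
    (autCount (path r ℓ k) : ℝ) * (p ^ k)⁻¹ * (Real.exp τ / n) ^ (k * (r - ℓ)) ≤
      boundA r * Real.exp (-((1 - τ) * k)) := by
  rw [autCount_mul_eq h hn (by linarith) hp]
  have h1 : (q ^ k)⁻¹ ≤ 1 := inv_le_one_of_one_le₀ (one_le_pow₀ hq)
  have h2 := coeffA_le hℓ h hk
  have h3 := coeffA_nonneg r ℓ k
  have h4 : Real.exp (-((1 - τ) * (k * ((r : ℝ) - ℓ)))) ≤ Real.exp (-((1 - τ) * k)) := by
    apply Real.exp_le_exp.2
    have h5 := one_le_cast_s h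
    have h6 : (k : ℝ) ≤ k * ((r : ℝ) - ℓ) := le_mul_of_one_le_right (by positivity) h5
    nlinarith
  have h5 : 0 ≤ (q ^ k)⁻¹ := by positivity
  calc _ ≤ coeffA r ℓ k * 1 * Real.exp (-((1 - τ) * k)) := by gcongr
    _ ≤ _ := by rw [mul_one]; gcongr

/-- The sum over the extensions of a cluster after a small gap is of order `1 / n`. -/
lemma sum_extension_le (hℓ : 0 < ℓ) (h : ℓ < r) (hn : 3 ≤ n) (hq : 1 ≤ q)
    (hp : p = q * threshold r ℓ n) {τ : ℝ} (hτ : τ < 1) (M : ℕ) :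
    ∑ k ∈ Finset.Icc 1 M, ∑ g ∈ smallGaps r ℓ,
      (4 * autCount (path r ℓ k) * (p ^ k)⁻¹ * (Real.exp τ / n) ^ ((k + g) * (r - ℓ))) ≤
    4 * boundA r * geom (1 - τ) * (r * Real.exp 1) / n := by
  have hn' : (0 : ℝ) < n := by exact_mod_cast (show 0 < n by omega)
  have hs : 0 < r - ℓ := by omega
  have hthr : 0 < threshold r ℓ n := by
    have := lam_pos r ℓ
    unfold threshold; positivity
  have hb : Real.exp τ / n ≤ Real.exp 1 / n := by
    gcongr
  have hb1 : Real.exp τ / n ≤ 1 := by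
    refine hb.trans ?_
    rw [div_le_one hn']
    have : (3 : ℝ) ≤ n := by exact_mod_cast hn
    have := Real.exp_one_lt_d9
    linarith
  have hA := one_le_boundA r
  have hinner : ∀ k ∈ Finset.Icc 1 M, ∑ g ∈ smallGaps r ℓ,
      (4 * autCount (path r ℓ k) * (p ^ k)⁻¹ * (Real.exp τ / n) ^ ((k + g) * (r - ℓ))) ≤
      Real.exp (-((1 - τ) * k)) * (4 * boundA r * (r * Real.exp 1) / n) := by
    intro k hk
    rw [Finset.mem_Icc] at hk
    have hterm : ∀ g ∈ smallGaps r ℓ,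
        (4 * autCount (path r ℓ k) * (p ^ k)⁻¹ * (Real.exp τ / n) ^ ((k + g) * (r - ℓ))) ≤
        4 * (boundA r * Real.exp (-((1 - τ) * k))) * (Real.exp 1 / n) := by
      intro g hg
      have hg1 := (Finset.mem_Icc.1 (Finset.mem_filter.1 hg).1).1
      have h1 := autCount_mul_le hℓ h (by omega) hq hp hτ (show 0 < k by omega)
      have h2 : (Real.exp τ / n) ^ (g * (r - ℓ)) ≤ Real.exp 1 / n := by
        calc (Real.exp τ / n) ^ (g * (r - ℓ)) ≤ (Real.exp τ / n) ^ 1 :=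
              pow_le_pow_of_le_one (by positivity) hb1 (Nat.mul_pos hg1 hs)
          _ ≤ _ := by rw [pow_one]; exact hb
      calc _ = 4 * (autCount (path r ℓ k) * (p ^ k)⁻¹ * (Real.exp τ / n) ^ (k * (r - ℓ))) *
            (Real.exp τ / n) ^ (g * (r - ℓ)) := by rw [add_mul, pow_add]; ring
        _ ≤ _ := by gcongr
    refine (Finset.sum_le_card_nsmul _ _ _ hterm).trans ?_
    have hcard : ((smallGaps r ℓ).card : ℝ) ≤ r := by
      have : (smallGaps r ℓ).card ≤ r := by
        refine (Finset.card_filter_le _ _).trans ?_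
        simp
      exact_mod_cast this
    rw [nsmul_eq_mul]
    calc _ ≤ (r : ℝ) * (4 * (boundA r * Real.exp (-((1 - τ) * k))) * (Real.exp 1 / n)) := by
          gcongr
      _ = _ := by ring
  refine (Finset.sum_le_sum hinner).trans ?_
  rw [← Finset.sum_mul]
  have h1 := sum_exp_le (show 0 < 1 - τ by linarith) M
  have h2 : (0 : ℝ) ≤ 4 * boundA r * (r * Real.exp 1) / n := by positivity
  calc _ ≤ (1 / (1 - Real.exp (-(1 - τ)))) * (4 * boundA r * (r * Real.exp 1) / n) := by gcongr
    _ = _ := by rw [geom]; ring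

end Terms

end RandomHypergraph

/-! ### The contribution of sparse sub-hypergraphs. -/

namespace RandomHypergraph

section Clusters

variable {r ℓ n m : ℕ} {p q c : ℝ}

lemma threshold_pos (r ℓ : ℕ) (hn : 0 < n) : 0 < threshold r ℓ n := by
  have := lam_pos r ℓ
  have : (0 : ℝ) < n := by exact_mod_cast hn
  unfold threshold
  positivity

lemma exp_div_le_one (hn : 3 ≤ n) {τ : ℝ} (hτ : τ < 1) : Real.exp τ / n ≤ 1 := by
  have : (3 : ℝ) ≤ n := by exact_mod_cast hn
  rw [div_le_one (by linarith)]
  have := Real.exp_one_lt_d9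
  have := Real.exp_le_exp.2 hτ.le
  linarith

/-- The prefactor of `pathSum`: `m` starts, `m` targets, and the `ℓ` vertices of a path beyond `s`
per edge. -/
lemma sq_mul_inv_pow_eq (P : Params r ℓ n m) :
    (m : ℝ) ^ 2 * ((n : ℝ) ^ ℓ)⁻¹ = (n : ℝ) ^ (2 - (ℓ : ℤ)) / ((r : ℝ) - ℓ) ^ 2 := by
  have hn : (0 : ℝ) < n := by exact_mod_cast P.n_pos
  have hs := one_le_cast_s P.lt
  have h1 : (n : ℝ) = m * ((r : ℝ) - ℓ) := by
    rw [← cast_s P.lt]; exact_mod_cast P.eq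
  rw [zpow_sub₀ hn.ne', zpow_natCast, eq_div_iff (by positivity)]
  have h2 : (m : ℝ) ^ 2 * ((r : ℝ) - ℓ) ^ 2 = (n : ℝ) ^ 2 := by rw [h1]; ring
  rw [show (n : ℝ) ^ (2 : ℤ) = (n : ℝ) ^ 2 by norm_cast, ← h2]
  field_simp

/-- The constant in the bound for the weight of the extensions of a cluster. -/
noncomputable def extConst (r : ℕ) (τ : ℝ) : ℝ :=
  4 * boundA r * geom (1 - τ) * (r * Real.exp 1)

lemma extConst_nonneg (r : ℕ) {τ : ℝ} (hτ : τ < 1) : 0 ≤ extConst r τ := by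
  have := one_le_boundA r
  have := geom_pos (show 0 < 1 - τ by linarith)
  unfold extConst
  positivity

/-- The total weight of all clusters is asymptotically that of the paths. -/
lemma sum_clusters_le_paths (P : Params r ℓ n m) (hn : 3 ≤ n) (hp : 0 < p) (hp1 : p ≤ 1)
    (hq : 1 ≤ q) (hpq : p = q * threshold r ℓ n) {τ : ℝ} (hτ : τ < 1)
    (hκ : 2 * extConst r τ ≤ n) :
    ∑ x ∈ Finset.range m, ∑ Q ∈ clusters r ℓ n m,
      weight r ℓ n p (Real.exp τ / n) (arcs n (r - ℓ) r x Q) ≤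
    (1 + 2 * (extConst r τ / n)) * (Real.exp (τ * ℓ) *
      ((n : ℝ) ^ (2 - (ℓ : ℤ)) / ((r : ℝ) - ℓ) ^ 2) * ∑ k ∈ Finset.Icc 1 m,
        coeffA r ℓ k * (q ^ k)⁻¹ * Real.exp (-((1 - τ) * (k * ((r : ℝ) - ℓ))))) := by
  have hn0 : (0 : ℝ) < n := by exact_mod_cast P.n_pos
  set κ := extConst r τ / n with hκdef
  have hκ0 : 0 ≤ κ := div_nonneg (extConst_nonneg r hτ) hn0.le
  have hκ1 : κ ≤ 1 / 2 := by
    rw [hκdef, div_le_div_iff₀ hn0 (by norm_num)]; linarith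
  set T := ∑ k ∈ Finset.Icc 1 m,
    coeffA r ℓ k * (q ^ k)⁻¹ * Real.exp (-((1 - τ) * (k * ((r : ℝ) - ℓ)))) with hT
  have hT0 : 0 ≤ T := Finset.sum_nonneg fun k _ =>
    mul_nonneg (mul_nonneg (coeffA_nonneg r ℓ k) (by positivity)) (Real.exp_pos _).le
  set b := Real.exp τ / n with hb
  have hb0 : 0 ≤ b := by positivity
  have hb1 : b ≤ 1 := exp_div_le_one hn hτ
  have hone : ∀ x ∈ Finset.range m, ∑ Q ∈ clusters r ℓ n m,
      weight r ℓ n p b (arcs n (r - ℓ) r x Q) ≤ (1 + 2 * κ) * (m * b ^ ℓ * T) := by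
    intro x _
    have h1 := sum_clusters_le P hp hp1 hb0 hb1 x
    set S := ∑ Q ∈ clusters r ℓ n m, weight r ℓ n p b (arcs n (r - ℓ) r x Q)
    have hS0 : 0 ≤ S := Finset.sum_nonneg fun Q _ => weight_nonneg hp hb0 _
    have h2 : ∑ k ∈ Finset.Icc 1 m,
        (m : ℝ) * autCount (path r ℓ k) * (p ^ k)⁻¹ * b ^ (ℓ + k * (r - ℓ)) = m * b ^ ℓ * T := by
      rw [hT, Finset.mul_sum]
      refine Finset.sum_congr rfl fun k _ => ?_
      rw [← autCount_mul_eq P.lt P.n_pos (by linarith) hpq τ k, pow_add]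
      ring
    have h3 := sum_extension_le P.pos P.lt hn hq hpq hτ m
    rw [h2] at h1
    -- The renewal inequality reads `S ≤ a + κ S` with `κ ≤ 1 / 2`, and `1 / (1 - κ) ≤ 1 + 2 κ` in
    -- that range.
    have h4 : S ≤ m * b ^ ℓ * T + S * κ := h1.trans (by gcongr; exact h3)
    have h5 : S * (1 - κ) ≤ m * b ^ ℓ * T := by linarith
    have h6 : 0 ≤ m * b ^ ℓ * T := by positivity
    have h7 : S ≤ (1 + 2 * κ) * (S * (1 - κ)) := by
      have : 0 ≤ S * (κ * (1 - 2 * κ)) :=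
        mul_nonneg hS0 (mul_nonneg hκ0 (by linarith))
      nlinarith
    exact h7.trans (by gcongr)
  refine (Finset.sum_le_card_nsmul _ _ _ hone).trans (le_of_eq ?_)
  rw [nsmul_eq_mul, Finset.card_range, ← sq_mul_inv_pow_eq P, hb, div_pow, ← Real.exp_nat_mul,
    mul_comm (ℓ : ℝ) τ]
  field_simp

/-- Serves to replace `q` by the given `c`. Only `c > q ≥ 1` needs an argument; then both inverses
are at most 1 and powers differ by at most `k` times the difference of the bases. -/
lemma inv_pow_le_add (hq : 1 ≤ q) (hc : 0 < c) (k : ℕ) :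
    (q ^ k)⁻¹ ≤ (c ^ k)⁻¹ + k * |q - c| := by
  rcases le_total c q with h | h
  · have h1 : (q ^ k)⁻¹ ≤ (c ^ k)⁻¹ := by gcongr
    have h2 : 0 ≤ k * |q - c| := by positivity
    linarith
  · have h1 : c⁻¹ ≤ q⁻¹ := by gcongr
    have hq1 : q⁻¹ ≤ 1 := inv_le_one_of_one_le₀ hq
    have hdiff : q⁻¹ - c⁻¹ ≤ |q - c| := by
      rw [inv_sub_inv (by linarith) hc.ne', abs_sub_comm, abs_of_nonneg (by linarith)]
      apply div_le_self (by linarith)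
      nlinarith
    rw [← inv_pow, ← inv_pow]
    have hc0 : 0 < c⁻¹ := inv_pos.2 hc
    induction k with
    | zero => simp
    | succ k ih =>
      rw [pow_succ, pow_succ]
      push_cast
      have h3 : q⁻¹ ^ k ≤ 1 := pow_le_one₀ (by positivity) hq1
      have h4 : c⁻¹ ^ k ≤ 1 := pow_le_one₀ hc0.le (h1.trans hq1)
      have h5 : 0 ≤ q⁻¹ ^ k := by positivity
      have h6 : 0 ≤ c⁻¹ ^ k := by positivity
      have h7 : 0 ≤ k * |q - c| := by positivity
      calc q⁻¹ ^ k * q⁻¹ = q⁻¹ ^ k * (q⁻¹ - c⁻¹) + q⁻¹ ^ k * c⁻¹ := by ring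
        _ ≤ 1 * |q - c| + (c⁻¹ ^ k + k * |q - c|) * c⁻¹ := by
            apply add_le_add
            · exact mul_le_mul h3 hdiff (by linarith) (by norm_num)
            · gcongr
        _ ≤ _ := by
            have : k * |q - c| * c⁻¹ ≤ k * |q - c| :=
              mul_le_of_le_one_right h7 (h1.trans hq1)
            linarith

lemma exp_neg_le_inv_sqrt (hn : 0 < n) {k : ℕ} (hk : Real.log n ≤ k) :
    Real.exp (-(k : ℝ)) ≤ Real.exp (-(1 / 2 * k)) * (1 / √(n : ℝ)) := by
  have hn0 : (0 : ℝ) < n := by exact_mod_cast hn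
  have h1 : 1 / √(n : ℝ) = Real.exp (-(1 / 2 * Real.log n)) := by
    rw [Real.exp_neg, one_div, Real.sqrt_eq_rpow, Real.rpow_def_of_pos hn0, mul_comm]
  rw [h1, ← Real.exp_add]
  apply Real.exp_le_exp.2
  linarith

lemma natCast_mul_exp_neg_le (k : ℕ) :
    (k : ℝ) * Real.exp (-(k : ℝ)) ≤ 2 * Real.exp (-(1 / 2 * k)) := by
  have h1 : Real.exp (-(k : ℝ)) = Real.exp (-(1 / 2 * k)) * Real.exp (-(1 / 2 * k)) := by
    rw [← Real.exp_add]; congr 1; ring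
  have h2 := Real.add_one_le_exp (1 / 2 * (k : ℝ))
  have h3 : Real.exp (1 / 2 * (k : ℝ)) * Real.exp (-(1 / 2 * k)) = 1 := by
    rw [← Real.exp_add]; simp
  have h4 := Real.exp_pos (-(1 / 2 * (k : ℝ)))
  rw [h1]
  nlinarith

/-- The truncated sum over the paths. -/
noncomputable def pathSeries (r ℓ n : ℕ) (c : ℝ) : ℝ :=
  ∑ k ∈ Finset.Icc 1 ⌊Real.log n⌋₊,
    coeffA r ℓ k * (c ^ k)⁻¹ * Real.exp (-((k : ℝ) * ((r : ℝ) - ℓ)))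

lemma pathSum_eq (r ℓ n : ℕ) (c : ℝ) :
    pathSum r ℓ n c = (n : ℝ) ^ (2 - (ℓ : ℤ)) / ((r : ℝ) - ℓ) ^ 2 * pathSeries r ℓ n c := by
  unfold pathSum pathSeries
  rw [← Finset.sum_div]
  ring

/-- For `k ≤ log n`, passing from `q` to `c` costs `k |q - c|`; for `k > log n`, half of the decay
`e ^ (-k)` is below `1 / √n`. The other half keeps both errors summable. The factor `1 - 0` is the
case `τ = 0` of the general term. -/
lemma sum_paths_le_pathSeries (hℓ : 0 < ℓ) (h : ℓ < r) (hn : 0 < n) (hq : 1 ≤ q) (hc : 0 < c)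
    (M : ℕ) :
    ∑ k ∈ Finset.Icc 1 M, coeffA r ℓ k * (q ^ k)⁻¹ *
      Real.exp (-((1 - 0) * (k * ((r : ℝ) - ℓ)))) ≤
    pathSeries r ℓ n c + 2 * boundA r * geom (1 / 2) * (|q - c| + 1 / √(n : ℝ)) := by
  set η := |q - c| + 1 / √(n : ℝ) with hη
  have hη0 : 0 ≤ η := by positivity
  have hA := one_le_boundA r
  set L := ⌊Real.log n⌋₊
  set F : ℕ → ℝ := fun k => coeffA r ℓ k * (c ^ k)⁻¹ * Real.exp (-((k : ℝ) * ((r : ℝ) - ℓ)))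
  have hF : ∀ k, 0 ≤ F k := fun k =>
    mul_nonneg (mul_nonneg (coeffA_nonneg r ℓ k) (by positivity)) (Real.exp_pos _).le
  have hterm : ∀ k ∈ Finset.Icc 1 M, coeffA r ℓ k * (q ^ k)⁻¹ *
      Real.exp (-((1 - 0) * (k * ((r : ℝ) - ℓ)))) ≤
      (if k ∈ Finset.Icc 1 L then F k else 0) +
        2 * boundA r * η * Real.exp (-(1 / 2 * (k : ℝ))) := by
    intro k hk
    rw [Finset.mem_Icc] at hk
    rw [sub_zero, one_mul]
    have hA0 := coeffA_nonneg r ℓ k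
    have hA1 := coeffA_le hℓ h (show 0 < k by omega)
    have hexp : Real.exp (-((k : ℝ) * ((r : ℝ) - ℓ))) ≤ Real.exp (-(k : ℝ)) := by
      apply Real.exp_le_exp.2
      have h5 := one_le_cast_s h
      have h6 : (k : ℝ) ≤ k * ((r : ℝ) - ℓ) := le_mul_of_one_le_right (by positivity) h5
      linarith
    split_ifs with hkL
    · have h1 := inv_pow_le_add hq hc k
      have h2 := natCast_mul_exp_neg_le k
      have h3 : |q - c| ≤ η := by
        have : 0 ≤ 1 / √(n : ℝ) := by positivity
        linarith
      calc _ ≤ coeffA r ℓ k * ((c ^ k)⁻¹ + k * |q - c|) *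
            Real.exp (-((k : ℝ) * ((r : ℝ) - ℓ))) := by gcongr
        _ = F k + coeffA r ℓ k * (k * Real.exp (-((k : ℝ) * ((r : ℝ) - ℓ)))) * |q - c| := by
            simp only [F]; ring
        _ ≤ F k + boundA r * (2 * Real.exp (-(1 / 2 * k))) * η := by
            have h5 := (mul_le_mul_of_nonneg_left hexp (Nat.cast_nonneg' k)).trans h2
            exact add_le_add_right (mul_le_mul (mul_le_mul hA1 h5 (by positivity)
              (by positivity)) h3 (abs_nonneg _) (by positivity)) _
        _ = _ := by ring
    · have hk' : Real.log n ≤ k := by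
        have : L < k := by
          by_contra hcon
          exact hkL (Finset.mem_Icc.2 ⟨hk.1, by omega⟩)
        exact (Nat.lt_of_floor_lt this).le
      have h1 := exp_neg_le_inv_sqrt hn hk'
      have h3 : 1 / √(n : ℝ) ≤ η := by
        have : 0 ≤ |q - c| := abs_nonneg _
        linarith
      have h4 : (q ^ k)⁻¹ ≤ 1 := inv_le_one_of_one_le₀ (one_le_pow₀ hq)
      calc _ ≤ boundA r * 1 * (Real.exp (-(1 / 2 * k)) * (1 / √(n : ℝ))) := by
            gcongr
            exact hexp.trans h1
        _ ≤ boundA r * 1 * (Real.exp (-(1 / 2 * k)) * η) := by gcongr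
        _ ≤ _ := by
            have : 0 ≤ boundA r * η * Real.exp (-(1 / 2 * (k : ℝ))) := by positivity
            linarith
  refine (Finset.sum_le_sum hterm).trans ?_
  rw [Finset.sum_add_distrib, ← Finset.mul_sum]
  apply add_le_add
  · rw [← Finset.sum_filter]
    apply Finset.sum_le_sum_of_subset_of_nonneg
    · intro k hk; exact (Finset.mem_filter.1 hk).2
    · intro k _ _; exact hF k
  · have h1 := sum_exp_le (show (0 : ℝ) < 1 / 2 by norm_num) M
    calc _ ≤ 2 * boundA r * η * (1 / (1 - Real.exp (-(1 / 2)))) := by gcongr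
      _ = _ := by rw [geom]; ring

lemma sum_paths_le (hℓ : 0 < ℓ) (h : ℓ < r) (hq : 1 ≤ q) {τ : ℝ} (hτ : τ < 1) (M : ℕ) :
    ∑ k ∈ Finset.Icc 1 M, coeffA r ℓ k * (q ^ k)⁻¹ *
      Real.exp (-((1 - τ) * (k * ((r : ℝ) - ℓ)))) ≤ boundA r * geom (1 - τ) := by
  have hA := one_le_boundA r
  have hterm : ∀ k ∈ Finset.Icc 1 M, coeffA r ℓ k * (q ^ k)⁻¹ *
      Real.exp (-((1 - τ) * (k * ((r : ℝ) - ℓ)))) ≤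
      boundA r * Real.exp (-((1 - τ) * (k : ℝ))) := by
    intro k hk
    rw [Finset.mem_Icc] at hk
    have hA0 := coeffA_nonneg r ℓ k
    have hA1 := coeffA_le hℓ h (show 0 < k by omega)
    have h4 : (q ^ k)⁻¹ ≤ 1 := inv_le_one_of_one_le₀ (one_le_pow₀ hq)
    have hexp : Real.exp (-((1 - τ) * (k * ((r : ℝ) - ℓ)))) ≤ Real.exp (-((1 - τ) * (k : ℝ))) := by
      apply Real.exp_le_exp.2
      have h5 := one_le_cast_s h
      have h6 : (k : ℝ) ≤ k * ((r : ℝ) - ℓ) := le_mul_of_one_le_right (by positivity) h5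
      nlinarith
    calc _ ≤ boundA r * 1 * Real.exp (-((1 - τ) * (k : ℝ))) := by gcongr
      _ = _ := by ring
  refine (Finset.sum_le_sum hterm).trans ?_
  rw [← Finset.mul_sum]
  have := sum_exp_le (show 0 < 1 - τ by linarith) M
  unfold geom
  gcongr

/-- A positive lower bound for the truncated sums over the paths. -/
noncomputable def seriesConst (r ℓ : ℕ) (B : ℝ) : ℝ :=
  coeffA r ℓ 1 * B⁻¹ * Real.exp (-((r : ℝ) - ℓ))

lemma seriesConst_pos (r ℓ : ℕ) {B : ℝ} (hB : 0 < B) : 0 < seriesConst r ℓ B := by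
  have := coeffA_pos r ℓ 1
  unfold seriesConst
  positivity

/-- The term `k = 1` alone, present since `log n ≥ 1`. This lower bound turns additive errors into
relative ones. -/
lemma seriesConst_le (hn : 3 ≤ n) (hc : 0 < c) {B : ℝ} (hB : c ≤ B) :
    seriesConst r ℓ B ≤ pathSeries r ℓ n c := by
  have hF : ∀ k, 0 ≤ coeffA r ℓ k * (c ^ k)⁻¹ * Real.exp (-((k : ℝ) * ((r : ℝ) - ℓ))) := fun k =>
    mul_nonneg (mul_nonneg (coeffA_nonneg r ℓ k) (by positivity)) (Real.exp_pos _).le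
  have hmem : 1 ∈ Finset.Icc 1 ⌊Real.log n⌋₊ := by
    rw [Finset.mem_Icc]
    refine ⟨le_rfl, Nat.le_floor ?_⟩
    have h3 : (3 : ℝ) ≤ n := by exact_mod_cast hn
    have := Real.exp_one_lt_d9
    rw [Nat.cast_one, Real.le_log_iff_exp_le (by linarith)]
    linarith
  have h1 := Finset.single_le_sum (fun k _ => hF k) hmem
  refine le_trans ?_ h1
  have := coeffA_nonneg r ℓ 1
  unfold seriesConst
  rw [pow_one, Nat.cast_one, one_mul]
  gcongr

lemma weight_exp (r ℓ n : ℕ) (p τ : ℝ) (H : Finset (Finset (Fin n))) :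
    weight r ℓ n p (Real.exp τ / n) H =
      weight r ℓ n p (Real.exp 0 / n) H * Real.exp (τ * (supp H).card) := by
  unfold weight
  rw [div_pow, div_pow, Real.exp_zero, one_pow, mul_comm τ, Real.exp_nat_mul]
  ring

lemma card_embMaps_div_le (hp : 0 < p) (hn : 0 < n) (H : Finset (Finset (Fin n))) :
    (p ^ H.card)⁻¹ * ((embMaps (cycle r ℓ n) H).card / (n.factorial : ℝ)) ≤
      weight r ℓ n p (Real.exp 0 / n) H * fallRatio n (supp H).card := by
  have h1 := card_embMaps_le (cycle r ℓ n) H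
  rw [Fintype.card_fin] at h1
  have h2 : ((embMaps (cycle r ℓ n) H).card : ℝ) ≤
      embCount (cycle r ℓ n) H * (n - (supp H).card).factorial := by exact_mod_cast h1
  have hn0 : (0 : ℝ) < n := by exact_mod_cast hn
  unfold weight fallRatio
  rw [Real.exp_zero]
  calc _ ≤ (p ^ H.card)⁻¹ * ((embCount (cycle r ℓ n) H * (n - (supp H).card).factorial : ℝ) /
        (n.factorial : ℝ)) := by gcongr
    _ = _ := by rw [div_pow, one_pow]; field_simp

lemma exp_sub_one_le (x : ℝ) : Real.exp x - 1 ≤ x * Real.exp x := by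
  have h1 := Real.add_one_le_exp (-x)
  have h2 : Real.exp (-x) * Real.exp x = 1 := by rw [← Real.exp_add]; simp
  have h3 := Real.exp_pos x
  nlinarith

lemma zpow_two_sub_le_one (hℓ : 2 ≤ ℓ) (hn : 0 < n) : (n : ℝ) ^ (2 - (ℓ : ℤ)) ≤ 1 :=
  zpow_le_one_of_nonpos₀ (by exact_mod_cast hn) (by omega)

-- The bound `fallRatio_le` splits each term in two. The `1` gives the weight with `b = 1 / n`; the
-- error `e ^ (τ v)` is absorbed as `b = e ^ τ / n`, at the price of a prefactor of order `1 / n`.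
open Classical in
lemma sum_sparse_le_exp (P : Params r ℓ n m) (hn16 : 16 ≤ n) (hp : 0 < p) (hp1 : p ≤ 1) {δ : ℝ}
    (hδ0 : 0 < δ) (hδ : δ ≤ 1 / 16) {τ : ℝ} (hτdef : τ = 1 - δ / 2) :
    ∑ H ∈ (cycle r ℓ n).powerset.filter (fun H => δ * n ≤ (n - (supp H).card : ℕ)),
      (p ^ H.card)⁻¹ * ((embMaps (cycle r ℓ n) H).card / (n.factorial : ℝ)) ≤
    Real.exp (∑ x ∈ Finset.range m, ∑ Q ∈ clusters r ℓ n m,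
      weight r ℓ n p (Real.exp 0 / n) (arcs n (r - ℓ) r x Q)) +
    8 / δ ^ 3 / n * (Real.exp (∑ x ∈ Finset.range m, ∑ Q ∈ clusters r ℓ n m,
      weight r ℓ n p (Real.exp τ / n) (arcs n (r - ℓ) r x Q)) - 1) := by
  have hn0 : (0 : ℝ) < n := by exact_mod_cast P.n_pos
  have hτ : τ < 1 := by linarith
  have hw0 := sum_weight_le_exp P hp hp1 (b := Real.exp 0 / n) (by positivity)
    (exp_div_le_one (by omega) (by norm_num))
  have hw1 := sum_weight_le_exp P hp hp1 (b := Real.exp τ / n) (by positivity)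
    (exp_div_le_one (by omega) hτ)
  set 𝓗 := (cycle r ℓ n).powerset.filter (fun H => H.Nonempty ∧ ∃ v, v ∉ supp H)
  have hsub : (cycle r ℓ n).powerset.filter (fun H => δ * n ≤ (n - (supp H).card : ℕ)) ⊆
      insert ∅ 𝓗 := by
    intro H hH
    rw [Finset.mem_filter] at hH
    rw [Finset.mem_insert]
    rcases Finset.eq_empty_or_nonempty H with h0 | h0
    · exact Or.inl h0
    · refine Or.inr (Finset.mem_filter.2 ⟨hH.1, h0, ?_⟩)
      by_contra! hcon
      have h1 : supp H = Finset.univ := Finset.eq_univ_of_forall hcon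
      have h2 := hH.2
      rw [h1, Finset.card_univ, Fintype.card_fin, Nat.sub_self, Nat.cast_zero] at h2
      have : 0 < δ * n := by positivity
      linarith
  have hterm : ∀ H ∈ (cycle r ℓ n).powerset.filter (fun H => δ * n ≤ (n - (supp H).card : ℕ)),
      (p ^ H.card)⁻¹ * ((embMaps (cycle r ℓ n) H).card / (n.factorial : ℝ)) ≤
      if H = ∅ then 1 else weight r ℓ n p (Real.exp 0 / n) H +
        8 / δ ^ 3 / n * weight r ℓ n p (Real.exp τ / n) H := by
    intro H hH
    split_ifs with h0
    · subst h0
      have h1 : (embMaps (cycle r ℓ n) ∅).card ≤ n.factorial := by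
        refine (Finset.card_le_univ _).trans ?_
        rw [Fintype.card_perm, Fintype.card_fin]
      rw [Finset.card_empty, pow_zero, inv_one, one_mul]
      exact div_le_one_of_le₀ (by exact_mod_cast h1) (by positivity)
    · have h1 := card_embMaps_div_le (r := r) (ℓ := ℓ) hp P.n_pos H
      have h2 := fallRatio_le hδ0 hδ hn16 (Finset.mem_filter.1 hH).2
      rw [← hτdef] at h2
      have h3 : 0 ≤ weight r ℓ n p (Real.exp 0 / n) H := weight_nonneg hp (by positivity) _
      refine h1.trans ((mul_le_mul_of_nonneg_left h2 h3).trans (le_of_eq ?_))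
      rw [weight_exp r ℓ n p τ H]
      ring
  have hnot : ∅ ∉ 𝓗 := fun hcon => by
    have := (Finset.mem_filter.1 hcon).2.1
    exact Finset.not_nonempty_empty this
  have hnn : ∀ H ∈ insert ∅ 𝓗, 0 ≤ if H = ∅ then (1 : ℝ) else
      weight r ℓ n p (Real.exp 0 / n) H + 8 / δ ^ 3 / n * weight r ℓ n p (Real.exp τ / n) H := by
    intro H _
    have h3 : 0 ≤ weight r ℓ n p (Real.exp 0 / n) H := weight_nonneg hp (by positivity) _
    have h4 : 0 ≤ weight r ℓ n p (Real.exp τ / n) H := weight_nonneg hp (by positivity) _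
    split_ifs
    · norm_num
    · positivity
  have hsum : ∑ H ∈ insert ∅ 𝓗, (if H = ∅ then (1 : ℝ) else
      weight r ℓ n p (Real.exp 0 / n) H + 8 / δ ^ 3 / n * weight r ℓ n p (Real.exp τ / n) H) =
      1 + (∑ H ∈ 𝓗, weight r ℓ n p (Real.exp 0 / n) H +
        8 / δ ^ 3 / n * ∑ H ∈ 𝓗, weight r ℓ n p (Real.exp τ / n) H) := by
    rw [Finset.sum_insert hnot, if_pos rfl, Finset.mul_sum, ← Finset.sum_add_distrib]
    congr 1
    refine Finset.sum_congr rfl fun H hH => ?_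
    rw [if_neg]
    rintro rfl
    exact hnot hH
  refine (Finset.sum_le_sum hterm).trans ((Finset.sum_le_sum_of_subset_of_nonneg hsub
    fun H hH _ => hnn H hH).trans ?_)
  rw [hsum]
  have h1 := mul_le_mul_of_nonneg_left hw1 (show (0 : ℝ) ≤ 8 / δ ^ 3 / n by positivity)
  linarith

/-- The main exponent, from `τ = 0`: the gaps and the replacement of `q` by `c` cost only a relative
error of order `η`. -/
lemma sum_clusters_le_pathSum (hℓ : 0 < ℓ) (P : Params r ℓ n m) (hn : 3 ≤ n) (hp : 0 < p)
    (hp1 : p ≤ 1) (hq : 1 ≤ q) (hpq : p = q * threshold r ℓ n) (hc : 0 < c) {c₀ : ℝ} (hc0 : 0 < c₀)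
    (hT : c₀ ≤ pathSeries r ℓ n c) (hκ : 2 * extConst r 0 ≤ n) {η : ℝ}
    (hη : η = |q - c| + 1 / √(n : ℝ)) (hηn : 1 / (n : ℝ) ≤ η) :
    ∑ x ∈ Finset.range m, ∑ Q ∈ clusters r ℓ n m,
      weight r ℓ n p (Real.exp 0 / n) (arcs n (r - ℓ) r x Q) ≤
    (1 + (2 * extConst r 0 + 2 * (2 * boundA r * geom (1 / 2) / c₀)) * η) * pathSum r ℓ n c := by
  have hS0 := sum_clusters_le_paths P hn hp hp1 hq hpq (show (0 : ℝ) < 1 by norm_num) hκ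
  have h1 := sum_paths_le_pathSeries hℓ P.lt P.n_pos hq hc m
  rw [show Real.exp (0 * (ℓ : ℝ)) = 1 by simp, one_mul] at hS0
  have hn0 : (0 : ℝ) < n := by exact_mod_cast P.n_pos
  have hκ0 := extConst_nonneg r (show (0 : ℝ) < 1 by norm_num)
  have hA := one_le_boundA r
  have hg := geom_pos (show (0 : ℝ) < 1 / 2 by norm_num)
  rw [pathSum_eq]
  rw [← hη] at h1
  have hs := one_le_cast_s P.lt
  have hD0 : 0 ≤ (n : ℝ) ^ (2 - (ℓ : ℤ)) / ((r : ℝ) - ℓ) ^ 2 := by positivity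
  have hη0 : 0 ≤ η := le_trans (by positivity) hηn
  have hG0 : 0 ≤ 2 * boundA r * geom (1 / 2) := by positivity
  generalize extConst r 0 = κ₀ at *
  generalize 2 * boundA r * geom (1 / 2) = G at *
  generalize (n : ℝ) ^ (2 - (ℓ : ℤ)) / ((r : ℝ) - ℓ) ^ 2 = D at *
  generalize pathSeries r ℓ n c = T at *
  have hT0 : 0 < T := hc0.trans_le hT
  have hκη : κ₀ / n ≤ κ₀ * η := by
    rw [div_eq_mul_one_div]; gcongr
  have hκn : κ₀ / n ≤ 1 / 2 := by
    rw [div_le_div_iff₀ hn0 (by norm_num)]; linarith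
  have h2 : T + G * η ≤ (1 + G / c₀ * η) * T := by
    have : G / c₀ * η * c₀ ≤ G / c₀ * η * T := by gcongr
    have h3 : G / c₀ * η * c₀ = G * η := by field_simp
    linarith
  have h0 : 0 ≤ κ₀ / n := by positivity
  have h3 : 0 ≤ G / c₀ * η := by positivity
  have h4 : (1 + 2 * (κ₀ / n)) * (D * (T + G * η)) ≤
      (1 + 2 * (κ₀ / n)) * (D * ((1 + G / c₀ * η) * T)) := by gcongr
  have h5 : (1 + 2 * (κ₀ / n)) * (1 + G / c₀ * η) ≤ 1 + (2 * κ₀ + 2 * (G / c₀)) * η := by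
    nlinarith
  refine hS0.trans (((mul_le_mul_of_nonneg_left (mul_le_mul_of_nonneg_left h1 hD0)
    (by positivity)).trans h4).trans ?_)
  calc _ = ((1 + 2 * (κ₀ / n)) * (1 + G / c₀ * η)) * (D * T) := by ring
    _ ≤ _ := mul_le_mul_of_nonneg_right h5 (by positivity)

/-- For the error term only the order of magnitude matters, as it carries a factor `1 / n`. -/
lemma sum_clusters_le_zpow (hℓ : 0 < ℓ) (P : Params r ℓ n m) (hn : 3 ≤ n) (hp : 0 < p)
    (hp1 : p ≤ 1) (hq : 1 ≤ q) (hpq : p = q * threshold r ℓ n) {τ : ℝ} (hτ : τ < 1)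
    (hκ : 2 * extConst r τ ≤ n) :
    ∑ x ∈ Finset.range m, ∑ Q ∈ clusters r ℓ n m,
      weight r ℓ n p (Real.exp τ / n) (arcs n (r - ℓ) r x Q) ≤
    2 * (Real.exp (τ * ℓ) * (boundA r * geom (1 - τ))) * (n : ℝ) ^ (2 - (ℓ : ℤ)) := by
  have hS1 := sum_clusters_le_paths P hn hp hp1 hq hpq hτ hκ
  have h1 := sum_paths_le hℓ P.lt hq hτ m
  have hn0 : (0 : ℝ) < n := by exact_mod_cast P.n_pos
  have hs := one_le_cast_s P.lt
  have hκ1 := extConst_nonneg r hτ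
  have hκn : 1 + 2 * (extConst r τ / n) ≤ 2 := by
    have : extConst r τ / n ≤ 1 / 2 := by
      rw [div_le_div_iff₀ hn0 (by norm_num)]; linarith
    linarith
  have hD0 : 0 ≤ (n : ℝ) ^ (2 - (ℓ : ℤ)) := by positivity
  have h2 : (n : ℝ) ^ (2 - (ℓ : ℤ)) / ((r : ℝ) - ℓ) ^ 2 ≤ (n : ℝ) ^ (2 - (ℓ : ℤ)) :=
    div_le_self hD0 (one_le_pow₀ hs)
  have hA := one_le_boundA r
  have hg := geom_pos (show 0 < 1 - τ by linarith)
  have h3 : Real.exp (τ * ℓ) * ((n : ℝ) ^ (2 - (ℓ : ℤ)) / ((r : ℝ) - ℓ) ^ 2) *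
      ∑ k ∈ Finset.Icc 1 m, coeffA r ℓ k * (q ^ k)⁻¹ *
        Real.exp (-((1 - τ) * (k * ((r : ℝ) - ℓ)))) ≤
      Real.exp (τ * ℓ) * (n : ℝ) ^ (2 - (ℓ : ℤ)) * (boundA r * geom (1 - τ)) :=
    mul_le_mul (mul_le_mul_of_nonneg_left h2 (Real.exp_pos _).le) h1
      (Finset.sum_nonneg fun k _ => mul_nonneg (mul_nonneg (coeffA_nonneg r ℓ k) (by positivity))
        (Real.exp_pos _).le) (by positivity)
  calc _ ≤ _ := hS1
    _ ≤ (1 + 2 * (extConst r τ / n)) *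
        (Real.exp (τ * ℓ) * (n : ℝ) ^ (2 - (ℓ : ℤ)) * (boundA r * geom (1 - τ))) :=
      mul_le_mul_of_nonneg_left h3 (by positivity)
    _ ≤ 2 * (Real.exp (τ * ℓ) * (n : ℝ) ^ (2 - (ℓ : ℤ)) * (boundA r * geom (1 - τ))) :=
      mul_le_mul_of_nonneg_right hκn (by positivity)
    _ = _ := by ring

/-- Combining the two exponential bounds for the sparse sub-hypergraphs. -/
lemma exp_add_le_exp {S0 S1 U D Φ E K₁ K₂ η N : ℝ} (h0 : S0 ≤ (1 + K₁ * η) * Φ) (h1 : S1 ≤ U * D)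
    (hS1 : 0 ≤ S1) (hU : 0 ≤ U) (hD1 : D ≤ 1) (hDΦ : D ≤ K₂ * Φ)
    (hK1 : 0 ≤ K₁) (hη : 0 ≤ η) (hΦ : 0 ≤ Φ) (hK2 : 0 ≤ K₂) (hE : 0 ≤ E) (hN : 0 ≤ N)
    (hNη : N ≤ η) :
    Real.exp S0 + E * N * (Real.exp S1 - 1) ≤
      Real.exp ((1 + (K₁ + E * (U * Real.exp U * K₂)) * η) * Φ) := by
  -- `S1` is bounded, so `exp S1 - 1` is linear in `D`, hence in `Φ`.
  have hE1 : Real.exp S1 - 1 ≤ U * Real.exp U * K₂ * Φ := by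
    have h2 : S1 ≤ U := h1.trans (mul_le_of_le_one_right hU hD1)
    calc Real.exp S1 - 1 ≤ S1 * Real.exp S1 := exp_sub_one_le S1
      _ ≤ (U * D) * Real.exp U :=
          mul_le_mul h1 (Real.exp_le_exp.2 h2) (Real.exp_pos _).le (hS1.trans h1)
      _ ≤ (U * (K₂ * Φ)) * Real.exp U := by gcongr
      _ = _ := by ring
  set W := E * (U * Real.exp U * K₂) with hW
  have hW0 : 0 ≤ W := by positivity
  have h3 : E * N * (Real.exp S1 - 1) ≤ W * η * Φ := by
    calc E * N * (Real.exp S1 - 1) ≤ E * N * (U * Real.exp U * K₂ * Φ) := by gcongr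
      _ = W * N * Φ := by rw [hW]; ring
      _ ≤ _ := by gcongr
  have h2 : 0 ≤ W * η * Φ := by positivity
  have hE0 : Real.exp S0 ≤ Real.exp ((1 + K₁ * η) * Φ) := Real.exp_le_exp.2 h0
  have h5 : 1 ≤ Real.exp ((1 + K₁ * η) * Φ) := Real.one_le_exp (by positivity)
  -- As the main exponential is at least 1, adding `y` to it is no more than multiplying it by `exp
  -- y`.
  have h4 := Real.add_one_le_exp (W * η * Φ)
  have h6 : Real.exp ((1 + (K₁ + W) * η) * Φ) =
      Real.exp ((1 + K₁ * η) * Φ) * Real.exp (W * η * Φ) := by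
    rw [← Real.exp_add]; congr 1; ring
  rw [h6]
  generalize Real.exp ((1 + K₁ * η) * Φ) = X at *
  nlinarith

open Classical in
/-- The contribution to the second moment of the sub-hypergraphs of the cycle that leave a
positive proportion of the vertices uncovered. -/
lemma exists_sum_sparse_le (hℓ : 2 ≤ ℓ) (h : ℓ < r) {δ : ℝ} (hδ0 : 0 < δ) (hδ : δ ≤ 1 / 16)
    {B : ℝ} (hB : 0 < B) :
    ∃ K : ℝ, 0 ≤ K ∧ ∃ N₀ : ℕ, ∀ (n m : ℕ) (p q c : ℝ), n = m * (r - ℓ) → N₀ ≤ n → 0 < p →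
      p ≤ 1 → 1 ≤ q → p = q * threshold r ℓ n → 0 < c → c ≤ B →
      ∑ H ∈ (cycle r ℓ n).powerset.filter (fun H => δ * n ≤ (n - (supp H).card : ℕ)),
        (p ^ H.card)⁻¹ * ((embMaps (cycle r ℓ n) H).card / (n.factorial : ℝ)) ≤
      Real.exp ((1 + K * (|q - c| + 1 / √(n : ℝ))) * pathSum r ℓ n c) := by
  have hs := one_le_cast_s h
  have hκ0 := extConst_nonneg r (show (0 : ℝ) < 1 by norm_num)
  have hτ : 1 - δ / 2 < 1 := by linarith
  have hκ1 := extConst_nonneg r hτ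
  have hc0 := seriesConst_pos r ℓ hB
  have hA := one_le_boundA r
  have hg := geom_pos (show (0 : ℝ) < 1 / 2 by norm_num)
  have hg' := geom_pos (show (0 : ℝ) < 1 - (1 - δ / 2) by linarith)
  obtain ⟨K₁, hK₁⟩ : ∃ K₁, K₁ =
    2 * extConst r 0 + 2 * (2 * boundA r * geom (1 / 2) / seriesConst r ℓ B) := ⟨_, rfl⟩
  obtain ⟨U, hU⟩ : ∃ U, U =
    2 * (Real.exp ((1 - δ / 2) * ℓ) * (boundA r * geom (1 - (1 - δ / 2)))) := ⟨_, rfl⟩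
  have hK₁0 : 0 ≤ K₁ := by rw [hK₁]; positivity
  have hU0 : 0 ≤ U := by rw [hU]; positivity
  refine ⟨K₁ + 8 / δ ^ 3 * (U * Real.exp U * (((r : ℝ) - ℓ) ^ 2 / seriesConst r ℓ B)),
    by positivity,
    max (max 16 (2 * r)) ⌈2 * extConst r 0 + 2 * extConst r (1 - δ / 2)⌉₊, ?_⟩
  intro n m p q c hnm hN hp hp1 hq hpq hc hcB
  have hn16 : 16 ≤ n := le_trans (le_trans (le_max_left _ _) (le_max_left _ _)) hN
  have hn2r : 2 * r ≤ n := le_trans (le_trans (le_max_right _ _) (le_max_left _ _)) hN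
  have hnκ : 2 * extConst r 0 + 2 * extConst r (1 - δ / 2) ≤ n := by
    have := le_trans (le_max_right _ _) hN
    exact (Nat.le_ceil _).trans (by exact_mod_cast this)
  have P : Params r ℓ n m := ⟨by omega, h, hnm, hn2r⟩
  have hn0 : (0 : ℝ) < n := by exact_mod_cast P.n_pos
  have hD0 : 0 < (n : ℝ) ^ (2 - (ℓ : ℤ)) := by positivity
  have hηn : 1 / (n : ℝ) ≤ |q - c| + 1 / √(n : ℝ) := by
    have h1 : 1 / (n : ℝ) ≤ 1 / √(n : ℝ) := by
      apply one_div_le_one_div_of_le (by positivity)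
      rw [Real.sqrt_le_left hn0.le]
      have : (1 : ℝ) ≤ n := by exact_mod_cast P.n_pos
      nlinarith
    have : 0 ≤ |q - c| := abs_nonneg _
    linarith
  have hT := seriesConst_le (r := r) (ℓ := ℓ) (show 3 ≤ n by omega) hc hcB
  have hT0 : 0 < pathSeries r ℓ n c := hc0.trans_le hT
  have hΦ0 : 0 ≤ pathSum r ℓ n c := by rw [pathSum_eq]; positivity
  have hDΦ : (n : ℝ) ^ (2 - (ℓ : ℤ)) ≤
      ((r : ℝ) - ℓ) ^ 2 / seriesConst r ℓ B * pathSum r ℓ n c := by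
    rw [pathSum_eq]
    have : ((r : ℝ) - ℓ) ^ 2 / seriesConst r ℓ B *
        ((n : ℝ) ^ (2 - (ℓ : ℤ)) / ((r : ℝ) - ℓ) ^ 2 * pathSeries r ℓ n c) =
      (n : ℝ) ^ (2 - (ℓ : ℤ)) * (pathSeries r ℓ n c / seriesConst r ℓ B) := by field_simp
    rw [this]
    exact le_mul_of_one_le_right hD0.le ((one_le_div hc0).2 hT)
  have hS0 := sum_clusters_le_pathSum (by omega) P (by omega) hp hp1 hq hpq hc hc0 hT
    (by linarith) rfl hηn
  have hS1 := sum_clusters_le_zpow (by omega) P (by omega) hp hp1 hq hpq hτ (by linarith)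
  rw [← hK₁] at hS0
  rw [← hU] at hS1
  have hS10 : 0 ≤ ∑ x ∈ Finset.range m, ∑ Q ∈ clusters r ℓ n m,
      weight r ℓ n p (Real.exp (1 - δ / 2) / n) (arcs n (r - ℓ) r x Q) :=
    Finset.sum_nonneg fun x _ => Finset.sum_nonneg fun Q _ => weight_nonneg hp (by positivity) _
  refine (sum_sparse_le_exp P hn16 hp hp1 hδ0 hδ rfl).trans ?_
  have hfin := exp_add_le_exp hS0 hS1 hS10 hU0 (zpow_two_sub_le_one hℓ P.n_pos) hDΦ hK₁0
    (by positivity) hΦ0 (by positivity) (show 0 ≤ 8 / δ ^ 3 by positivity)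
    (show 0 ≤ 1 / (n : ℝ) by positivity) hηn
  rwa [mul_one_div] at hfin

end Clusters

end RandomHypergraph

/-! ### Dense sub-hypergraphs: a renewal inequality over the gaps. -/

namespace RandomHypergraph

/-- The number of points below `ℓ + (e + 1) (r - ℓ)` that are not covered by the edges of a linear
path with indices in `F`. -/
def uncovered (r ℓ : ℕ) (F : Finset ℕ) (e : ℕ) : ℕ :=
  ((Finset.range ((e + 1) * (r - ℓ) + ℓ)).filter
    (fun u => ∀ t ∈ F, ¬ (t * (r - ℓ) ≤ u ∧ u < t * (r - ℓ) + r))).card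

lemma uncovered_range {r ℓ : ℕ} (h : ℓ < r) (e : ℕ) :
    uncovered r ℓ (Finset.range (e + 1)) e = 0 := by
  unfold uncovered
  rw [Finset.card_eq_zero, Finset.filter_eq_empty_iff]
  intro u hu hcon
  rw [Finset.mem_range] at hu
  obtain ⟨i, hi, hiu⟩ := exists_interval_of_lt h (Nat.succ_pos e)
    (show u < ℓ + (e + 1) * (r - ℓ) by omega)
  exact hcon i (Finset.mem_range.2 hi) hiu

/-- The edge `e` reaches `ℓ` positions past `(e + 1) s`, so `g` missing edges expose only `g s - ℓ`
vertices, and none if this is negative. -/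
lemma uncovered_union_le {r ℓ : ℕ} (h : ℓ < r) {F : Finset ℕ} {e g k : ℕ} (hk : 0 < k) :
    uncovered r ℓ (F ∪ Finset.Ico (e + 1 + g) (e + 1 + g + k)) (e + g + k) ≤
      uncovered r ℓ F e + (g * (r - ℓ) - ℓ) := by
  unfold uncovered
  have e2 : (e + 1 + g) * (r - ℓ) = (e + 1) * (r - ℓ) + g * (r - ℓ) := by ring
  have e3 : (e + g + k + 1) * (r - ℓ) = (e + 1 + g) * (r - ℓ) + k * (r - ℓ) := by ring
  rw [show g * (r - ℓ) - ℓ = (Finset.Ico ((e + 1) * (r - ℓ) + ℓ) ((e + 1 + g) * (r - ℓ))).card by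
    rw [Nat.card_Ico]; omega]
  refine (Finset.card_le_card ?_).trans (Finset.card_union_le _ _)
  intro u hu
  obtain ⟨hu, hcov⟩ := Finset.mem_filter.1 hu
  rw [Finset.mem_range] at hu
  rw [Finset.mem_union, Finset.mem_filter, Finset.mem_range, Finset.mem_Ico]
  by_cases h1 : u < (e + 1) * (r - ℓ) + ℓ
  · exact Or.inl ⟨h1, fun t ht => hcov t (Finset.mem_union_left _ ht)⟩
  · refine Or.inr ⟨by omega, ?_⟩
    by_contra hcon
    obtain ⟨i, hi, hiu⟩ := exists_interval_of_lt h hk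
      (show u - (e + 1 + g) * (r - ℓ) < ℓ + k * (r - ℓ) by omega)
    refine hcov (e + 1 + g + i)
      (Finset.mem_union_right _ (Finset.mem_Ico.2 ⟨by omega, by omega⟩)) ?_
    have e5 : (e + 1 + g + i) * (r - ℓ) = (e + 1 + g) * (r - ℓ) + i * (r - ℓ) := by ring
    omega

section Dense

variable {r ℓ n m : ℕ} {ρ z : ℝ}

lemma seg_add (n s r x k k' : ℕ) : seg n s r x (k + k') = seg n s r x k ∪ seg n s r (x + k) k' := by
  rw [seg_eq_arcs, seg_eq_arcs, ← arcs_Ico, ← arcs_union]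
  congr 1
  ext t
  simp only [Finset.mem_range, Finset.mem_union, Finset.mem_Ico]
  omega

/-- The constant in the bound for the embeddings of a run of any length. -/
noncomputable def runConst (r : ℕ) : ℝ := 4 * boundA r ^ 2

lemma runConst_pos (r : ℕ) : 0 < runConst r := by
  have := one_le_boundA r
  unfold runConst
  positivity

lemma boundA_le_runConst (r : ℕ) : boundA r ≤ runConst r := by
  have := one_le_boundA r
  unfold runConst
  nlinarith

/-- Long runs are handled by splitting them into two halves. -/
lemma embCount_union_seg_le_of_forall (P : Params r ℓ n m) {x k c : ℕ} (hk : 0 < k) (hkm : k ≤ m)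
    {H : Finset (Finset (Fin n))}
    (hc : ∀ k', 0 < k' → ℓ + k' * (r - ℓ) ≤ n →
      embCount (cycle r ℓ n) (H ∪ seg n (r - ℓ) r x k') ≤
        embCount (cycle r ℓ n) H * (c * autCount (path r ℓ k'))) :
    (embCount (cycle r ℓ n) (H ∪ seg n (r - ℓ) r x k) : ℝ) ≤
      embCount (cycle r ℓ n) H * (c * (runConst r * lam r ℓ ^ k)) := by
  have hl := lam_pos r ℓ
  have hA := one_le_boundA r
  have hlt := P.lt
  by_cases hfit : ℓ + k * (r - ℓ) ≤ n
  · have h1 : (embCount (cycle r ℓ n) (H ∪ seg n (r - ℓ) r x k) : ℝ) ≤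
        embCount (cycle r ℓ n) H * (c * autCount (path r ℓ k)) := by exact_mod_cast hc k hk hfit
    have h2 := autCount_path_le_boundA P.pos P.lt hk
    have h3 := boundA_le_runConst r
    refine h1.trans ?_
    gcongr
    exact h2.trans (by gcongr)
  · have hk2 : 2 ≤ k := by
      by_contra hcon
      have : k = 1 := by omega
      subst this
      have := P.two_le
      omega
    -- A run too long to be an embedded path is halved; as `2 r ≤ n`, each half fits. The second
    -- half is attached to the last edge of the first, at a cost of 4, whence `runConst r = 4 *
    -- boundA r ^ 2`.
    obtain ⟨k₁, k₂, rfl, h1, h2, h3, h4⟩ : ∃ k₁ k₂, k = k₁ + k₂ ∧ 0 < k₁ ∧ 0 < k₂ ∧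
        2 * k₁ ≤ m + 1 ∧ 2 * k₂ ≤ m + 1 := ⟨k / 2, k - k / 2, by omega, by omega, by omega,
          by omega, by omega⟩
    have hfit' : ∀ j, 2 * j ≤ m + 1 → ℓ + j * (r - ℓ) ≤ n := by
      intro j hj
      have h5 : 2 * j * (r - ℓ) ≤ (m + 1) * (r - ℓ) := Nat.mul_le_mul_right _ hj
      have h6 : (m + 1) * (r - ℓ) = n + (r - ℓ) := by rw [P.eq]; ring
      have h7 : 2 * j * (r - ℓ) = 2 * (j * (r - ℓ)) := by ring
      have := P.two_le
      omega
    have h5 := hc k₁ h1 (hfit' k₁ h3)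
    have hmem : arc n (r - ℓ) r (x + (k₁ - 1)) ∈ H ∪ seg n (r - ℓ) r x k₁ :=
      Finset.mem_union_right _ (Finset.mem_image.2 ⟨k₁ - 1, Finset.mem_range.2 (by omega), rfl⟩)
    have h6 := embCount_union_seg_le_four P h2 (hfit' k₂ h4)
      (show 1 * (r - ℓ) < r by have := P.pos; omega) hmem
    rw [show x + (k₁ - 1) + 1 = x + k₁ by omega, Finset.union_assoc, ← seg_add] at h6
    have h7 := autCount_path_le_boundA P.pos P.lt h1
    have h8 := autCount_path_le_boundA P.pos P.lt h2
    have h9 : (embCount (cycle r ℓ n) (H ∪ seg n (r - ℓ) r x (k₁ + k₂)) : ℝ) ≤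
        embCount (cycle r ℓ n) H * (c * autCount (path r ℓ k₁)) * (4 * autCount (path r ℓ k₂)) := by
      exact_mod_cast h6.trans (Nat.mul_le_mul_right _ h5)
    calc _ ≤ _ := h9
      _ ≤ embCount (cycle r ℓ n) H * (c * (boundA r * lam r ℓ ^ k₁)) *
          (4 * (boundA r * lam r ℓ ^ k₂)) := by gcongr
      _ = _ := by rw [runConst, pow_add]; ring

/-- The factor for the choice of the position of a run after a gap. -/
noncomputable def gapFactor (r ℓ m g : ℕ) : ℝ := if (g + 1) * (r - ℓ) < r then 4 else m

lemma gapFactor_nonneg (r ℓ m g : ℕ) : 0 ≤ gapFactor r ℓ m g := by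
  unfold gapFactor
  split_ifs <;> positivity

/-- The factor for the missing edges and the uncovered vertices of a gap. -/
noncomputable def gapWeight (r ℓ : ℕ) (ρ z : ℝ) (g : ℕ) : ℝ := ρ ^ g * z ^ (g * (r - ℓ) - ℓ)

lemma gapWeight_nonneg (hρ : 0 ≤ ρ) (hz : 0 ≤ z) (g : ℕ) : 0 ≤ gapWeight r ℓ ρ z g := by
  unfold gapWeight
  positivity

/-- The weight of a dense sub-hypergraph relative to that of the whole cycle. -/
noncomputable def denseWeight (r ℓ n m : ℕ) (ρ z : ℝ) (x : ℕ) (F : Finset ℕ) (e : ℕ) : ℝ :=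
  embCount (cycle r ℓ n) (arcs n (r - ℓ) r x F) * (lam r ℓ ^ F.card)⁻¹ *
    ρ ^ (e + 1 - F.card) * z ^ uncovered r ℓ F e / m

lemma denseWeight_nonneg (hρ : 0 ≤ ρ) (hz : 0 ≤ z) (x : ℕ) (F : Finset ℕ) (e : ℕ) :
    0 ≤ denseWeight r ℓ n m ρ z x F e := by
  have := lam_pos r ℓ
  unfold denseWeight
  positivity

lemma denseWeight_range_le (P : Params r ℓ n m) (x : ℕ) {e : ℕ} (he : e < m) :
    denseWeight r ℓ n m ρ z x (Finset.range (e + 1)) e ≤ runConst r := by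
  have hl := lam_pos r ℓ
  have hm : (0 : ℝ) < m := by exact_mod_cast P.m_pos
  have h1 := embCount_union_seg_le_of_forall P (x := x) (Nat.succ_pos e) he (H := ∅) (c := m)
    (fun k' hk' hfit => embCount_union_seg_le_m P hk' hfit ∅)
  rw [Finset.empty_union, seg_eq_arcs] at h1
  have h2 : (embCount (cycle r ℓ n) (∅ : Finset (Finset (Fin n))) : ℝ) ≤ 1 := by
    exact_mod_cast embCount_empty _
  have hA := runConst_pos r
  unfold denseWeight
  rw [uncovered_range P.lt, Finset.card_range, Nat.sub_self, pow_zero, pow_zero, mul_one, mul_one,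
    div_le_iff₀ hm, ← div_eq_mul_inv, div_le_iff₀ (by positivity)]
  calc _ ≤ _ := h1
    _ ≤ 1 * (m * (runConst r * lam r ℓ ^ (e + 1))) := by gcongr
    _ = _ := by ring

lemma denseWeight_union_le (P : Params r ℓ n m) (hρ : 0 ≤ ρ) (hz : 1 ≤ z) (x : ℕ) {e g k : ℕ}
    {F : Finset ℕ} (hk : 0 < k) (he : e ∈ F) (hF : F ⊆ Finset.range (e + 1)) (hm : e + g + k < m) :
    denseWeight r ℓ n m ρ z x (F ∪ Finset.Ico (e + 1 + g) (e + 1 + g + k)) (e + g + k) ≤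
      (runConst r * (gapFactor r ℓ m g * gapWeight r ℓ ρ z g)) *
        denseWeight r ℓ n m ρ z x F e := by
  have hl := lam_pos r ℓ
  have hA := runConst_pos r
  have h1 : (embCount (cycle r ℓ n) (arcs n (r - ℓ) r x F ∪
      seg n (r - ℓ) r (x + (e + 1 + g)) k) : ℝ) ≤
      embCount (cycle r ℓ n) (arcs n (r - ℓ) r x F) *
        (gapFactor r ℓ m g * (runConst r * lam r ℓ ^ k)) := by
    unfold gapFactor
    split_ifs with hg
    · have hmem : arc n (r - ℓ) r (x + e) ∈ arcs n (r - ℓ) r x F :=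
        Finset.mem_image.2 ⟨e, he, rfl⟩
      refine embCount_union_seg_le_of_forall P (c := 4) hk (by omega) fun k' hk' hfit => ?_
      have := embCount_union_seg_le_four P hk' hfit hg hmem
      rwa [show x + e + (g + 1) = x + (e + 1 + g) by omega] at this
    · exact embCount_union_seg_le_of_forall P hk (by omega)
        fun k' hk' hfit => embCount_union_seg_le_m P hk' hfit _
  have hdisj : Disjoint F (Finset.Ico (e + 1 + g) (e + 1 + g + k)) := by
    rw [Finset.disjoint_left]
    intro t ht ht'
    have := Finset.mem_range.1 (hF ht)
    rw [Finset.mem_Ico] at ht'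
    omega
  have hcard : (F ∪ Finset.Ico (e + 1 + g) (e + 1 + g + k)).card = F.card + k := by
    rw [Finset.card_union_of_disjoint hdisj, Nat.card_Ico]; omega
  have hFc : F.card ≤ e + 1 := by simpa using Finset.card_le_card hF
  have h2 := pow_le_pow_right₀ hz (uncovered_union_le P.lt (F := F) (e := e) (g := g) hk)
  have hz0 : 0 ≤ z := by linarith
  have hgf := gapFactor_nonneg r ℓ m g
  unfold denseWeight gapWeight
  rw [arcs_union, arcs_Ico, hcard,
    show e + g + k + 1 - (F.card + k) = (e + 1 - F.card) + g by omega]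
  calc _ ≤ embCount (cycle r ℓ n) (arcs n (r - ℓ) r x F) *
        (gapFactor r ℓ m g * (runConst r * lam r ℓ ^ k)) * (lam r ℓ ^ (F.card + k))⁻¹ *
        ρ ^ (e + 1 - F.card + g) * z ^ (uncovered r ℓ F e + (g * (r - ℓ) - ℓ)) / m := by gcongr
    _ = _ := by rw [pow_add, pow_add, pow_add]; field_simp

/-- The sets of indices with given last element. -/
def spans (e : ℕ) : Finset (Finset ℕ) :=
  (Finset.range (e + 1)).powerset.filter (fun F => 0 ∈ F ∧ e ∈ F)

lemma mem_spans {e : ℕ} {F : Finset ℕ} :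
    F ∈ spans e ↔ F ⊆ Finset.range (e + 1) ∧ 0 ∈ F ∧ e ∈ F := by
  unfold spans
  rw [Finset.mem_filter, Finset.mem_powerset]

/-- Either no edge is missing up to `e`, or the last run is preceded by a gap `g` after an edge `e'
< e`. The length of that run is determined by `e`, so only `g` and `e'` are summed over. -/
lemma sum_denseWeight_le_add (P : Params r ℓ n m) (hρ : 0 ≤ ρ) (hz : 1 ≤ z) (x : ℕ) {e : ℕ}
    (he : e < m) :
    ∑ F ∈ spans e, denseWeight r ℓ n m ρ z x F e ≤ runConst r +
      (∑ g ∈ Finset.Icc 1 m, runConst r * (gapFactor r ℓ m g * gapWeight r ℓ ρ z g)) *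
        ∑ e' ∈ Finset.range e, ∑ F ∈ spans e', denseWeight r ℓ n m ρ z x F e' := by
  have hz0 : 0 ≤ z := by linarith
  rw [← Finset.sum_filter_add_sum_filter_not (spans e) (fun F => F = Finset.range (e + 1))]
  apply add_le_add
  · rw [Finset.sum_filter, Finset.sum_ite_eq']
    split_ifs
    · exact denseWeight_range_le P x he
    · exact (runConst_pos r).le
  · rw [Finset.sum_sigma', Finset.sum_mul_sum, ← Finset.sum_product'
      (f := fun (g : ℕ) (a : (_ : ℕ) × Finset ℕ) =>
        runConst r * (gapFactor r ℓ m g * gapWeight r ℓ ρ z g) *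
          denseWeight r ℓ n m ρ z x a.2 a.1)]
    apply sum_le_sum_of_relation (fun F a => a.2.1 ∈ a.2.2 ∧ a.2.2 ⊆ Finset.range (a.2.1 + 1) ∧
      F = a.2.2 ∪ Finset.Ico (a.2.1 + 1 + a.1) (e + 1))
    · intro a _
      exact mul_nonneg (mul_nonneg (runConst_pos r).le (mul_nonneg (gapFactor_nonneg _ _ _ _)
        (gapWeight_nonneg hρ hz0 _))) (denseWeight_nonneg hρ hz0 _ _ _)
    · intro F hF
      obtain ⟨hF, hne⟩ := Finset.mem_filter.1 hF
      obtain ⟨hsub, h0, heF⟩ := mem_spans.1 hF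
      rcases exists_last_interval h0 with ⟨k, hk, rfl⟩ | ⟨Q, e', g, k, hg, hk, h0', he', hQ, rfl⟩
      · exfalso
        apply hne
        have h1 := Finset.mem_range.1 heF
        have h2 := Finset.mem_range.1 (hsub (Finset.mem_range.2 (show k - 1 < k by omega)))
        congr 1
        omega
      · have hlast : e = e' + g + k := by
          have h2 := Finset.mem_range.1 (hsub (Finset.mem_union_right _
            (Finset.mem_Ico.2 ⟨show e' + 1 + g ≤ e' + g + k by omega, by omega⟩)))
          rcases Finset.mem_union.1 heF with h3 | h3
          · have := Finset.mem_range.1 (hQ h3); omega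
          · rw [Finset.mem_Ico] at h3; omega
        subst hlast
        refine ⟨(g, ⟨e', Q⟩), ?_, denseWeight_union_le P hρ hz x hk he' hQ he, he', hQ, ?_⟩
        · rw [Finset.mem_product, Finset.mem_Icc, Finset.mem_sigma]
          exact ⟨⟨hg, by omega⟩, Finset.mem_range.2 (show e' < e' + g + k by omega),
            mem_spans.2 ⟨hQ, h0', he'⟩⟩
        · congr 2; omega
    · rintro F _ F' _ ⟨g, e', Q⟩ ⟨_, _, rfl⟩ ⟨_, _, rfl⟩
      rfl

/-- Discrete Grönwall: `a (1 + w) ^ e` solves the recursion with equality. -/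
lemma le_pow_of_renewal {t : ℕ → ℝ} {a w : ℝ} {M : ℕ} (hw : 0 ≤ w)
    (h : ∀ e < M, t e ≤ a + w * ∑ j ∈ Finset.range e, t j) :
    ∀ e < M, t e ≤ a * (1 + w) ^ e := by
  intro e
  induction e using Nat.strong_induction_on with
  | _ e ih =>
    intro he
    have h1 : ∑ j ∈ Finset.range e, t j ≤ ∑ j ∈ Finset.range e, a * (1 + w) ^ j :=
      Finset.sum_le_sum fun j hj => ih j (Finset.mem_range.1 hj) (by
        have := Finset.mem_range.1 hj; omega)
    have h2 : a + w * ∑ j ∈ Finset.range e, a * (1 + w) ^ j = a * (1 + w) ^ e := by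
      rw [← Finset.mul_sum]
      have := mul_geom_sum (1 + w) e
      rw [show 1 + w - 1 = w by ring] at this
      calc _ = a + a * (w * ∑ j ∈ Finset.range e, (1 + w) ^ j) := by ring
        _ = _ := by rw [this]; ring
    calc t e ≤ a + w * ∑ j ∈ Finset.range e, t j := h e he
      _ ≤ a + w * ∑ j ∈ Finset.range e, a * (1 + w) ^ j := by gcongr
      _ = _ := h2

/-- The total dense weight with given last edge is bounded. -/
lemma sum_denseWeight_le (P : Params r ℓ n m) (hρ : 0 ≤ ρ) (hz : 1 ≤ z) (x : ℕ) {e : ℕ}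
    (he : e < m) {w : ℝ} (hw : m * ∑ g ∈ Finset.Icc 1 m,
      runConst r * (gapFactor r ℓ m g * gapWeight r ℓ ρ z g) ≤ w) :
    ∑ F ∈ spans e, denseWeight r ℓ n m ρ z x F e ≤ runConst r * Real.exp w := by
  have hz0 : 0 ≤ z := by linarith
  have hA := runConst_pos r
  set W := ∑ g ∈ Finset.Icc 1 m, runConst r * (gapFactor r ℓ m g * gapWeight r ℓ ρ z g)
  have hW : 0 ≤ W := Finset.sum_nonneg fun g _ => mul_nonneg hA.le
    (mul_nonneg (gapFactor_nonneg _ _ _ _) (gapWeight_nonneg hρ hz0 _))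
  refine (le_pow_of_renewal hW (fun e he => sum_denseWeight_le_add P hρ hz x he) e he).trans ?_
  have h1 : (1 + W) ^ e ≤ Real.exp w := by
    calc (1 + W) ^ e ≤ Real.exp W ^ e := by
          gcongr
          linarith [Real.add_one_le_exp W]
      _ = Real.exp (e * W) := by rw [Real.exp_nat_mul]
      _ ≤ Real.exp w := by
          apply Real.exp_le_exp.2
          refine le_trans ?_ hw
          gcongr
  gcongr

end Dense

end RandomHypergraph

/-! ### The cost of a gap, and the contribution of dense sub-hypergraphs. -/

namespace RandomHypergraph

section Gaps

variable {r ℓ n m : ℕ}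

/-- The constant in the bound for the gap factors. -/
noncomputable def gapConst (ℓ : ℕ) (C δ : ℝ) : ℝ := 4 * (2 * C / δ) ^ ℓ

/-- A small gap exposes no vertex and has four positions, and one missing edge already gains `1 /
n`. A large gap gives `m C ^ g (δ n) ^ (g s - ℓ) / n ^ (g s)`, where `m / n ^ ℓ ≤ 1 / n` because `ℓ
≥ 2`; the powers of `C δ ≤ 1 / 2` make it summable over `g`. -/
lemma gapFactor_mul_gapWeight_le (hℓ : 2 ≤ ℓ) (P : Params r ℓ n m) {C δ : ℝ} (hC : 1 ≤ C)
    (hδ : 0 < δ) (hδ1 : δ ≤ 1) (hCδ : C * δ ≤ 1 / 2) {g : ℕ} (hg : 0 < g) :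
    gapFactor r ℓ m g * gapWeight r ℓ (C / (n : ℝ) ^ (r - ℓ)) (δ * n) g ≤
      gapConst ℓ C δ * (1 / 2) ^ g / n := by
  have hn : (1 : ℝ) ≤ n := by exact_mod_cast P.n_pos
  have hn0 : (0 : ℝ) < n := by linarith
  have hlt := P.lt
  have hs := P.s_pos
  have hgs : g * 1 ≤ g * (r - ℓ) := Nat.mul_le_mul_left _ hs
  have hmn : (m : ℝ) ≤ n := by
    have h1 : m * 1 ≤ m * (r - ℓ) := Nat.mul_le_mul_left _ hs
    have := P.eq
    exact_mod_cast (show m ≤ n by omega)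
  have hC0 : 0 < C := by linarith
  have e1 : (g + 1) * (r - ℓ) = g * (r - ℓ) + (r - ℓ) := by ring
  unfold gapFactor gapWeight gapConst
  split_ifs with h
  · have h1 : g * (r - ℓ) < ℓ := by omega
    rw [show g * (r - ℓ) - ℓ = 0 by omega, pow_zero, mul_one, div_pow, ← pow_mul]
    have h2 : (n : ℝ) ≤ (n : ℝ) ^ ((r - ℓ) * g) :=
      le_self_pow₀ hn (Nat.mul_pos hs hg).ne'
    have h3 : C ^ g ≤ (2 * C / δ) ^ ℓ * (1 / 2) ^ g := by
      have h4 : (2 * C / δ) ^ g ≤ (2 * C / δ) ^ ℓ := by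
        apply pow_le_pow_right₀ _ (by omega)
        rw [le_div_iff₀ hδ]
        nlinarith
      have h5 : 2 * C ≤ 2 * C / δ := by
        rw [le_div_iff₀ hδ]
        nlinarith
      calc C ^ g = (2 * C) ^ g * (1 / 2) ^ g := by rw [← mul_pow]; congr 1; ring
        _ ≤ (2 * C / δ) ^ g * (1 / 2) ^ g := by gcongr
        _ ≤ _ := by gcongr
    calc 4 * (C ^ g / (n : ℝ) ^ ((r - ℓ) * g)) ≤
        4 * ((2 * C / δ) ^ ℓ * (1 / 2) ^ g / n) := by gcongr
      _ = _ := by ring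
  · have h1 : ℓ ≤ g * (r - ℓ) := by omega
    have h2 : (C / (n : ℝ) ^ (r - ℓ)) ^ g * (δ * n) ^ (g * (r - ℓ) - ℓ) =
        C ^ g * δ ^ (g * (r - ℓ)) / (δ ^ ℓ * (n : ℝ) ^ ℓ) := by
      rw [div_pow, ← pow_mul, mul_comm (r - ℓ) g, ← mul_pow, eq_div_iff (by positivity),
        mul_assoc, ← pow_add, Nat.sub_add_cancel h1, mul_pow]
      field_simp
    have h3 : C ^ g * δ ^ (g * (r - ℓ)) ≤ (1 / 2) ^ g := by
      calc C ^ g * δ ^ (g * (r - ℓ)) ≤ C ^ g * δ ^ g := by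
            apply mul_le_mul_of_nonneg_left _ (by positivity)
            exact pow_le_pow_of_le_one hδ.le hδ1 (by omega)
        _ = (C * δ) ^ g := by rw [mul_pow]
        _ ≤ _ := by gcongr
    have h4 : (n : ℝ) ^ 2 ≤ (n : ℝ) ^ ℓ := pow_le_pow_right₀ hn hℓ
    have h5 : 1 / δ ^ ℓ ≤ 4 * (2 * C / δ) ^ ℓ := by
      have h6 : (1 / δ) ^ ℓ ≤ (2 * C / δ) ^ ℓ := by
        gcongr
        linarith
      rw [div_pow, one_pow] at h6
      have h7 : 0 ≤ (2 * C / δ) ^ ℓ := by positivity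
      linarith
    rw [h2]
    calc (m : ℝ) * (C ^ g * δ ^ (g * (r - ℓ)) / (δ ^ ℓ * (n : ℝ) ^ ℓ)) ≤
        n * ((1 / 2) ^ g / (δ ^ ℓ * (n : ℝ) ^ 2)) := by gcongr
      _ = 1 / δ ^ ℓ * (1 / 2) ^ g / n := by field_simp
      _ ≤ _ := by gcongr

/-- For the gap that closes the cycle: no run follows it, and the factor `m` is the choice of the
starting edge. -/
lemma mul_gapWeight_le (hℓ : 2 ≤ ℓ) (P : Params r ℓ n m) {C δ : ℝ} (hC : 1 ≤ C)
    (hδ : 0 < δ) (hδ1 : δ ≤ 1) (hCδ : C * δ ≤ 1 / 2) {g : ℕ} (hg : 0 < g) :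
    m * gapWeight r ℓ (C / (n : ℝ) ^ (r - ℓ)) (δ * n) g ≤ gapConst ℓ C δ * (1 / 2) ^ g := by
  have hn0 : (0 : ℝ) < n := by exact_mod_cast P.n_pos
  have h1 := gapFactor_mul_gapWeight_le hℓ P hC hδ hδ1 hCδ hg
  have hmn : (m : ℝ) ≤ n := by
    have h1 : m * 1 ≤ m * (r - ℓ) := Nat.mul_le_mul_left _ P.s_pos
    have := P.eq
    exact_mod_cast (show m ≤ n by omega)
  have hw : 0 ≤ gapWeight r ℓ (C / (n : ℝ) ^ (r - ℓ)) (δ * n) g :=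
    gapWeight_nonneg (by positivity) (by positivity) g
  have hgf : 1 ≤ gapFactor r ℓ m g := by
    unfold gapFactor
    split_ifs
    · norm_num
    · exact_mod_cast P.m_pos
  rw [le_div_iff₀ hn0] at h1
  refine le_trans ?_ h1
  calc _ ≤ (n : ℝ) * gapWeight r ℓ (C / (n : ℝ) ^ (r - ℓ)) (δ * n) g := by gcongr
    _ ≤ (n : ℝ) * (gapFactor r ℓ m g * gapWeight r ℓ (C / (n : ℝ) ^ (r - ℓ)) (δ * n) g) := by
        gcongr
        exact le_mul_of_one_le_left hw hgf
    _ = _ := by ring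

lemma sum_half_pow_le (M : ℕ) : ∑ g ∈ Finset.Icc 1 M, (1 / 2 : ℝ) ^ g ≤ 1 := by
  have h : ∑ g ∈ Finset.Icc 1 M, (1 / 2 : ℝ) ^ g = 1 - (1 / 2) ^ M := by
    induction M with
    | zero => simp
    | succ M ih =>
      rw [Finset.sum_Icc_succ_top (by omega), ih]
      ring
  rw [h]
  have : (0 : ℝ) ≤ (1 / 2) ^ M := by positivity
  linarith

lemma gapConst_nonneg {C δ : ℝ} (hC : 1 ≤ C) (hδ : 0 < δ) (ℓ : ℕ) : 0 ≤ gapConst ℓ C δ := by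
  unfold gapConst
  positivity

lemma sum_gaps_le (hℓ : 2 ≤ ℓ) (P : Params r ℓ n m) {C δ : ℝ} (hC : 1 ≤ C)
    (hδ : 0 < δ) (hδ1 : δ ≤ 1) (hCδ : C * δ ≤ 1 / 2) :
    m * ∑ g ∈ Finset.Icc 1 m, runConst r *
      (gapFactor r ℓ m g * gapWeight r ℓ (C / (n : ℝ) ^ (r - ℓ)) (δ * n) g) ≤
    runConst r * gapConst ℓ C δ := by
  have hn0 : (0 : ℝ) < n := by exact_mod_cast P.n_pos
  have hmn : (m : ℝ) ≤ n := by
    have h1 : m * 1 ≤ m * (r - ℓ) := Nat.mul_le_mul_left _ P.s_pos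
    have := P.eq
    exact_mod_cast (show m ≤ n by omega)
  have hA := runConst_pos r
  have hG := gapConst_nonneg hC hδ ℓ
  have h1 : ∑ g ∈ Finset.Icc 1 m, runConst r *
      (gapFactor r ℓ m g * gapWeight r ℓ (C / (n : ℝ) ^ (r - ℓ)) (δ * n) g) ≤
      ∑ g ∈ Finset.Icc 1 m, (runConst r * gapConst ℓ C δ / n) * (1 / 2) ^ g := by
    apply Finset.sum_le_sum
    intro g hg
    have := gapFactor_mul_gapWeight_le hℓ P hC hδ hδ1 hCδ (Finset.mem_Icc.1 hg).1
    calc _ ≤ runConst r * (gapConst ℓ C δ * (1 / 2) ^ g / n) := by gcongr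
      _ = _ := by ring
  rw [← Finset.mul_sum (s := Finset.Icc 1 m) (f := fun g => (1 / 2 : ℝ) ^ g)] at h1
  have h2 := mul_le_mul_of_nonneg_left (sum_half_pow_le m)
    (show 0 ≤ runConst r * gapConst ℓ C δ / n by positivity)
  calc _ ≤ (m : ℝ) * ((runConst r * gapConst ℓ C δ / n) * 1) :=
        mul_le_mul_of_nonneg_left (h1.trans h2) (Nat.cast_nonneg m)
    _ = (m / n : ℝ) * (runConst r * gapConst ℓ C δ) := by ring
    _ ≤ 1 * (runConst r * gapConst ℓ C δ) := by
        gcongr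
        exact (div_le_one hn0).2 hmn
    _ = _ := one_mul _

end Gaps

section Dense

variable {r ℓ n m : ℕ}

/-- Choosing an edge whose predecessor on the cycle is missing. -/
lemma exists_spans (P : Params r ℓ n m) {H : Finset (Finset (Fin n))} (hH : H ⊆ cycle r ℓ n)
    (hne : H.Nonempty) (hcyc : H ≠ cycle r ℓ n) :
    ∃ x < m, ∃ e, e + 1 < m ∧ ∃ F ∈ spans e, H = arcs n (r - ℓ) r x F := by
  have hs := P.s_pos
  have hm := P.m_pos
  -- `m - 1` steps forward lead to the predecessor. If every edge of `H` had its predecessor in `H`,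
  -- going backwards from one edge would reach them all.
  have hx : ∃ x < m, arc n (r - ℓ) r x ∈ H ∧ arc n (r - ℓ) r (x + (m - 1)) ∉ H := by
    by_contra! hcon
    apply hcyc
    apply Finset.Subset.antisymm hH
    intro a ha
    obtain ⟨y, hy, rfl⟩ := (mem_cycle_iff hs P.eq a).1 ha
    obtain ⟨a, ha⟩ := hne
    obtain ⟨i, hi, rfl⟩ := (mem_cycle_iff hs P.eq a).1 (hH ha)
    have hstep : ∀ t, arc n (r - ℓ) r (i + t * (m - 1)) ∈ H := by
      intro t
      induction t with
      | zero => simpa using ha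
      | succ t ih =>
        have h1 := hcon ((i + t * (m - 1)) % m) (Nat.mod_lt _ hm) (by rwa [arc_mod P.eq])
        rwa [arc_congr (j := i + (t + 1) * (m - 1)) P.eq] at h1
        have h2 : (i + t * (m - 1)) % m + (m - 1) ≡ i + t * (m - 1) + (m - 1) [MOD m] :=
          Nat.ModEq.add_right _ (Nat.mod_modEq _ _)
        rwa [show i + t * (m - 1) + (m - 1) = i + (t + 1) * (m - 1) by ring] at h2
    obtain ⟨t, _, ht⟩ := exists_add_modEq hm y i
    have h1 := hstep t
    rwa [arc_congr (j := y) P.eq] at h1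
    have h2 : y + t + t * (m - 1) ≡ i + t * (m - 1) [MOD m] := Nat.ModEq.add_right _ ht
    have h3 : y + t + t * (m - 1) = y + m * t := by
      obtain ⟨m', rfl⟩ : ∃ m', m = m' + 1 := ⟨m - 1, by omega⟩
      rw [Nat.add_sub_cancel]; ring
    have h4 : y + m * t ≡ y [MOD m] := by simp [Nat.ModEq]
    rw [h3] at h2
    exact h2.symm.trans h4
  obtain ⟨x, hxm, hxH, hxn⟩ := hx
  set F := (Finset.range m).filter (fun t => arc n (r - ℓ) r (x + t) ∈ H) with hF
  have h0 : 0 ∈ F := Finset.mem_filter.2 ⟨Finset.mem_range.2 hm, by simpa using hxH⟩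
  obtain ⟨e, he, hmax⟩ : ∃ e ∈ F, ∀ t ∈ F, t ≤ e :=
    ⟨F.max' ⟨0, h0⟩, F.max'_mem _, fun t ht => F.le_max' t ht⟩
  obtain ⟨hem, heH⟩ := Finset.mem_filter.1 he
  have hem := Finset.mem_range.1 hem
  refine ⟨x, hxm, e, ?_, F, mem_spans.2 ⟨fun t ht => Finset.mem_range.2 ?_, h0, he⟩, ?_⟩
  · by_contra hcon
    have : e = m - 1 := by omega
    exact hxn (this ▸ heH)
  · have := hmax t ht
    omega
  · ext a
    constructor
    · intro ha
      obtain ⟨i, hi, rfl⟩ := (mem_cycle_iff hs P.eq a).1 (hH ha)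
      obtain ⟨t, ht, h3⟩ := exists_add_modEq hm x i
      have h4 := arc_congr (n := n) (s := r - ℓ) (r := r) P.eq h3
      exact Finset.mem_image.2 ⟨t, Finset.mem_filter.2 ⟨Finset.mem_range.2 ht, h4 ▸ ha⟩, h4⟩
    · intro ha
      obtain ⟨t, ht, rfl⟩ := Finset.mem_image.1 ha
      exact (Finset.mem_filter.1 ht).2

/-- The last term is the gap of `m - 1 - e` edges that closes the cycle. Edges that wrap round can
only cover more. -/
lemma sub_card_supp_arcs_le (P : Params r ℓ n m) (x : ℕ) {e : ℕ} {F : Finset ℕ} (he : e < m)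
    (hF : F ⊆ Finset.range (e + 1)) :
    n - (supp (arcs n (r - ℓ) r x F)).card ≤
      uncovered r ℓ F e + ((m - 1 - e) * (r - ℓ) - ℓ) := by
  have := P.neZero
  have hlt := P.lt
  have e1 : (m - 1 - e) * (r - ℓ) + (e + 1) * (r - ℓ) = n := by
    rw [← add_mul, P.eq]; congr 1; omega
  have h1 : n - (supp (arcs n (r - ℓ) r x F)).card =
      (Finset.univ.filter (fun v => v ∉ supp (arcs n (r - ℓ) r x F))).card := by
    rw [Finset.filter_not, Finset.filter_mem_eq_inter, Finset.univ_inter,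
      Finset.card_univ_sdiff, Fintype.card_fin]
  rw [h1, card_filter_ofNat (x * (r - ℓ))]
  unfold uncovered
  rw [show (m - 1 - e) * (r - ℓ) - ℓ = (Finset.Ico ((e + 1) * (r - ℓ) + ℓ) n).card by
    rw [Nat.card_Ico]; omega]
  refine (Finset.card_le_card ?_).trans (Finset.card_union_le _ _)
  intro u hu
  obtain ⟨hu, hcov⟩ := Finset.mem_filter.1 hu
  rw [Finset.mem_range] at hu
  rw [Finset.mem_union, Finset.mem_filter, Finset.mem_range, Finset.mem_Ico]
  by_cases h2 : u < (e + 1) * (r - ℓ) + ℓ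
  · refine Or.inl ⟨h2, fun t ht hcon => hcov ?_⟩
    have h3 := Finset.mem_range.1 (hF ht)
    rw [mem_supp]
    refine ⟨_, Finset.mem_image_of_mem _ ht, ?_⟩
    have h4 := P.two_le
    rw [ofNat_mem_arc P.eq (by omega) (by omega) hu]
    exact Or.inl hcon
  · exact Or.inr ⟨by omega, hu⟩

lemma card_arcs (P : Params r ℓ n m) (x : ℕ) {F : Finset ℕ} (hF : F ⊆ Finset.range m) :
    (arcs n (r - ℓ) r x F).card = F.card := by
  apply Finset.card_image_of_injOn
  intro t ht t' ht' h
  have h2 := P.two_le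
  have hlt := P.lt
  have h1 := arc_injOn P.eq (by omega) (by omega) P.s_pos h
  exact Nat.ModEq.eq_of_lt_of_lt (Nat.ModEq.add_left_cancel' x h1)
    (Finset.mem_range.1 (hF ht)) (Finset.mem_range.1 (hF ht'))

/-- Relative to the whole cycle, each of the `m - |F|` missing edges gives a factor `p ≤ λ ρ`, and
the `y` uncovered vertices give `y! ≤ z ^ y`. The powers of `λ` combine to `m λ ^ m`, at most
`Aut(C_n)`. -/
lemma dense_term_le (P : Params r ℓ n m) {p ρ z : ℝ} (hp : 0 < p) (hpρ : p ≤ lam r ℓ * ρ)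
    (hz : 1 ≤ z) (x : ℕ) {e : ℕ} (he : e + 1 < m) {F : Finset ℕ}
    (hF : F ⊆ Finset.range (e + 1))
    (hy : ((n - (supp (arcs n (r - ℓ) r x F)).card : ℕ) : ℝ) ≤ z) :
    (p ^ (arcs n (r - ℓ) r x F).card)⁻¹ *
      ((embMaps (cycle r ℓ n) (arcs n (r - ℓ) r x F)).card / (n.factorial : ℝ)) ≤
    (autCount (cycle r ℓ n) * (p ^ m)⁻¹ / n.factorial) *
      (denseWeight r ℓ n m ρ z x F e * gapWeight r ℓ ρ z (m - 1 - e)) := by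
  have hl := lam_pos r ℓ
  have hm : (0 : ℝ) < m := by exact_mod_cast P.m_pos
  have hρ : 0 < ρ := by
    by_contra hcon
    have := mul_nonpos_of_nonneg_of_nonpos hl.le (not_lt.1 hcon)
    linarith
  have hz0 : 0 < z := by linarith
  have hFc : F.card ≤ e + 1 := by simpa using Finset.card_le_card hF
  rw [card_arcs P x (hF.trans (Finset.range_mono he.le))]
  set y := n - (supp (arcs n (r - ℓ) r x F)).card with hydef
  have h1 : ((embMaps (cycle r ℓ n) (arcs n (r - ℓ) r x F)).card : ℝ) ≤
      embCount (cycle r ℓ n) (arcs n (r - ℓ) r x F) * y.factorial := by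
    have := card_embMaps_le (cycle r ℓ n) (arcs n (r - ℓ) r x F)
    rw [Fintype.card_fin] at this
    exact_mod_cast this
  have h2 : (y.factorial : ℝ) ≤ z ^ (uncovered r ℓ F e + ((m - 1 - e) * (r - ℓ) - ℓ)) := by
    have h3 : (y.factorial : ℝ) ≤ (y : ℝ) ^ y := by exact_mod_cast Nat.factorial_le_pow y
    refine h3.trans ((pow_le_pow_left₀ (by positivity) hy y).trans ?_)
    exact pow_le_pow_right₀ hz (sub_card_supp_arcs_le P x (by omega) hF)
  have h4 : (m : ℝ) * lam r ℓ ^ m ≤ autCount (cycle r ℓ n) := by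
    rw [lam_eq_lamNat]
    exact_mod_cast mul_lamNat_pow_le_autCount_cycle P
  have h5 : p ^ (m - F.card) ≤ (lam r ℓ * ρ) ^ (m - F.card) := pow_le_pow_left₀ hp.le hpρ _
  have h6 : (p ^ F.card)⁻¹ = (p ^ m)⁻¹ * p ^ (m - F.card) := by
    have : p ^ m = p ^ F.card * p ^ (m - F.card) := by rw [← pow_add]; congr 1; omega
    rw [this]
    field_simp
  have h7 : (lam r ℓ * ρ) ^ (m - F.card) =
      lam r ℓ ^ m * (lam r ℓ ^ F.card)⁻¹ * (ρ ^ (e + 1 - F.card) * ρ ^ (m - 1 - e)) := by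
    have : lam r ℓ ^ m = lam r ℓ ^ F.card * lam r ℓ ^ (m - F.card) := by
      rw [← pow_add]; congr 1; omega
    rw [this, mul_pow, ← pow_add ρ, show e + 1 - F.card + (m - 1 - e) = m - F.card by omega]
    field_simp
  have hdw : 0 ≤ denseWeight r ℓ n m ρ z x F e * gapWeight r ℓ ρ z (m - 1 - e) :=
    mul_nonneg (denseWeight_nonneg hρ.le hz0.le _ _ _) (gapWeight_nonneg hρ.le hz0.le _)
  rw [h6]
  calc (p ^ m)⁻¹ * p ^ (m - F.card) *
        ((embMaps (cycle r ℓ n) (arcs n (r - ℓ) r x F)).card / (n.factorial : ℝ)) ≤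
      (p ^ m)⁻¹ * (lam r ℓ * ρ) ^ (m - F.card) *
        ((embCount (cycle r ℓ n) (arcs n (r - ℓ) r x F) *
          z ^ (uncovered r ℓ F e + ((m - 1 - e) * (r - ℓ) - ℓ))) / (n.factorial : ℝ)) := by
        gcongr
        exact h1.trans (by gcongr)
    _ = (m * lam r ℓ ^ m * (p ^ m)⁻¹ / n.factorial) *
      (denseWeight r ℓ n m ρ z x F e * gapWeight r ℓ ρ z (m - 1 - e)) := by
        rw [h7, pow_add]
        unfold denseWeight gapWeight
        field_simp
    _ ≤ _ := by gcongr

lemma card_embMaps_cycle_le (C : Finset (Finset (Fin n))) :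
    (embMaps C C).card ≤ autCount C := by
  apply Finset.card_le_card
  intro σ hσ
  rw [mem_embMaps] at hσ
  refine Finset.mem_filter.2 ⟨Finset.mem_univ _, ?_⟩
  apply Finset.eq_of_subset_of_card_le
  · intro a ha
    obtain ⟨b, hb, rfl⟩ := Finset.mem_image.1 ha
    exact hσ b hb
  · unfold relabel
    rw [Finset.card_image_of_injective _ (Finset.map_injective _)]

open Classical in
/-- The contribution to the second moment of the sub-hypergraphs that cover almost all vertices. -/
lemma sum_dense_le (hℓ : 2 ≤ ℓ) (P : Params r ℓ n m) {p C δ : ℝ} (hp : 0 < p)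
    (hpC : p ≤ lam r ℓ * (C / (n : ℝ) ^ (r - ℓ))) (hC : 1 ≤ C) (hδ : 0 < δ) (hδ1 : δ ≤ 1)
    (hCδ : C * δ ≤ 1 / 2) (hδn : 1 ≤ δ * n) :
    ∑ H ∈ (cycle r ℓ n).powerset.filter (fun H => ¬ δ * n ≤ (n - (supp H).card : ℕ)),
      (p ^ H.card)⁻¹ * ((embMaps (cycle r ℓ n) H).card / (n.factorial : ℝ)) ≤
    (autCount (cycle r ℓ n) * (p ^ m)⁻¹ / n.factorial) *
      (1 + gapConst ℓ C δ * (runConst r * Real.exp (runConst r * gapConst ℓ C δ))) := by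
  have hlt := P.lt
  have h2r := P.two_le
  have hn0 : (0 : ℝ) < n := by exact_mod_cast P.n_pos
  set ρ := C / (n : ℝ) ^ (r - ℓ) with hρdef
  have hρ : 0 ≤ ρ := by positivity
  set z := δ * n with hzdef
  have hz0 : 0 ≤ z := by linarith
  set X := (autCount (cycle r ℓ n) * (p ^ m)⁻¹ / n.factorial : ℝ) with hX
  have hX0 : 0 ≤ X := by positivity
  have hA := runConst_pos r
  -- The whole cycle gives the summand `1`; every other dense `H` has a closing gap.
  rw [← Finset.sum_filter_add_sum_filter_not _ (fun H => H = cycle r ℓ n), mul_add, mul_one]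
  apply add_le_add
  · have h1 : ∀ H ∈ ((cycle r ℓ n).powerset.filter
        (fun H => ¬ z ≤ (n - (supp H).card : ℕ))).filter (fun H => H = cycle r ℓ n),
        H = cycle r ℓ n := fun H hH => (Finset.mem_filter.1 hH).2
    have h2 : (p ^ (cycle r ℓ n).card)⁻¹ *
        ((embMaps (cycle r ℓ n) (cycle r ℓ n)).card / (n.factorial : ℝ)) ≤ X := by
      rw [card_cycle P.lt P.eq (by omega)]
      have : ((embMaps (cycle r ℓ n) (cycle r ℓ n)).card : ℝ) ≤ autCount (cycle r ℓ n) := by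
        exact_mod_cast card_embMaps_cycle_le _
      calc _ ≤ (p ^ m)⁻¹ * (autCount (cycle r ℓ n) / (n.factorial : ℝ)) := by gcongr
        _ = X := by rw [hX]; ring
    have h3 := Finset.sum_le_sum_of_subset_of_nonneg
      (f := fun H => (p ^ H.card)⁻¹ * ((embMaps (cycle r ℓ n) H).card / (n.factorial : ℝ)))
      (fun H hH => Finset.mem_singleton.2 (h1 H hH)) (fun H _ _ => by positivity)
    rw [Finset.sum_singleton] at h3
    exact h3.trans h2
  · have hbound : ∑ x ∈ Finset.range m, ∑ e ∈ Finset.range (m - 1), ∑ F ∈ spans e,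
        X * (denseWeight r ℓ n m ρ z x F e * gapWeight r ℓ ρ z (m - 1 - e)) ≤
        X * (gapConst ℓ C δ * (runConst r * Real.exp (runConst r * gapConst ℓ C δ))) := by
      have hx : ∀ x ∈ Finset.range m, ∑ e ∈ Finset.range (m - 1), ∑ F ∈ spans e,
          X * (denseWeight r ℓ n m ρ z x F e * gapWeight r ℓ ρ z (m - 1 - e)) ≤
          X * ((runConst r * Real.exp (runConst r * gapConst ℓ C δ)) *
            ∑ g ∈ Finset.Icc 1 (m - 1), gapWeight r ℓ ρ z g) := by
        intro x _
        have h1 : ∀ e ∈ Finset.range (m - 1), ∑ F ∈ spans e,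
            X * (denseWeight r ℓ n m ρ z x F e * gapWeight r ℓ ρ z (m - 1 - e)) ≤
            X * ((runConst r * Real.exp (runConst r * gapConst ℓ C δ)) *
              gapWeight r ℓ ρ z (m - 1 - e)) := by
          intro e he
          have he := Finset.mem_range.1 he
          rw [← Finset.mul_sum, ← Finset.sum_mul]
          have h2 := sum_denseWeight_le P hρ hδn x (show e < m by omega)
            (sum_gaps_le hℓ P hC hδ hδ1 hCδ)
          have h3 : 0 ≤ gapWeight r ℓ ρ z (m - 1 - e) := gapWeight_nonneg hρ hz0 _
          gcongr
        refine (Finset.sum_le_sum h1).trans (le_of_eq ?_)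
        rw [← Finset.mul_sum, ← Finset.mul_sum]
        congr 2
        apply Finset.sum_bij' (fun e _ => m - 1 - e) (fun g _ => m - 1 - g)
        · intro e he
          rw [Finset.mem_range] at he
          exact Finset.mem_Icc.2 ⟨by omega, by omega⟩
        · intro g hg
          rw [Finset.mem_Icc] at hg
          exact Finset.mem_range.2 (by omega)
        · intro e he
          rw [Finset.mem_range] at he
          omega
        · intro g hg
          rw [Finset.mem_Icc] at hg
          omega
        · intro e _; rfl
      refine (Finset.sum_le_card_nsmul _ _ _ hx).trans ?_
      rw [nsmul_eq_mul, Finset.card_range]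
      -- The sum over the `m` starts is paid for by the closing gap.
      have h4 : m * ∑ g ∈ Finset.Icc 1 (m - 1), gapWeight r ℓ ρ z g ≤ gapConst ℓ C δ := by
        rw [Finset.mul_sum]
        have h5 : ∀ g ∈ Finset.Icc 1 (m - 1), m * gapWeight r ℓ ρ z g ≤
            gapConst ℓ C δ * (1 / 2) ^ g := fun g hg =>
          mul_gapWeight_le hℓ P hC hδ hδ1 hCδ (Finset.mem_Icc.1 hg).1
        refine (Finset.sum_le_sum h5).trans ?_
        rw [← Finset.mul_sum]
        exact mul_le_of_le_one_right (gapConst_nonneg hC hδ ℓ) (sum_half_pow_le _)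
      calc _ = X * ((m * ∑ g ∈ Finset.Icc 1 (m - 1), gapWeight r ℓ ρ z g) *
            (runConst r * Real.exp (runConst r * gapConst ℓ C δ))) := by ring
        _ ≤ _ := by gcongr
    refine le_trans ?_ hbound
    simp_rw [Finset.sum_sigma']
    apply sum_le_sum_of_relation (fun H a => H = arcs n (r - ℓ) r a.1 a.2.2)
    · intro a _
      exact mul_nonneg hX0 (mul_nonneg (denseWeight_nonneg hρ hz0 _ _ _)
        (gapWeight_nonneg hρ hz0 _))
    · intro H hH
      obtain ⟨hH, hne⟩ := Finset.mem_filter.1 hH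
      obtain ⟨hH, hy⟩ := Finset.mem_filter.1 hH
      have hsub := Finset.mem_powerset.1 hH
      have hnon : H.Nonempty := by
        rw [Finset.nonempty_iff_ne_empty]
        rintro rfl
        apply hy
        have : supp (∅ : Finset (Finset (Fin n))) = ∅ := by
          ext v; simp [mem_supp]
        rw [this, Finset.card_empty, Nat.sub_zero, hzdef]
        exact mul_le_of_le_one_left hn0.le hδ1
      obtain ⟨x, hx, e, he, F, hF, rfl⟩ := exists_spans P hsub hnon hne
      refine ⟨⟨x, e, F⟩, ?_, ?_, rfl⟩
      · simp only [Finset.mem_sigma, Finset.mem_range]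
        exact ⟨hx, by omega, hF⟩
      · exact dense_term_le P hp hpC hδn x he (mem_spans.1 hF).1 (not_le.1 hy).le
    · rintro H _ H' _ a rfl rfl
      rfl

end Dense

end RandomHypergraph

/-! ### The first moment threshold, and the combination of the bounds. -/

namespace RandomHypergraph

open Filter

section Final

variable {r ℓ n m : ℕ}

/-- A form of Stirling's upper bound. -/
lemma factorial_mul_exp_le (hn : 0 < n) :
    (n.factorial : ℝ) * Real.exp n ≤ Real.exp 1 * n * (n : ℝ) ^ n := by
  induction n with
  | zero => omega
  | succ n ih =>
    rcases Nat.eq_zero_or_pos n with rfl | h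
    · simp
    have ih := ih h
    have hn0 : (0 : ℝ) < n := by exact_mod_cast h
    have h1 : Real.exp 1 * (n : ℝ) ^ (n + 1) ≤ ((n : ℝ) + 1) ^ (n + 1) := by
      have h2 : (n : ℝ) / (n + 1) ≤ Real.exp (-(1 / ((n : ℝ) + 1))) := by
        have := Real.add_one_le_exp (-(1 / ((n : ℝ) + 1)))
        refine le_trans (le_of_eq ?_) this
        field_simp
        ring
      have h3 := pow_le_pow_left₀ (by positivity) h2 (n + 1)
      rw [← Real.exp_nat_mul, div_pow, div_le_iff₀ (by positivity)] at h3
      have h4 : ((n + 1 : ℕ) : ℝ) * (-(1 / ((n : ℝ) + 1))) = -1 := by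
        push_cast
        field_simp
      rw [h4] at h3
      calc Real.exp 1 * (n : ℝ) ^ (n + 1)
          ≤ Real.exp 1 * (Real.exp (-1) * ((n : ℝ) + 1) ^ (n + 1)) := by gcongr
        _ = _ := by rw [← mul_assoc, ← Real.exp_add]; simp
    rw [Nat.factorial_succ]
    push_cast
    rw [Real.exp_add]
    calc ((n : ℝ) + 1) * n.factorial * (Real.exp n * Real.exp 1)
        = ((n : ℝ) + 1) * Real.exp 1 * (n.factorial * Real.exp n) := by ring
      _ ≤ ((n : ℝ) + 1) * Real.exp 1 * (Real.exp 1 * n * (n : ℝ) ^ n) := by gcongr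
      _ = ((n : ℝ) + 1) * Real.exp 1 * (Real.exp 1 * (n : ℝ) ^ (n + 1)) := by ring
      _ ≤ ((n : ℝ) + 1) * Real.exp 1 * ((n : ℝ) + 1) ^ (n + 1) := by gcongr
      _ = _ := by ring

/-- The first moment is bounded below the threshold. -/
lemma firstMoment_le (P : Params r ℓ n m) (p : unitInterval) :
    firstMoment r ℓ n p ≤
      ((p : ℝ) / threshold r ℓ n) ^ m * (Real.exp 1 * ((r : ℝ) - ℓ)) := by
  have h2 := P.two_le
  have hlt := P.lt
  have hl := lam_pos r ℓ
  have hm : (0 : ℝ) < m := by exact_mod_cast P.m_pos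
  have hn : (0 : ℝ) < n := by exact_mod_cast P.n_pos
  have hp : (0 : ℝ) ≤ p := p.2.1
  have hs := one_le_cast_s P.lt
  have hnm : (n : ℝ) = m * ((r : ℝ) - ℓ) := by
    rw [← cast_s P.lt]; exact_mod_cast P.eq
  rw [firstMoment_eq P.lt P.eq (by omega)]
  have h1 : (m : ℝ) * lam r ℓ ^ m * (copies r ℓ n).card ≤ n.factorial := by
    rw [lam_eq_lamNat, ← autCount_mul_card_copies r ℓ n]
    exact_mod_cast Nat.mul_le_mul_right _ (mul_lamNat_pow_le_autCount_cycle P)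
  have h3 := factorial_mul_exp_le P.n_pos
  have h4 : ((p : ℝ) / threshold r ℓ n) ^ m =
      (p : ℝ) ^ m * (n : ℝ) ^ n / (lam r ℓ ^ m * Real.exp n) := by
    unfold threshold
    have e1 : (n : ℝ) ^ n = ((n : ℝ) ^ (r - ℓ)) ^ m := by
      rw [← pow_mul, mul_comm (r - ℓ) m, ← P.eq]
    have e2 : Real.exp n = Real.exp ((r : ℝ) - ℓ) ^ m := by
      rw [← Real.exp_nat_mul, hnm]
    rw [e1, e2, div_pow, div_pow, mul_pow]
    have := Real.exp_pos ((r : ℝ) - ℓ)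
    field_simp
  have h5 : m * lam r ℓ ^ m * Real.exp n * (copies r ℓ n).card ≤
      Real.exp 1 * n * (n : ℝ) ^ n := by
    refine le_trans ?_ h3
    calc _ = (m * lam r ℓ ^ m * (copies r ℓ n).card) * Real.exp n := by ring
      _ ≤ _ := by gcongr
  rw [h4, div_mul_eq_mul_div, le_div_iff₀ (by positivity)]
  have h6 : (copies r ℓ n).card * (lam r ℓ ^ m * Real.exp n) ≤
      Real.exp 1 * ((r : ℝ) - ℓ) * (n : ℝ) ^ n := by
    -- The factor `n = m s` in Stirling's bound is cancelled, up to `s`, by the `m` rotations of the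
    -- cycle.
    have h7 : (m : ℝ) * ((copies r ℓ n).card * (lam r ℓ ^ m * Real.exp n)) ≤
        m * (Real.exp 1 * ((r : ℝ) - ℓ) * (n : ℝ) ^ n) := by
      calc _ = m * lam r ℓ ^ m * Real.exp n * (copies r ℓ n).card := by ring
        _ ≤ Real.exp 1 * n * (n : ℝ) ^ n := h5
        _ = Real.exp 1 * (m * ((r : ℝ) - ℓ)) * (n : ℝ) ^ n := by rw [← hnm]
        _ = _ := by ring
    exact le_of_mul_le_mul_left h7 hm
  calc _ = (p : ℝ) ^ m * ((copies r ℓ n).card * (lam r ℓ ^ m * Real.exp n)) := by ring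
    _ ≤ (p : ℝ) ^ m * (Real.exp 1 * ((r : ℝ) - ℓ) * (n : ℝ) ^ n) := by gcongr
    _ = _ := by ring

lemma eventually_toInfty (r ℓ N : ℕ) :
    ∀ᶠ n in toInfty r ℓ, N ≤ n ∧ ∃ m, n = m * (r - ℓ) := by
  unfold toInfty
  rw [eventually_inf_principal]
  filter_upwards [eventually_ge_atTop N] with n hn hd
  obtain ⟨m, rfl⟩ := hd
  exact ⟨hn, m, mul_comm _ _⟩

/-- Above the threshold the second moment is bounded by the contributions of sparse and of dense
sub-hypergraphs. -/
lemma exists_momentRatio_le (hℓ : 2 ≤ ℓ) (h : ℓ < r) {B : ℝ} (hB : 0 < B) :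
    ∃ K₁ K₂ : ℝ, 0 ≤ K₁ ∧ 0 ≤ K₂ ∧ ∃ N₀ : ℕ, ∀ (n m : ℕ) (p : unitInterval) (c : ℝ),
      n = m * (r - ℓ) → N₀ ≤ n → 0 < (p : ℝ) → 1 ≤ (p : ℝ) / threshold r ℓ n →
      (p : ℝ) / threshold r ℓ n ≤ B + 1 → 0 < c → c ≤ B →
      momentRatio r ℓ n p ≤
        Real.exp ((1 + K₁ * (|(p : ℝ) / threshold r ℓ n - c| + 1 / √(n : ℝ))) *
          pathSum r ℓ n c) + K₂ / firstMoment r ℓ n p := by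
  classical
  -- Chosen so that `p / threshold ≤ B + 1` becomes `p ≤ λ C / n ^ s`.
  set C := (B + 1) * Real.exp ((r : ℝ) - ℓ) with hCdef
  have hs := one_le_cast_s h
  have hC : 1 ≤ C := by
    have : 1 ≤ Real.exp ((r : ℝ) - ℓ) := Real.one_le_exp (by linarith)
    rw [hCdef]
    nlinarith
  -- `1 / 16` is what the falling factorial bound needs; `1 / (2 C)` makes the gap weights decay
  -- like `2 ^ (-g)`.
  set δ := min (1 / 16) (1 / (2 * C)) with hδdef
  have hδ0 : 0 < δ := lt_min (by norm_num) (by positivity)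
  have hδ16 : δ ≤ 1 / 16 := min_le_left _ _
  have hCδ : C * δ ≤ 1 / 2 := by
    calc C * δ ≤ C * (1 / (2 * C)) := by gcongr; exact min_le_right _ _
      _ = 1 / 2 := by field_simp
  obtain ⟨K₁, hK₁, N₁, hN₁⟩ := exists_sum_sparse_le hℓ h hδ0 hδ16 hB
  have hG := gapConst_nonneg hC hδ0 ℓ
  have hA := runConst_pos r
  refine ⟨K₁, 1 + gapConst ℓ C δ * (runConst r * Real.exp (runConst r * gapConst ℓ C δ)), hK₁,
    by positivity, max N₁ (max (2 * r) ⌈1 / δ⌉₊), ?_⟩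
  intro n m p c hnm hN hp hq hqB hc hcB
  have hN1 : N₁ ≤ n := (le_max_left _ _).trans hN
  have hN2 : 2 * r ≤ n := ((le_max_left _ _).trans (le_max_right _ _)).trans hN
  have hN3 : 1 / δ ≤ n := by
    have := ((le_max_right _ _).trans (le_max_right _ _)).trans hN
    exact (Nat.le_ceil _).trans (by exact_mod_cast this)
  have P : Params r ℓ n m := ⟨by omega, h, hnm, hN2⟩
  have hn0 : (0 : ℝ) < n := by exact_mod_cast P.n_pos
  have hthr := threshold_pos r ℓ P.n_pos
  have hl := lam_pos r ℓ
  have hpq : (p : ℝ) = (p : ℝ) / threshold r ℓ n * threshold r ℓ n := by field_simp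
  have hsparse := hN₁ n m p _ c hnm hN1 hp p.2.2 hq hpq hc hcB
  have hδn : 1 ≤ δ * n := by
    rw [div_le_iff₀ hδ0] at hN3
    linarith
  have hpC : (p : ℝ) ≤ lam r ℓ * (C / (n : ℝ) ^ (r - ℓ)) := by
    rw [div_le_iff₀ hthr] at hqB
    refine hqB.trans (le_of_eq ?_)
    unfold threshold
    rw [hCdef]
    ring
  have hdense := sum_dense_le hℓ P hp hpC hC hδ0 (by linarith) hCδ hδn
  have hX : (autCount (cycle r ℓ n) * ((p : ℝ) ^ m)⁻¹ / n.factorial : ℝ) =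
      1 / firstMoment r ℓ n p := by
    rw [firstMoment_eq h hnm (by omega), ← autCount_mul_card_copies r ℓ n]
    have h1 : (autCount (cycle r ℓ n) : ℝ) ≠ 0 := by exact_mod_cast (autCount_pos _).ne'
    have h2 : ((copies r ℓ n).card : ℝ) ≠ 0 := by exact_mod_cast (copies_card_pos r ℓ n).ne'
    push_cast
    field_simp
  rw [hX] at hdense
  refine (momentRatio_le_sum_powerset h hnm (by omega) hp).trans ?_
  rw [← Finset.sum_filter_add_sum_filter_not _
    (fun H => δ * n ≤ ((n - (supp H).card : ℕ) : ℝ))]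
  refine (add_le_add hsparse hdense).trans (le_of_eq ?_)
  ring

lemma pathSum_nonneg (h : ℓ < r) (n : ℕ) {c : ℝ} (hc : 0 < c) : 0 ≤ pathSum r ℓ n c := by
  rw [pathSum_eq]
  have hs := one_le_cast_s h
  have : 0 ≤ pathSeries r ℓ n c := Finset.sum_nonneg fun k _ =>
    mul_nonneg (mul_nonneg (coeffA_nonneg r ℓ k) (by positivity)) (Real.exp_pos _).le
  positivity

/-- `c ^ (-k) ≤ e ^ (k log 2)` is beaten by `e ^ (-k)` since `log 2 < 1`. Eventually `c ≥ 1 / 2`,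
because `q ≥ 1` and `q - c → 0`. -/
lemma pathSeries_le (hℓ : 0 < ℓ) (h : ℓ < r) (n : ℕ) {c : ℝ} (hc : 1 / 2 ≤ c) :
    pathSeries r ℓ n c ≤ boundA r * geom (1 - Real.log 2) := by
  have hA := one_le_boundA r
  have hlog : Real.log 2 < 1 := by
    have := Real.log_two_lt_d9
    linarith
  have hterm : ∀ k ∈ Finset.Icc 1 ⌊Real.log n⌋₊,
      coeffA r ℓ k * (c ^ k)⁻¹ * Real.exp (-((k : ℝ) * ((r : ℝ) - ℓ))) ≤
      boundA r * Real.exp (-((1 - Real.log 2) * (k : ℝ))) := by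
    intro k hk
    rw [Finset.mem_Icc] at hk
    have hA0 := coeffA_nonneg r ℓ k
    have hA1 := coeffA_le hℓ h (show 0 < k by omega)
    have hexp : Real.exp (-((k : ℝ) * ((r : ℝ) - ℓ))) ≤ Real.exp (-(k : ℝ)) := by
      apply Real.exp_le_exp.2
      have h5 := one_le_cast_s h
      have h6 : (k : ℝ) ≤ k * ((r : ℝ) - ℓ) := le_mul_of_one_le_right (by positivity) h5
      linarith
    have h2 : (c ^ k)⁻¹ ≤ Real.exp (k * Real.log 2) := by
      rw [Real.exp_nat_mul, Real.exp_log two_pos, ← inv_pow]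
      have hc0 : 0 < c := by linarith
      apply pow_le_pow_left₀ (by positivity)
      rw [inv_le_comm₀ hc0 two_pos]
      linarith
    calc _ ≤ boundA r * Real.exp (k * Real.log 2) * Real.exp (-(k : ℝ)) := by gcongr
      _ = _ := by rw [mul_assoc, ← Real.exp_add]; congr 2; ring
  unfold pathSeries
  refine (Finset.sum_le_sum hterm).trans ?_
  rw [← Finset.mul_sum]
  have := sum_exp_le (show 0 < 1 - Real.log 2 by linarith) ⌊Real.log n⌋₊
  unfold geom
  gcongr

variable {p : ℕ → unitInterval} {c : ℕ → ℝ} {B : ℝ}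

/-- If the first moment tends to infinity, the edge probability is eventually above the
threshold. -/
lemma eventually_one_le_div (hℓ : 2 ≤ ℓ) (h : ℓ < r)
    (hZ : Tendsto (fun n => firstMoment r ℓ n (p n)) (toInfty r ℓ) atTop) :
    ∀ᶠ n in toInfty r ℓ, 0 < (p n : ℝ) ∧ 1 ≤ (p n : ℝ) / threshold r ℓ n := by
  filter_upwards [eventually_toInfty r ℓ (2 * r),
    hZ.eventually_gt_atTop (Real.exp 1 * ((r : ℝ) - ℓ))] with n hn hlarge
  obtain ⟨hN, m, hnm⟩ := hn
  have P : Params r ℓ n m := ⟨by omega, h, hnm, hN⟩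
  have hs := one_le_cast_s h
  have hthr := threshold_pos r ℓ P.n_pos
  have h1 : 1 ≤ (p n : ℝ) / threshold r ℓ n := by
    by_contra! hcon
    have h2 := firstMoment_le P (p n)
    have hp : (0 : ℝ) ≤ p n := (p n).2.1
    have h3 : ((p n : ℝ) / threshold r ℓ n) ^ m ≤ 1 := pow_le_one₀ (by positivity) hcon.le
    have h4 := mul_le_mul_of_nonneg_right h3
      (show 0 ≤ Real.exp 1 * ((r : ℝ) - ℓ) by positivity)
    linarith
  refine ⟨?_, h1⟩
  by_contra! hcon
  have : (p n : ℝ) / threshold r ℓ n ≤ 0 := div_nonpos_of_nonpos_of_nonneg hcon hthr.le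
  linarith

lemma tendsto_error (K : ℝ)
    (hp : Tendsto (fun n => (p n : ℝ) / threshold r ℓ n - c n) (toInfty r ℓ) (nhds 0)) :
    Tendsto (fun n : ℕ => K * (|(p n : ℝ) / threshold r ℓ n - c n| + 1 / √(n : ℝ)))
      (toInfty r ℓ) (nhds 0) := by
  have h1 : Tendsto (fun n : ℕ => 1 / √(n : ℝ)) (toInfty r ℓ) (nhds 0) := by
    have h2 : Tendsto (fun n : ℕ => √(n : ℝ)) atTop atTop :=
      Real.tendsto_sqrt_atTop.comp tendsto_natCast_atTop_atTop
    have h3 := (h2.inv_tendsto_atTop).mono_left (show toInfty r ℓ ≤ atTop from inf_le_left)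
    refine h3.congr fun n => ?_
    simp
  have h2 := ((hp.abs.congr fun n => rfl).add h1).const_mul K
  simpa using h2

lemma eventually_momentRatio_le (hℓ : 2 ≤ ℓ) (h : ℓ < r) (hc : ∀ n, 0 < c n ∧ c n ≤ B)
    (hp : Tendsto (fun n => (p n : ℝ) / threshold r ℓ n - c n) (toInfty r ℓ) (nhds 0))
    (hZ : Tendsto (fun n => firstMoment r ℓ n (p n)) (toInfty r ℓ) atTop) :
    ∃ K₁ K₂ : ℝ, 0 ≤ K₁ ∧ 0 ≤ K₂ ∧ ∀ᶠ n in toInfty r ℓ, momentRatio r ℓ n (p n) ≤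
      Real.exp ((1 + K₁ * (|(p n : ℝ) / threshold r ℓ n - c n| + 1 / √(n : ℝ))) *
        pathSum r ℓ n (c n)) + K₂ / firstMoment r ℓ n (p n) := by
  have hB : 0 < B := (hc 0).1.trans_le (hc 0).2
  obtain ⟨K₁, K₂, hK₁, hK₂, N₀, hN₀⟩ := exists_momentRatio_le hℓ h hB
  refine ⟨K₁, K₂, hK₁, hK₂, ?_⟩
  filter_upwards [eventually_toInfty r ℓ N₀, eventually_one_le_div hℓ h hZ,
    hp.eventually (gt_mem_nhds one_pos)] with n hn hq hq1
  obtain ⟨hN, m, hnm⟩ := hn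
  exact hN₀ n m (p n) (c n) hnm hN hq.1 hq.2 (by linarith [(hc n).2]) (hc n).1 (hc n).2

lemma tendsto_pathSum (hℓ : 3 ≤ ℓ) (h : ℓ < r) (hc : ∀ n, 0 < c n ∧ c n ≤ B)
    (hp : Tendsto (fun n => (p n : ℝ) / threshold r ℓ n - c n) (toInfty r ℓ) (nhds 0))
    (hZ : Tendsto (fun n => firstMoment r ℓ n (p n)) (toInfty r ℓ) atTop) :
    Tendsto (fun n => pathSum r ℓ n (c n)) (toInfty r ℓ) (nhds 0) := by
  have hs := one_le_cast_s h
  have hA := one_le_boundA r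
  have hlog : Real.log 2 < 1 := by
    have := Real.log_two_lt_d9
    linarith
  have hg := geom_pos (show 0 < 1 - Real.log 2 by linarith)
  have h1 : Tendsto (fun n : ℕ => (boundA r * geom (1 - Real.log 2)) * (1 / (n : ℝ)))
      (toInfty r ℓ) (nhds 0) := by
    have := (tendsto_one_div_atTop_nhds_zero_nat (𝕜 := ℝ)).mono_left
      (show toInfty r ℓ ≤ atTop from inf_le_left)
    simpa using this.const_mul (boundA r * geom (1 - Real.log 2))
  refine tendsto_of_tendsto_of_tendsto_of_le_of_le' tendsto_const_nhds h1
    (Eventually.of_forall fun n => pathSum_nonneg h n (hc n).1) ?_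
  filter_upwards [eventually_toInfty r ℓ 1, eventually_one_le_div (by omega) h hZ,
    hp.eventually (gt_mem_nhds (show (0 : ℝ) < 1 / 2 by norm_num))] with n hn hq hq1
  have hn1 : (1 : ℝ) ≤ n := by exact_mod_cast hn.1
  have h2 := pathSeries_le (show 0 < ℓ by omega) h n
    (show 1 / 2 ≤ c n by linarith [hq.2])
  have h3 : (n : ℝ) ^ (2 - (ℓ : ℤ)) ≤ 1 / (n : ℝ) := by
    rw [one_div, ← zpow_neg_one]
    exact zpow_le_zpow_right₀ hn1 (by omega)
  have h4 : (n : ℝ) ^ (2 - (ℓ : ℤ)) / ((r : ℝ) - ℓ) ^ 2 ≤ 1 / (n : ℝ) :=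
    (div_le_self (by positivity) (one_le_pow₀ hs)).trans h3
  rw [pathSum_eq, mul_comm]
  exact mul_le_mul h2 h4 (by positivity) (by positivity)

end Final

end RandomHypergraph

open RandomHypergraph in
theorem mainTheorem4 (r ℓ : ℕ) (hℓ : 2 ≤ ℓ) (hr : ℓ < r)
    (p : ℕ → unitInterval) (c : ℕ → ℝ) (B : ℝ)
    (hc : ∀ n, 0 < c n ∧ c n ≤ B)
    -- `p = (c + o(1)) p^*`
    (hp : Filter.Tendsto (fun n => (p n : ℝ) / threshold r ℓ n - c n) (toInfty r ℓ) (nhds 0))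
    (hZ : Filter.Tendsto (fun n => firstMoment r ℓ n (p n)) (toInfty r ℓ) Filter.atTop) :
    -- the second moment through the overlap distribution
    (∀ n : ℕ, (r - ℓ) ∣ n → r < n → 0 < p n →
      momentRatio r ℓ n (p n) =
        ∑ t ∈ Finset.range (n / (r - ℓ) + 1), overlapProb r ℓ n t / (p n : ℝ) ^ t) ∧
    -- the upper bound, with the contribution of order `1 / E[Z]` of (nearly) equal cycles
    (∃ ε : ℕ → ℝ, Filter.Tendsto ε (toInfty r ℓ) (nhds 0) ∧ ∃ K : ℝ,
      ∀ᶠ n in toInfty r ℓ, momentRatio r ℓ n (p n) ≤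
        Real.exp ((1 + ε n) * pathSum r ℓ n (c n)) + K / firstMoment r ℓ n (p n)) ∧
    -- the upper bound without that contribution, when `E[Z]` exceeds the order of `n ^ (ℓ - 2)`
    (Filter.Tendsto (fun n : ℕ => (n : ℝ) ^ (2 - (ℓ : ℤ)) * firstMoment r ℓ n (p n))
        (toInfty r ℓ) Filter.atTop →
      ∃ ε : ℕ → ℝ, Filter.Tendsto ε (toInfty r ℓ) (nhds 0) ∧
        ∀ᶠ n in toInfty r ℓ, momentRatio r ℓ n (p n) ≤
          Real.exp ((1 + ε n) * pathSum r ℓ n (c n))) ∧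
    (3 ≤ ℓ → Filter.Tendsto (fun n => momentRatio r ℓ n (p n)) (toInfty r ℓ) (nhds 1)) := by
  have hB : 0 < B := (hc 0).1.trans_le (hc 0).2
  have hs := one_le_cast_s hr
  obtain ⟨K₁, K₂, hK₁, hK₂, hmain⟩ := eventually_momentRatio_le hℓ hr hc hp hZ
  have herr := tendsto_error (r := r) (ℓ := ℓ) K₁ hp
  refine ⟨?_, ⟨_, herr, K₂, hmain⟩, ?_, ?_⟩
  · rintro n ⟨m, hm⟩ hrn hpn
    exact momentRatio_eq_sum_overlapProb hr (m := m) (by rw [hm, mul_comm]) hrn hpn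
  · intro hZ'
    have hc0 := seriesConst_pos r ℓ hB
    set κ := K₂ * (((r : ℝ) - ℓ) ^ 2 / seriesConst r ℓ B) with hκ
    have h1 := herr.add (hZ'.inv_tendsto_atTop.const_mul κ)
    rw [mul_zero, add_zero] at h1
    refine ⟨_, h1, ?_⟩
    filter_upwards [hmain, eventually_toInfty r ℓ 3, hZ.eventually_gt_atTop 0] with n hn hn3 hpos
    refine hn.trans ?_
    have hn0 : (0 : ℝ) < n := by exact_mod_cast (show 0 < n by omega)
    set η := |(p n : ℝ) / threshold r ℓ n - c n| + 1 / √(n : ℝ)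
    have hη : 0 ≤ η := by positivity
    have hΦ := pathSum_nonneg hr n (hc n).1
    have hT := seriesConst_le (r := r) (ℓ := ℓ) hn3.1 (hc n).1 (hc n).2
    have hD : 0 < (n : ℝ) ^ (2 - (ℓ : ℤ)) := by positivity
    -- `n ^ (2 - ℓ)` is at most a constant times `pathSum`, so `1 / E[Z]` is at most `pathSum` times
    -- a quantity tending to 0, which is added to the error in the exponent.
    have h2 : K₂ / firstMoment r ℓ n (p n) ≤
        κ * ((n : ℝ) ^ (2 - (ℓ : ℤ)) * firstMoment r ℓ n (p n))⁻¹ * pathSum r ℓ n (c n) := by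
      rw [pathSum_eq, hκ]
      have h3 : K₂ * (((r : ℝ) - ℓ) ^ 2 / seriesConst r ℓ B) *
          ((n : ℝ) ^ (2 - (ℓ : ℤ)) * firstMoment r ℓ n (p n))⁻¹ *
          ((n : ℝ) ^ (2 - (ℓ : ℤ)) / ((r : ℝ) - ℓ) ^ 2 * pathSeries r ℓ n (c n)) =
          K₂ / firstMoment r ℓ n (p n) * (pathSeries r ℓ n (c n) / seriesConst r ℓ B) := by
        have : (r : ℝ) - ℓ ≠ 0 := by linarith
        field_simp
      rw [h3]
      exact le_mul_of_one_le_right (by positivity) ((one_le_div hc0).2 hT)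
    set w := κ * ((n : ℝ) ^ (2 - (ℓ : ℤ)) * firstMoment r ℓ n (p n))⁻¹ * pathSum r ℓ n (c n)
      with hw
    have hw0 : 0 ≤ w := le_trans (by positivity) h2
    have h4 : 1 ≤ Real.exp ((1 + K₁ * η) * pathSum r ℓ n (c n)) :=
      Real.one_le_exp (by positivity)
    have h5 := Real.add_one_le_exp w
    have h6 : Real.exp ((1 + (K₁ * η +
        κ * ((n : ℝ) ^ (2 - (ℓ : ℤ)) * firstMoment r ℓ n (p n))⁻¹)) * pathSum r ℓ n (c n)) =
        Real.exp ((1 + K₁ * η) * pathSum r ℓ n (c n)) * Real.exp w := by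
      rw [← Real.exp_add, hw]
      congr 1
      ring
    refine le_trans ?_ h6.ge
    nlinarith
  · intro hℓ3
    have hΦ := tendsto_pathSum hℓ3 hr hc hp hZ
    have h1 : Filter.Tendsto (fun n =>
        Real.exp ((1 + K₁ * (|(p n : ℝ) / threshold r ℓ n - c n| + 1 / √(n : ℝ))) *
          pathSum r ℓ n (c n)) + K₂ / firstMoment r ℓ n (p n)) (toInfty r ℓ) (nhds 1) := by
      have h2 := (herr.const_add 1).mul hΦ
      rw [mul_zero] at h2
      have h3 := (Real.continuous_exp.tendsto 0).comp h2
      rw [Real.exp_zero] at h3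
      have h4 := h3.add (hZ.const_div_atTop K₂)
      rw [add_zero] at h4
      exact h4
    -- The ratio is squeezed between 1 and a bound whose exponent and `1 / E[Z]` term both vanish.
    refine tendsto_of_tendsto_of_tendsto_of_le_of_le' tendsto_const_nhds h1 ?_ hmain
    filter_upwards [eventually_toInfty r ℓ (2 * r), eventually_one_le_div hℓ hr hZ] with n hn hq
    obtain ⟨hN, m, hnm⟩ := hn
    exact one_le_momentRatio hr hnm (by omega) hq.1
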